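/- Let $\kappa(x,y)=c_0/(|x-y|^{\Delta}+c_1)$ be a small-world kernel on $[0,1]$, where $\Delta>1$ and $0<c_0\le c_1$ (so $\kappa$ takes values in $(0,1]$), and let $\mathcal D$ be a probability distribution on $[0,1]$. Let $\mathcal K f(x)=\int\kappa(x,y)f(y)\,d\mathcal D(y)$ on $L^2(\mathcal D)$, assume that $\mathcal K$ has no negative eigenvalue, let $\lambda_1\ge\lambda_2\ge\cdots\ge 0$ be its eigenvalues with multiplicity (continued by zeros), and put $\delta_d=\lambda_d-\lambda_{d+1}$. Let $C(n)$ satisfy $C(n)\ge 1$ for all large $n$ and put $\rho(n)=n/C(n)$. In the simplified model on $n$ nodes, $x_1,\dots,x_n$ are i.i.d. from $\mathcal D$ and, given these, the entries $A_{ij}=A_{ji}\in\{0,1\}$, $i\le j$, of the adjacency matrix $A$ are independent with $\Pr[A_{ij}=1]=\kappa(x_i,x_j)/C(n)$. Let $K=(\kappa(x_i,x_j))_{i,j\le n}$ be the Gram matrix. For $M\in\{A,K\}$ let $\tilde U_M\tilde S_M\tilde V_M^{\mathsf T}$ be any singular value decomposition of $M$ with singular values in decreasing order; for $d\le n$ let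 $U_M$ consist of the first $d$ columns of $\tilde U_M$, and let $S_M$ be the $d\times d$ diagonal matrix of the $d$ largest singular values. Let $t=t(n)>0$ satisfy $t=o(\rho(n))$ and $t^2/\rho(n)=\omega(\log n)$, and suppose $\rho(n)=\omega(\log n)$. Let $d$ be the largest $d\in\{1,\dots,n\}$ with $\sigma_d(A/\rho(n))-\sigma_{d+1}(A/\rho(n))\ge 10\,(t/\rho(n))^{2/29}$, where $\sigma_i$ denotes the $i$-th largest singular value and $\sigma_{n+1}=0$. Then there is a constant $M_0>0$, depending only on $\kappa$ and $\mathcal D$, such that for every $c$ and all sufficiently large $n$, with probability larger than $1-n^{-c}$ the following holds: $d$ is well defined, $\delta_d>0$, and for every choice of the singular value decompositions there is an orthogonal $d\times d$ matrix $W$ with $$\left\|\sqrt{C(n)}\,U_AS_A^{1/2}W-U_KS_K^{1/2}\right\|_F\le M_0\,\frac{t\sqrt{dn}}{\delta_d^2\,\rho(n)} .$$ -/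

import Mathlib

open MeasureTheory ProbabilityTheory Filter Asymptotics
open scoped unitInterval Matrix

namespace LatentGraph

noncomputable section

/-- Parameters of a small-world kernel `κ(x, y) = c₀ / (|x - y| ^ Δ + c₁)` on `[0, 1]` with
`Δ > 1`; the condition `c₀ ≤ c₁` says that `κ` takes its values in `(0, 1]`. -/
structure SmallWorldKernel where
  c₀ : ℝ
  c₁ : ℝ
  Δ : ℝ
  c₀_pos : 0 < c₀
  c₀_le_c₁ : c₀ ≤ c₁
  one_lt_Δ : 1 < Δ

namespace SmallWorldKernel

/-- The kernel function `κ : [0, 1] × [0, 1] → (0, 1]`. -/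
def val (κ : SmallWorldKernel) (x y : I) : ℝ :=
  κ.c₀ / (|(x : ℝ) - (y : ℝ)| ^ κ.Δ + κ.c₁)

theorem denom_pos (κ : SmallWorldKernel) (x y : I) :
    0 < |(x : ℝ) - (y : ℝ)| ^ κ.Δ + κ.c₁ :=
  add_pos_of_nonneg_of_pos (Real.rpow_nonneg (abs_nonneg _) _) (κ.c₀_pos.trans_le κ.c₀_le_c₁)

theorem val_pos (κ : SmallWorldKernel) (x y : I) : 0 < κ.val x y :=
  div_pos κ.c₀_pos (κ.denom_pos x y)

theorem val_le_one (κ : SmallWorldKernel) (x y : I) : κ.val x y ≤ 1 := by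
  refine (div_le_one (κ.denom_pos x y)).2 (κ.c₀_le_c₁.trans ?_)
  exact le_add_of_nonneg_left (Real.rpow_nonneg (abs_nonneg _) _)

theorem val_comm (κ : SmallWorldKernel) (x y : I) : κ.val x y = κ.val y x := by
  unfold val
  rw [abs_sub_comm]

theorem continuous_val (κ : SmallWorldKernel) :
    Continuous (fun q : I × I => κ.val q.1 q.2) := by
  unfold val
  refine Continuous.div continuous_const ?_ (fun q => (κ.denom_pos q.1 q.2).ne')
  refine Continuous.add (Continuous.rpow_const (by fun_prop) ?_) continuous_const
  exact fun _ => Or.inr (zero_le_one.trans κ.one_lt_Δ.le)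

theorem integrable_val_mul (κ : SmallWorldKernel) (D : Measure I) [IsProbabilityMeasure D]
    (f : Lp ℝ 2 D) (x : I) : Integrable (fun y => κ.val x y * f y) D := by
  refine Integrable.bdd_mul (c := 1) ((Lp.memLp f).integrable one_le_two) ?_ ?_
  · exact (κ.continuous_val.comp (by fun_prop : Continuous fun y : I => (x, y))).aestronglyMeasurable
  · refine Eventually.of_forall fun y => ?_
    rw [Real.norm_of_nonneg (κ.val_pos x y).le]
    exact κ.val_le_one x y

theorem memLp_integral (κ : SmallWorldKernel) (D : Measure I) [IsProbabilityMeasure D]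
    (f : Lp ℝ 2 D) : MemLp (fun x => ∫ y, κ.val x y * f y ∂D) 2 D := by
  refine MemLp.of_bound (C := ∫ y, ‖f y‖ ∂D) ?_ (Eventually.of_forall fun x => ?_)
  · refine StronglyMeasurable.aestronglyMeasurable ?_
    refine StronglyMeasurable.integral_prod_right (f := fun x y => κ.val x y * f y) ?_
    exact κ.continuous_val.stronglyMeasurable.mul
      ((Lp.stronglyMeasurable f).comp_measurable measurable_snd)
  · refine norm_integral_le_of_norm_le ((Lp.memLp f).integrable one_le_two).norm
      (Eventually.of_forall fun y => ?_)
    rw [norm_mul, Real.norm_of_nonneg (κ.val_pos x y).le]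
    exact mul_le_of_le_one_left (norm_nonneg _) (κ.val_le_one x y)

/-- The integral operator `𝒦 f(x) = ∫ κ(x, y) f(y) dD(y)` on `L²(D)`. -/
def integralOperator (κ : SmallWorldKernel) (D : Measure I) [IsProbabilityMeasure D] :
    Module.End ℝ (Lp ℝ 2 D) where
  toFun f := (κ.memLp_integral D f).toLp
  map_add' f g := by
    rw [← MemLp.toLp_add]
    refine MemLp.toLp_congr _ _ (Eventually.of_forall fun x => ?_)
    simp only [Pi.add_apply]
    rw [← integral_add (κ.integrable_val_mul D f x) (κ.integrable_val_mul D g x)]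
    refine integral_congr_ae ?_
    filter_upwards [Lp.coeFn_add f g] with y hy
    rw [hy, Pi.add_apply, mul_add]
  map_smul' a f := by
    rw [RingHom.id_apply, ← MemLp.toLp_const_smul]
    refine MemLp.toLp_congr _ _ (Eventually.of_forall fun x => ?_)
    simp only [Pi.smul_apply, smul_eq_mul]
    rw [← integral_const_mul]
    refine integral_congr_ae ?_
    filter_upwards [Lp.coeFn_smul a f] with y hy
    rw [hy, Pi.smul_apply, smul_eq_mul]
    ring

end SmallWorldKernel

/-- `lam 0 ≥ lam 1 ≥ ⋯ ≥ 0` is the list of the eigenvalues of `T`, repeated according to their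
multiplicity and continued by zeros if there are only finitely many nonzero ones. (In particular
`T` has no negative eigenvalue.) -/
structure IsEigenvalueSequence {E : Type} [AddCommGroup E] [Module ℝ E] (T : Module.End ℝ E)
    (lam : ℕ → ℝ) : Prop where
  antitone : Antitone lam
  nonneg : ∀ i, 0 ≤ lam i
  multiplicity : ∀ μ : ℝ, μ ≠ 0 → Cardinal.mk {i // lam i = μ} = Module.rank ℝ (T.eigenspace μ)

/-- The eigengap `δ_d = λ_d - λ_{d+1}` for `d ≥ 1`, where `λ_i` is `lam (i - 1)`. -/
def eigengap (lam : ℕ → ℝ) (d : ℕ) : ℝ := lam (d - 1) - lam d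

/-- The Gram matrix `K` with entries `κ(x_i, x_j)`. -/
def gramMatrix (κ : SmallWorldKernel) {n : ℕ} (x : Fin n → I) : Matrix (Fin n) (Fin n) ℝ :=
  Matrix.of fun i j => κ.val (x i) (x j)

/-- The probability `κ(x_i, x_j) / C` of the edge `{i, j}`. The projection to `[0, 1]` does nothing
when `C ≥ 1`. -/
def edgeProb (κ : SmallWorldKernel) (C : ℝ) {n : ℕ} (x : Fin n → I) (e : Sym2 (Fin n)) : I :=
  Set.projIcc 0 1 zero_le_one
    (Sym2.lift ⟨fun i j => κ.val (x i) (x j) / C, fun i j => by simp only [κ.val_comm]⟩ e)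

theorem continuous_edgeProb (κ : SmallWorldKernel) (C : ℝ) {n : ℕ} (e : Sym2 (Fin n)) :
    Continuous (fun x : Fin n → I => edgeProb κ C x e) := by
  induction e using Sym2.ind with
  | _ i j =>
    refine continuous_projIcc.comp ?_
    exact (κ.continuous_val.comp
      (by fun_prop : Continuous fun x : Fin n → I => (x i, x j))).div_const C

/-- Given the latent positions `x`, the edges are independent and `e` is present with probability
`edgeProb κ C x e`. -/
def edgeKernel (κ : SmallWorldKernel) (C : ℝ) (n : ℕ) :
    Kernel (Fin n → I) (Sym2 (Fin n) → Bool) where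
  toFun x := Measure.pi fun e => bernoulliMeasure true false (edgeProb κ C x e)
  measurable' := by
    refine Measurable.measure_of_isPiSystem_of_isProbabilityMeasure
      (S := Set.univ.pi '' Set.univ.pi fun _ : Sym2 (Fin n) => {s : Set Bool | MeasurableSet s})
      generateFrom_pi.symm isPiSystem_pi ?_
    rintro _ ⟨s, hs, rfl⟩
    simp only [Measure.pi_pi]
    refine Finset.measurable_prod _ fun e _ => ?_
    have hm : Measurable fun x : Fin n → I => edgeProb κ C x e :=
      (continuous_edgeProb κ C e).measurable
    have h1 : Measurable fun x : Fin n → I => unitInterval.toNNReal (edgeProb κ C x e) :=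
      unitInterval.toNNReal_continuous.measurable.comp hm
    have h2 : Measurable fun x : Fin n → I =>
        unitInterval.toNNReal (unitInterval.symm (edgeProb κ C x e)) :=
      (unitInterval.toNNReal_continuous.comp unitInterval.continuous_symm).measurable.comp hm
    simp only [bernoulliMeasure_def, Measure.add_apply, Measure.smul_apply, ENNReal.smul_def,
      smul_eq_mul]
    exact (h1.coe_nnreal_ennreal.mul_const _).add (h2.coe_nnreal_ennreal.mul_const _)

instance (κ : SmallWorldKernel) (C : ℝ) (n : ℕ) : IsMarkovKernel (edgeKernel κ C n) :=
  ⟨fun x => (inferInstance : IsProbabilityMeasure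
    (Measure.pi fun e => bernoulliMeasure true false (edgeProb κ C x e)))⟩

/-- The law of `(x, e)` in the simplified model on `n` nodes: the latent positions `x_1, …, x_n` are
i.i.d. from `D` and, given `x`, the edges are independent and `{i, j}` (`i ≤ j`) is present with
probability `κ(x_i, x_j) / C`. -/
def modelLaw (κ : SmallWorldKernel) (D : Measure I) [IsProbabilityMeasure D] (C : ℝ) (n : ℕ) :
    Measure ((Fin n → I) × (Sym2 (Fin n) → Bool)) :=
  (Measure.pi fun _ => D) ⊗ₘ edgeKernel κ C n

/-- The symmetric `0/1` adjacency matrix. -/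
def adjacency {n : ℕ} (e : Sym2 (Fin n) → Bool) : Matrix (Fin n) (Fin n) ℝ :=
  Matrix.of fun i j => if e s(i, j) then 1 else 0

/-- The `i`-th largest singular value of a square matrix, `i = 1, 2, …`; it is `0` for `i > n`. -/
def singularValue {n : ℕ} (M : Matrix (Fin n) (Fin n) ℝ) (i : ℕ) : ℝ :=
  (Matrix.toEuclideanLin M).singularValues (i - 1)

/-- `M = U S Vᵀ` is a singular value decomposition, where `S` is the diagonal matrix of the singular
values of `M` in decreasing order. -/
def IsSVD {n : ℕ} (M U V : Matrix (Fin n) (Fin n) ℝ) : Prop :=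
  U ∈ Matrix.orthogonalGroup (Fin n) ℝ ∧ V ∈ Matrix.orthogonalGroup (Fin n) ℝ ∧
    M = U * Matrix.diagonal (fun i : Fin n => singularValue M (i + 1)) * Vᵀ

/-- The output `d` of the rule `DecideThreshold(t, ρ)`: the largest `d` for which
`λ_d(A/ρ) - λ_{d+1}(A/ρ) ≥ 10 (t/ρ)^(2/29)`, with `λ_i` the `i`-th singular value. -/
def IsThresholdIndex {n : ℕ} (A : Matrix (Fin n) (Fin n) ℝ) (t ρ : ℝ) (d : ℕ) : Prop :=
  IsGreatest {k : ℕ | 1 ≤ k ∧ k ≤ n ∧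
    10 * (t / ρ) ^ (2 / 29 : ℝ) ≤
      singularValue (ρ⁻¹ • A) k - singularValue (ρ⁻¹ • A) (k + 1)} d

/-- `U_M S_M^{1/2}`: the first `d` columns of the matrix `U` of left singular vectors of `M`, the
`j`-th one multiplied by the square root of the `j`-th singular value. -/
def topEmbedding {n d : ℕ} (h : d ≤ n) (M U : Matrix (Fin n) (Fin n) ℝ) :
    Matrix (Fin n) (Fin d) ℝ :=
  U.submatrix id (Fin.castLE h) *
    Matrix.diagonal (fun j : Fin d => √(singularValue M (j + 1)))

open scoped Matrix.Norms.Frobenius in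
/-- The Frobenius norm. -/
def frobeniusNorm {m n : ℕ} (M : Matrix (Fin m) (Fin n) ℝ) : ℝ := ‖M‖

end

end LatentGraph

set_option linter.unusedSectionVars false

/-! Normalize both matrices: `P = A/ρ` and `Q = K/n`, and put `ε = t/ρ`, `h = ε^(2/29)`. Two events
of overwhelming probability suffice; everything on them is deterministic.

Noise. Given the latent positions, `A - K/C` is a centered Bernoulli sum of symmetric matrices whose
squares are diagonal. Its even trace moments are bounded by the method of exchangeable pairs: one
edge is resampled, the resulting difference of powers is controlled by a trace inequality for two
symmetric matrices, and Young's inequality absorbs the remaining power. With moment order `2s`, `s`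
of size `log n`, Markov's inequality gives operator norm at most `t`, so `‖P - Q‖ ≤ ε`.

Spectrum. The kernel is Lipschitz, so it is nearly constant on products of cells of length `1/m`. Up
to small errors in the quadratic form, the integral operator and `Q` are both the same `m × m`
matrix, once with the true cell masses and once with the empirical ones; Hoeffding's inequality
makes these close. A max-min argument (`hasFormBound_comparison`, `singularValues_scaledGram_close`)
shows that the singular values of `Q` are within `h` of the eigenvalues `lam` and that `Q` is almost
positive. Almost positivity passes to `P` and turns every sufficiently large singular vector into an
eigenvector, so any singular value decomposition can be used.

Threshold. The singular values of `P` are within `2h` of `lam`, so a gap of at least `10h` in `P`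
forces `eigengap lam d ≥ 6h`, while a fixed positive gap of `lam` is eventually at least `14h` and
is seen in `P`. Hence `d` exists.

Alignment. Each leading eigenvector of `Q` is an approximate eigenvector of `P` with residual `ε`,
so it lies within `2ε/δ` of the leading eigenspace of `P`. The matrix of inner products is therefore
nearly orthogonal and `W` is its polar factor; a perturbation bound for the square root handles the
weights (`exists_orthogonal_alignment`). This needs `d (2ε/δ)² < 1`, which follows from `ε ≤ h³` and
from `(d-1) δ ≤ 2 κ.lip`. The argument produces only one factor `1/δ`; the second is inserted by `δ
≤ lam 0`. -/

namespace LatentGraph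

/-! ### Trace inequalities for powers of symmetric matrices. -/

section TraceInequality

theorem pow_mul_pow_add_le {a b : ℝ} (ha : 0 ≤ a) (hb : 0 ≤ b) (r s : ℕ) :
    a ^ r * b ^ s + a ^ s * b ^ r ≤ a ^ (r + s) + b ^ (r + s) := by
  have h : 0 ≤ (a ^ r - b ^ r) * (a ^ s - b ^ s) := by
    rcases le_total a b with h | h
    · exact mul_nonneg_of_nonpos_of_nonpos (sub_nonpos.2 (pow_le_pow_left₀ ha h r))
        (sub_nonpos.2 (pow_le_pow_left₀ ha h s))
    · exact mul_nonneg (sub_nonneg.2 (pow_le_pow_left₀ hb h r))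
        (sub_nonneg.2 (pow_le_pow_left₀ hb h s))
  have e : (a ^ r - b ^ r) * (a ^ s - b ^ s) =
      a ^ (r + s) + b ^ (r + s) - (a ^ r * b ^ s + a ^ s * b ^ r) := by ring
  linarith

/-- The terms `r` and `2q - r` are paired, each pair being bounded by rearrangement. The total
degree is even, so absolute values disappear. -/
theorem sum_pow_mul_pow_le (y z : ℝ) (q : ℕ) :
    ∑ r ∈ Finset.range (2 * q + 1), y ^ r * z ^ (2 * q - r) ≤
      (2 * q + 1) / 2 * (y ^ (2 * q) + z ^ (2 * q)) := by
  have h1 := Finset.sum_range_reflect (fun r => y ^ r * z ^ (2 * q - r)) (2 * q + 1)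
  have h2 : ∑ r ∈ Finset.range (2 * q + 1), (y ^ r * z ^ (2 * q - r) +
      y ^ (2 * q + 1 - 1 - r) * z ^ (2 * q - (2 * q + 1 - 1 - r))) ≤
      ∑ r ∈ Finset.range (2 * q + 1), (y ^ (2 * q) + z ^ (2 * q)) := by
    refine Finset.sum_le_sum fun r hr => ?_
    have hr' : r ≤ 2 * q := Nat.lt_succ_iff.1 (Finset.mem_range.1 hr)
    have e1 : 2 * q + 1 - 1 - r = 2 * q - r := by omega
    have e2 : 2 * q - (2 * q - r) = r := by omega
    have e3 : r + (2 * q - r) = 2 * q := by omega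
    have h := pow_mul_pow_add_le (abs_nonneg y) (abs_nonneg z) r (2 * q - r)
    rw [e3, (even_two_mul q).pow_abs, (even_two_mul q).pow_abs] at h
    rw [e1, e2]
    refine le_trans (add_le_add ?_ ?_) h
    all_goals
      rw [← abs_pow, ← abs_pow, ← abs_mul]
      exact le_abs_self _
  rw [Finset.sum_add_distrib, h1, Finset.sum_const, Finset.card_range, nsmul_eq_mul] at h2
  push_cast at h2
  linarith

/-- Young's inequality with exponents `q + 1` and `(q + 1) / q`, cleared of denominators so that
induction proves it. -/
theorem succ_mul_mul_pow_le {a y : ℝ} (ha : 0 ≤ a) (hy : 0 ≤ y) (q : ℕ) :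
    (q + 1) * (a * y ^ q) ≤ a ^ (q + 1) + q * y ^ (q + 1) := by
  induction q with
  | zero => simp
  | succ q ih =>
    have h := pow_mul_pow_add_le ha hy 1 (q + 1)
    have h' := mul_le_mul_of_nonneg_right ih hy
    push_cast
    have e1 : a ^ (1 + (q + 1)) = a ^ (q + 1 + 1) := by ring
    have e2 : y ^ (1 + (q + 1)) = y ^ (q + 1 + 1) := by ring
    rw [e1, e2, pow_one, pow_one] at h
    have e3 : (q + 1) * (a * y ^ q) * y = (q + 1) * (a * y ^ (q + 1)) := by ring
    have e4 : (a ^ (q + 1) + q * y ^ (q + 1)) * y = a ^ (q + 1) * y + q * y ^ (q + 1 + 1) := by ring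
    rw [e3, e4] at h'
    linarith

theorem pow_succ_sub_pow_succ {R : Type*} [Ring R] (Y Z : R) (m : ℕ) :
    Y ^ (m + 1) - Z ^ (m + 1) = ∑ r ∈ Finset.range (m + 1), Y ^ r * (Y - Z) * Z ^ (m - r) := by
  induction m with
  | zero => simp
  | succ m ih =>
    rw [Finset.sum_range_succ, Nat.sub_self, pow_zero, mul_one]
    have : ∑ r ∈ Finset.range (m + 1), Y ^ r * (Y - Z) * Z ^ (m + 1 - r) =
        (∑ r ∈ Finset.range (m + 1), Y ^ r * (Y - Z) * Z ^ (m - r)) * Z := by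
      rw [Finset.sum_mul]
      refine Finset.sum_congr rfl fun r hr => ?_
      have : m + 1 - r = (m - r) + 1 := by have := Finset.mem_range.1 hr; omega
      rw [this, pow_succ, mul_assoc, mul_assoc, mul_assoc]
    rw [this, ← ih, pow_succ Y (m + 1), pow_succ Z (m + 1)]
    noncomm_ring

variable {N : Type*} [Fintype N] [DecidableEq N]

theorem exists_orthogonal_diagonalization {Y : Matrix N N ℝ} (hY : Y.IsSymm) :
    ∃ (U : Matrix N N ℝ) (y : N → ℝ), Uᵀ * U = 1 ∧ U * Uᵀ = 1 ∧
      ∀ r : ℕ, Y ^ r = U * Matrix.diagonal (fun i => y i ^ r) * Uᵀ := by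
  have hH : Y.IsHermitian := by
    rw [Matrix.IsHermitian, Matrix.conjTranspose_eq_transpose_of_trivial]; exact hY
  set U : Matrix N N ℝ := (hH.eigenvectorUnitary).1 with hU
  have h1 : Uᵀ * U = 1 := by
    have := Unitary.coe_star_mul_self hH.eigenvectorUnitary
    rwa [Matrix.star_eq_conjTranspose, Matrix.conjTranspose_eq_transpose_of_trivial] at this
  have h2 : U * Uᵀ = 1 := mul_eq_one_comm.1 h1
  have h3 : Y = U * Matrix.diagonal hH.eigenvalues * Uᵀ := by
    have := hH.spectral_theorem
    rw [Unitary.conjStarAlgAut_apply] at this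
    rw [Matrix.star_eq_conjTranspose, Matrix.conjTranspose_eq_transpose_of_trivial] at this
    exact this
  generalize hH.eigenvalues = y at h3
  refine ⟨U, y, h1, h2, fun r => ?_⟩
  induction r with
  | zero => simp [h2]
  | succ r ih =>
    rw [pow_succ, ih, h3]
    calc U * Matrix.diagonal (fun i => y i ^ r) * Uᵀ *
          (U * Matrix.diagonal y * Uᵀ)
        = U * (Matrix.diagonal (fun i => y i ^ r) * (Uᵀ * U) *
          Matrix.diagonal y) * Uᵀ := by simp only [Matrix.mul_assoc]
      _ = _ := by
        rw [h1, mul_one, Matrix.diagonal_mul_diagonal]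
        simp only [pow_succ]

theorem trace_mul_diagonal_mul_transpose_mul_diagonal (G : Matrix N N ℝ) (y z : N → ℝ) :
    (G * Matrix.diagonal y * Gᵀ * Matrix.diagonal z).trace =
      ∑ j, ∑ k, G j k ^ 2 * (y k * z j) := by
  simp only [Matrix.trace, Matrix.diag, Matrix.mul_diagonal, Matrix.mul_apply (M := G * _),
    Matrix.transpose_apply, Finset.sum_mul]
  exact Finset.sum_congr rfl fun j _ => Finset.sum_congr rfl fun k _ => by ring

/-- For real symmetric `H`, `Y`, `Z`, the sum of the traces of `H Y^r H Z^(2q-r)` is controlled by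
the traces of `H² Y^(2q)` and `H² Z^(2q)`. -/
theorem sum_trace_mul_pow_mul_pow_le {H Y Z : Matrix N N ℝ} (hH : H.IsSymm) (hY : Y.IsSymm)
    (hZ : Z.IsSymm) (q : ℕ) :
    ∑ r ∈ Finset.range (2 * q + 1), (H * Y ^ r * H * Z ^ (2 * q - r)).trace ≤
      (2 * q + 1) / 2 * ((H * H * Y ^ (2 * q)).trace + (H * H * Z ^ (2 * q)).trace) := by
  obtain ⟨U, y, hU1, hU2, hUy⟩ := exists_orthogonal_diagonalization hY
  obtain ⟨V, z, hV1, hV2, hVz⟩ := exists_orthogonal_diagonalization hZ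
  set G := Vᵀ * H * U with hG
  have hGt : Gᵀ = Uᵀ * H * V := by
    rw [hG]; simp [Matrix.transpose_mul, hH.eq, Matrix.mul_assoc]
  -- In eigenbases of `Y` and `Z` every mixed trace is a sum of scalar monomials with the same
  -- nonnegative weights `G j k ^ 2`, so the scalar inequality applies termwise.
  have key : ∀ r s : ℕ, (H * Y ^ r * H * Z ^ s).trace =
      ∑ j, ∑ k, G j k ^ 2 * (y k ^ r * z j ^ s) := by
    intro r s
    rw [← trace_mul_diagonal_mul_transpose_mul_diagonal G (fun i => y i ^ r) (fun i => z i ^ s),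
      hGt, hG, hUy, hVz]
    calc (H * (U * Matrix.diagonal (fun i => y i ^ r) * Uᵀ) * H *
          (V * Matrix.diagonal (fun i => z i ^ s) * Vᵀ)).trace
        = ((H * U * Matrix.diagonal (fun i => y i ^ r) * Uᵀ * H *
          V * Matrix.diagonal (fun i => z i ^ s)) * Vᵀ).trace := by simp only [Matrix.mul_assoc]
      _ = _ := by rw [Matrix.trace_mul_comm]; simp only [Matrix.mul_assoc]
  have kY : (H * H * Y ^ (2 * q)).trace = ∑ j, ∑ k, G j k ^ 2 * y k ^ (2 * q) := by
    have := key (2 * q) 0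
    simp only [pow_zero, mul_one] at this
    rw [← this, Matrix.mul_assoc, Matrix.trace_mul_comm]
  have kZ : (H * H * Z ^ (2 * q)).trace = ∑ j, ∑ k, G j k ^ 2 * z j ^ (2 * q) := by
    have := key 0 (2 * q)
    simpa only [pow_zero, mul_one, one_mul] using this
  rw [kY, kZ, Finset.sum_congr rfl fun r _ => key r (2 * q - r), Finset.sum_comm,
    ← Finset.sum_add_distrib, Finset.mul_sum]
  refine Finset.sum_le_sum fun j _ => ?_
  rw [Finset.sum_comm, ← Finset.sum_add_distrib, Finset.mul_sum]
  refine Finset.sum_le_sum fun k _ => ?_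
  rw [← Finset.mul_sum, ← mul_add, mul_left_comm]
  exact mul_le_mul_of_nonneg_left (sum_pow_mul_pow_le _ _ _) (sq_nonneg _)

/-- A substitute for the derivative of the power map: telescoping the difference of powers brings
out a second factor `a • H`, and the mixed traces that remain are the ones just bounded. -/
theorem mul_sub_trace_mul_pow_sub_pow_le {H Y Z : Matrix N N ℝ} (hH : H.IsSymm) (hY : Y.IsSymm)
    (hZ : Z.IsSymm) {a : ℝ} (h : Y - Z = a • H) (q : ℕ) :
    a * (H * (Y ^ (2 * q + 1) - Z ^ (2 * q + 1))).trace ≤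
      a ^ 2 * ((2 * q + 1) / 2 * ((H * H * Y ^ (2 * q)).trace + (H * H * Z ^ (2 * q)).trace)) := by
  have e : (H * (Y ^ (2 * q + 1) - Z ^ (2 * q + 1))).trace =
      a * ∑ r ∈ Finset.range (2 * q + 1), (H * Y ^ r * H * Z ^ (2 * q - r)).trace := by
    rw [pow_succ_sub_pow_succ, h, Finset.mul_sum, Matrix.trace_sum, Finset.mul_sum]
    refine Finset.sum_congr rfl fun r _ => ?_
    simp only [Matrix.mul_smul, Matrix.smul_mul, Matrix.mul_assoc, Matrix.trace_smul, smul_eq_mul]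
  rw [e, ← mul_assoc, ← sq]
  exact mul_le_mul_of_nonneg_left (sum_trace_mul_pow_mul_pow_le hH hY hZ q) (sq_nonneg _)

/-- The trace is the squared Frobenius norm of `H * Y ^ q`. -/
theorem trace_mul_self_mul_pow_nonneg {H Y : Matrix N N ℝ} (hH : H.IsSymm) (hY : Y.IsSymm)
    (q : ℕ) : 0 ≤ (H * H * Y ^ (2 * q)).trace := by
  have e : H * H * Y ^ (2 * q) = H * (H * Y ^ q * Y ^ q) := by
    rw [two_mul, pow_add]; simp only [Matrix.mul_assoc]
  have hYq : (Y ^ q)ᵀ = Y ^ q := by rw [Matrix.transpose_pow, hY.eq]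
  have e2 : (H * H * Y ^ (2 * q)).trace = ((H * Y ^ q) * (H * Y ^ q)ᵀ).trace := by
    rw [e, Matrix.trace_mul_comm, Matrix.transpose_mul, hYq, hH.eq]
    simp only [Matrix.mul_assoc]
  rw [e2]
  simp only [Matrix.trace, Matrix.diag, Matrix.mul_apply (N := (_)ᵀ), Matrix.transpose_apply]
  exact Finset.sum_nonneg fun i _ => Finset.sum_nonneg fun j _ => mul_self_nonneg _

/-- Young's inequality for the trace of a nonnegative diagonal matrix against a power. -/
theorem succ_mul_trace_diagonal_mul_pow_le {Y : Matrix N N ℝ} (hY : Y.IsSymm) {D : N → ℝ}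
    (hD : ∀ k, 0 ≤ D k) (q : ℕ) :
    (q + 1) * (Matrix.diagonal D * Y ^ (2 * q)).trace ≤
      ∑ k, D k ^ (q + 1) + q * (Y ^ (2 * (q + 1))).trace := by
  obtain ⟨U, y, hU1, hU2, hUy⟩ := exists_orthogonal_diagonalization hY
  have ent : ∀ (r : ℕ) (k : N), (Y ^ r) k k = ∑ j, U k j ^ 2 * y j ^ r := by
    intro r k
    rw [hUy, Matrix.mul_apply]
    refine Finset.sum_congr rfl fun j _ => ?_
    rw [Matrix.mul_diagonal, Matrix.transpose_apply]; ring
  -- The diagonal entries of a power of `Y` are averages of powers of its eigenvalues with these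
  -- weights, which reduces the claim to scalars.
  have one : ∀ k, ∑ j, U k j ^ 2 = 1 := by
    intro k
    have := ent 0 k
    simpa using this.symm
  have eD : ∑ k, D k ^ (q + 1) = ∑ k, ∑ j, U k j ^ 2 * D k ^ (q + 1) :=
    Finset.sum_congr rfl fun k _ => by rw [← Finset.sum_mul, one, one_mul]
  rw [eD]
  simp only [Matrix.trace, Matrix.diag, Matrix.diagonal_mul, ent, Finset.mul_sum]
  rw [← Finset.sum_add_distrib]
  refine Finset.sum_le_sum fun k _ => ?_
  rw [← Finset.sum_add_distrib]
  refine Finset.sum_le_sum fun j _ => ?_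
  have := mul_le_mul_of_nonneg_left (succ_mul_mul_pow_le (hD k) (sq_nonneg (y j)) q)
    (sq_nonneg (U k j))
  rw [pow_mul, pow_mul]
  linarith

end TraceInequality

end LatentGraph

namespace LatentGraph

noncomputable section

/-! ### Moments of Bernoulli matrix sums by exchangeable pairs. -/

section BernoulliMoments

/-- The probability that a Bernoulli variable with parameter `p` takes the value `b`. -/
def coinWeight (p : ℝ) (b : Bool) : ℝ := if b then p else 1 - p

/-- The numerical value of a boolean. -/
def coinValue (b : Bool) : ℝ := if b then 1 else 0

theorem coinWeight_nonneg {p : ℝ} (h0 : 0 ≤ p) (h1 : p ≤ 1) (b : Bool) : 0 ≤ coinWeight p b := by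
  unfold coinWeight; split_ifs <;> linarith

theorem sum_coinWeight (p : ℝ) : ∑ b, coinWeight p b = 1 := by
  simp [coinWeight]

theorem coinValue_nonneg (b : Bool) : 0 ≤ coinValue b := by
  unfold coinValue; split_ifs <;> norm_num

variable {ι : Type*} [Fintype ι] [DecidableEq ι]

/-- The probability of the configuration `ω` under independent Bernoulli variables. -/
def prodWeight (p : ι → ℝ) (ω : ι → Bool) : ℝ := ∏ e, coinWeight (p e) (ω e)

/-- Expectation under independent Bernoulli variables with parameters `p`. -/
def coinExpect (p : ι → ℝ) (f : (ι → Bool) → ℝ) : ℝ := ∑ ω, prodWeight p ω * f ω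

/-- Expectation of `F ω ω'`, where `ω'` arises from `ω` by resampling the coordinate `e`. -/
def pairExpect (p : ι → ℝ) (e : ι) (F : (ι → Bool) → (ι → Bool) → ℝ) : ℝ :=
  ∑ ω, ∑ b, prodWeight p ω * coinWeight (p e) b * F ω (Function.update ω e b)

theorem prodWeight_nonneg {p : ι → ℝ} (h0 : ∀ e, 0 ≤ p e) (h1 : ∀ e, p e ≤ 1) (ω : ι → Bool) :
    0 ≤ prodWeight p ω :=
  Finset.prod_nonneg fun e _ => coinWeight_nonneg (h0 e) (h1 e) _

theorem prodWeight_update_mul (p : ι → ℝ) (ω : ι → Bool) (e : ι) (b : Bool) :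
    prodWeight p (Function.update ω e b) * coinWeight (p e) (ω e) =
      prodWeight p ω * coinWeight (p e) b := by
  unfold prodWeight
  rw [← Finset.mul_prod_erase _ _ (Finset.mem_univ e),
    ← Finset.mul_prod_erase Finset.univ (fun i => coinWeight (p i) (ω i)) (Finset.mem_univ e),
    Function.update_self]
  have : ∏ x ∈ Finset.univ.erase e, coinWeight (p x) (Function.update ω e b x) =
      ∏ x ∈ Finset.univ.erase e, coinWeight (p x) (ω x) :=
    Finset.prod_congr rfl fun x hx => by rw [Function.update_of_ne (Finset.ne_of_mem_erase hx)]
  rw [this]; ring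

/-- Exchangeability: trading the old value of the coordinate for the new one is an involution that
preserves the joint weight. -/
theorem pairExpect_swap (p : ι → ℝ) (e : ι) (F : (ι → Bool) → (ι → Bool) → ℝ) :
    pairExpect p e (fun ω ω' => F ω' ω) = pairExpect p e F := by
  unfold pairExpect
  rw [← Fintype.sum_prod_type', ← Fintype.sum_prod_type']
  let φ : (ι → Bool) × Bool → (ι → Bool) × Bool := fun x => (Function.update x.1 e x.2, x.1 e)
  have hφ : Function.Involutive φ := by
    rintro ⟨ω, b⟩
    simp [φ]
  rw [← Equiv.sum_comp hφ.toPerm]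
  refine Finset.sum_congr rfl fun x _ => ?_
  rcases x with ⟨ω, b⟩
  simp only [Function.Involutive.coe_toPerm, φ, Function.update_idem, Function.update_eq_self,
    prodWeight_update_mul]

theorem pairExpect_left (p : ι → ℝ) (e : ι) (f : (ι → Bool) → ℝ) (g : Bool → ℝ) :
    pairExpect p e (fun ω ω' => f ω * g (ω' e)) =
      coinExpect p (fun ω => f ω * ∑ b, coinWeight (p e) b * g b) := by
  unfold pairExpect coinExpect
  refine Finset.sum_congr rfl fun ω _ => ?_
  simp only [Finset.mul_sum, Function.update_self]
  exact Finset.sum_congr rfl fun b _ => by ring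

theorem pairExpect_add (p : ι → ℝ) (e : ι) (F G : (ι → Bool) → (ι → Bool) → ℝ) :
    pairExpect p e (fun ω ω' => F ω ω' + G ω ω') = pairExpect p e F + pairExpect p e G := by
  simp only [pairExpect, mul_add, Finset.sum_add_distrib]

theorem pairExpect_sub (p : ι → ℝ) (e : ι) (F G : (ι → Bool) → (ι → Bool) → ℝ) :
    pairExpect p e (fun ω ω' => F ω ω' - G ω ω') = pairExpect p e F - pairExpect p e G := by
  simp only [pairExpect, mul_sub, Finset.sum_sub_distrib]

theorem pairExpect_mono {p : ι → ℝ} (h0 : ∀ e, 0 ≤ p e) (h1 : ∀ e, p e ≤ 1) (e : ι)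
    {F G : (ι → Bool) → (ι → Bool) → ℝ}
    (h : ∀ ω b, F ω (Function.update ω e b) ≤ G ω (Function.update ω e b)) :
    pairExpect p e F ≤ pairExpect p e G :=
  Finset.sum_le_sum fun ω _ => Finset.sum_le_sum fun b _ => mul_le_mul_of_nonneg_left (h ω b)
    (mul_nonneg (prodWeight_nonneg h0 h1 ω) (coinWeight_nonneg (h0 e) (h1 e) b))

theorem coinExpect_mono {p : ι → ℝ} (h0 : ∀ e, 0 ≤ p e) (h1 : ∀ e, p e ≤ 1)
    {f g : (ι → Bool) → ℝ} (h : ∀ ω, f ω ≤ g ω) : coinExpect p f ≤ coinExpect p g :=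
  Finset.sum_le_sum fun ω _ => mul_le_mul_of_nonneg_left (h ω) (prodWeight_nonneg h0 h1 ω)

theorem coinExpect_sum {κ : Type*} (s : Finset κ) (p : ι → ℝ) (f : κ → (ι → Bool) → ℝ) :
    coinExpect p (fun ω => ∑ k ∈ s, f k ω) = ∑ k ∈ s, coinExpect p (f k) := by
  simp only [coinExpect, Finset.mul_sum]
  exact Finset.sum_comm

theorem coinExpect_const_mul (p : ι → ℝ) (a : ℝ) (f : (ι → Bool) → ℝ) :
    coinExpect p (fun ω => a * f ω) = a * coinExpect p f := by
  simp only [coinExpect, Finset.mul_sum]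
  exact Finset.sum_congr rfl fun ω _ => by ring

theorem coinExpect_add (p : ι → ℝ) (f g : (ι → Bool) → ℝ) :
    coinExpect p (fun ω => f ω + g ω) = coinExpect p f + coinExpect p g := by
  simp only [coinExpect, mul_add, Finset.sum_add_distrib]

/-- The expectation of a product of functions of the single coordinates. -/
theorem coinExpect_prod (p : ι → ℝ) (g : ι → Bool → ℝ) :
    coinExpect p (fun ω => ∏ e, g e (ω e)) = ∏ e, ∑ b, coinWeight (p e) b * g e b := by
  rw [Finset.prod_univ_sum, Fintype.piFinset_univ]
  simp only [coinExpect, prodWeight, Finset.prod_mul_distrib]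

variable {N : Type*} [Fintype N] [DecidableEq N]

/-- The centered matrix `∑ (ω e - p e) H e`. -/
def centeredSum (p : ι → ℝ) (H : ι → Matrix N N ℝ) (ω : ι → Bool) : Matrix N N ℝ :=
  ∑ e, (coinValue (ω e) - p e) • H e

theorem isSymm_centeredSum (p : ι → ℝ) {H : ι → Matrix N N ℝ} (hH : ∀ e, (H e).IsSymm)
    (ω : ι → Bool) : (centeredSum p H ω).IsSymm := by
  simp only [Matrix.IsSymm, centeredSum, Matrix.transpose_sum, Matrix.transpose_smul, (hH _).eq]

theorem centeredSum_sub_update (p : ι → ℝ) (H : ι → Matrix N N ℝ) (ω : ι → Bool) (e : ι)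
    (b : Bool) : centeredSum p H ω - centeredSum p H (Function.update ω e b) =
      (coinValue (ω e) - coinValue b) • H e := by
  unfold centeredSum
  rw [← Finset.sum_sub_distrib, Finset.sum_eq_single e]
  · rw [Function.update_self, ← sub_smul]; congr 1; ring
  · intro i _ hi
    rw [Function.update_of_ne hi, sub_self]
  · exact fun h => absurd (Finset.mem_univ e) h

/-- By exchangeability the left side is half the expectation of a product of two differences between
`ω` and its resampled copy; the trace inequality bounds that product by squares. -/
theorem coinExpect_coordinate_le {p : ι → ℝ} (h0 : ∀ e, 0 ≤ p e) (h1 : ∀ e, p e ≤ 1)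
    {H : ι → Matrix N N ℝ} (hH : ∀ e, (H e).IsSymm) (q : ℕ) (e : ι) :
    coinExpect p (fun ω => (coinValue (ω e) - p e) *
      (H e * centeredSum p H ω ^ (2 * q + 1)).trace) ≤
    (2 * q + 1) / 2 * coinExpect p (fun ω => (coinValue (ω e) + p e) *
      (H e * H e * centeredSum p H ω ^ (2 * q)).trace) := by
  set T : (ι → Bool) → ℝ := fun ω => (H e * centeredSum p H ω ^ (2 * q + 1)).trace with hT
  set R : (ι → Bool) → ℝ := fun ω => (H e * H e * centeredSum p H ω ^ (2 * q)).trace with hR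
  set ξ : Bool → ℝ := fun b => coinValue b - p e with hξ
  have hξ0 : ∑ b, coinWeight (p e) b * ξ b = 0 := by
    simp [coinWeight, coinValue, hξ]; ring
  have a1 : pairExpect p e (fun ω _ => ξ (ω e) * T ω) = coinExpect p (fun ω => ξ (ω e) * T ω) := by
    have := pairExpect_left p e (fun ω => ξ (ω e) * T ω) (fun _ => 1)
    simpa only [mul_one, sum_coinWeight] using this
  -- The resampled coordinate is centered and independent of `ω`, so the cross terms vanish.
  have a2 : pairExpect p e (fun ω ω' => T ω * ξ (ω' e)) = 0 := by
    rw [pairExpect_left, hξ0]; simp [coinExpect]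
  have a3 : pairExpect p e (fun _ ω' => ξ (ω' e) * T ω') =
      coinExpect p (fun ω => ξ (ω e) * T ω) := by
    rw [← a1]; exact pairExpect_swap p e (fun ω _ => ξ (ω e) * T ω)
  have a4 : pairExpect p e (fun ω ω' => T ω' * ξ (ω e)) = 0 := by
    rw [← a2]; exact pairExpect_swap p e (fun ω ω' => T ω * ξ (ω' e))
  have b1 : pairExpect p e (fun ω ω' => (coinValue (ω e) - coinValue (ω' e)) * (T ω - T ω')) =
      2 * coinExpect p (fun ω => ξ (ω e) * T ω) := by
    have : (fun ω ω' : ι → Bool => (coinValue (ω e) - coinValue (ω' e)) * (T ω - T ω')) =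
        fun ω ω' => (ξ (ω e) * T ω + ξ (ω' e) * T ω') - (T ω * ξ (ω' e) + T ω' * ξ (ω e)) := by
      funext ω ω'; simp only [hξ]; ring
    rw [this, pairExpect_sub p e (fun ω ω' => ξ (ω e) * T ω + ξ (ω' e) * T ω')
      (fun ω ω' => T ω * ξ (ω' e) + T ω' * ξ (ω e)), pairExpect_add, pairExpect_add,
      a1, a2, a3, a4]
    ring
  have c1 : pairExpect p e (fun ω ω' => (coinValue (ω e) - coinValue (ω' e)) * (T ω - T ω')) ≤
      pairExpect p e (fun ω ω' =>
        (2 * q + 1) / 2 * R ω * (coinValue (ω e) - coinValue (ω' e)) ^ 2 +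
        (2 * q + 1) / 2 * R ω' * (coinValue (ω' e) - coinValue (ω e)) ^ 2) := by
    refine pairExpect_mono h0 h1 e fun ω b => ?_
    have := mul_sub_trace_mul_pow_sub_pow_le (hH e) (isSymm_centeredSum p hH ω)
      (isSymm_centeredSum p hH (Function.update ω e b)) (centeredSum_sub_update p H ω e b) q
    rw [Matrix.mul_sub, Matrix.trace_sub] at this
    simp only [Function.update_self, hT, hR]
    refine this.trans (le_of_eq ?_)
    ring
  have c2 : pairExpect p e (fun ω ω' =>
        (2 * q + 1) / 2 * R ω * (coinValue (ω e) - coinValue (ω' e)) ^ 2) ≤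
      (2 * q + 1) / 2 * coinExpect p (fun ω => (coinValue (ω e) + p e) * R ω) := by
    have d1 : pairExpect p e (fun ω ω' =>
        (2 * q + 1) / 2 * R ω * (coinValue (ω e) - coinValue (ω' e)) ^ 2) =
        coinExpect p (fun ω => (2 * q + 1) / 2 * R ω *
          ∑ b, coinWeight (p e) b * (coinValue (ω e) - coinValue b) ^ 2) := by
      unfold pairExpect coinExpect
      refine Finset.sum_congr rfl fun ω _ => ?_
      simp only [Finset.mul_sum, Function.update_self]
      exact Finset.sum_congr rfl fun b _ => by ring
    rw [d1, ← coinExpect_const_mul]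
    refine coinExpect_mono h0 h1 fun ω => ?_
    have hR0 : 0 ≤ R ω := trace_mul_self_mul_pow_nonneg (hH e) (isSymm_centeredSum p hH ω) q
    -- The mean squared jump is `1 - p e` if the edge is present and `p e` otherwise.
    have d2 : ∑ b, coinWeight (p e) b * (coinValue (ω e) - coinValue b) ^ 2 ≤
        coinValue (ω e) + p e := by
      have := h0 e
      cases ω e <;> simp [coinWeight, coinValue]
      linarith
    rw [mul_assoc, mul_comm (R ω)]
    exact mul_le_mul_of_nonneg_left (mul_le_mul_of_nonneg_right d2 hR0) (by positivity)
  rw [pairExpect_add] at c1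
  have c3 : pairExpect p e (fun ω ω' =>
        (2 * q + 1) / 2 * R ω' * (coinValue (ω' e) - coinValue (ω e)) ^ 2) =
      pairExpect p e (fun ω ω' =>
        (2 * q + 1) / 2 * R ω * (coinValue (ω e) - coinValue (ω' e)) ^ 2) :=
    pairExpect_swap p e (fun ω ω' =>
        (2 * q + 1) / 2 * R ω * (coinValue (ω e) - coinValue (ω' e)) ^ 2)
  rw [c3, b1] at c1
  linarith

/-- One factor of the power is expanded into its coordinates, and the coordinatewise bounds are
added up. -/
theorem coinExpect_trace_pow_le {p : ι → ℝ} (h0 : ∀ e, 0 ≤ p e) (h1 : ∀ e, p e ≤ 1)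
    {H : ι → Matrix N N ℝ} (hH : ∀ e, (H e).IsSymm) (q : ℕ) :
    coinExpect p (fun ω => (centeredSum p H ω ^ (2 * (q + 1))).trace) ≤
    (2 * q + 1) / 2 * coinExpect p (fun ω =>
      ((∑ e, (coinValue (ω e) + p e) • (H e * H e)) * centeredSum p H ω ^ (2 * q)).trace) := by
  have e1 : ∀ ω, (centeredSum p H ω ^ (2 * (q + 1))).trace = ∑ e, (coinValue (ω e) - p e) *
      (H e * centeredSum p H ω ^ (2 * q + 1)).trace := by
    intro ω
    have : 2 * (q + 1) = (2 * q + 1) + 1 := by ring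
    rw [this, pow_succ' _ (2 * q + 1)]
    conv_lhs => enter [1, 1]; rw [centeredSum]
    simp only [Finset.sum_mul, Matrix.trace_sum, Matrix.smul_mul, Matrix.trace_smul, smul_eq_mul]
  have e2 : ∀ ω, ((∑ e, (coinValue (ω e) + p e) • (H e * H e)) *
      centeredSum p H ω ^ (2 * q)).trace = ∑ e, (coinValue (ω e) + p e) *
      (H e * H e * centeredSum p H ω ^ (2 * q)).trace := by
    intro ω
    simp only [Finset.sum_mul, Matrix.trace_sum, Matrix.smul_mul, Matrix.trace_smul, smul_eq_mul]
  simp only [e1, e2]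
  rw [coinExpect_sum, coinExpect_sum, Finset.mul_sum]
  exact Finset.sum_le_sum fun e _ => coinExpect_coordinate_le h0 h1 hH q e

/-- Moment inequality for a centered Bernoulli sum of symmetric matrices whose squares are
diagonal. -/
theorem coinExpect_trace_pow_le_sum {p : ι → ℝ} (h0 : ∀ e, 0 ≤ p e) (h1 : ∀ e, p e ≤ 1)
    {H : ι → Matrix N N ℝ} (hH : ∀ e, (H e).IsSymm) {h : ι → N → ℝ} (hh : ∀ e k, 0 ≤ h e k)
    (hHh : ∀ e, H e * H e = Matrix.diagonal (h e)) (q : ℕ) :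
    coinExpect p (fun ω => (centeredSum p H ω ^ (2 * (q + 1))).trace) ≤
    ((2 * q + 1) / 2) ^ (q + 1) *
      ∑ k, coinExpect p (fun ω => (∑ e, (coinValue (ω e) + p e) * h e k) ^ (q + 1)) := by
  set c : ℝ := (2 * q + 1) / 2 with hc
  have hc0 : 0 ≤ c := by rw [hc]; positivity
  set Dg : (ι → Bool) → N → ℝ := fun ω k => ∑ e, (coinValue (ω e) + p e) * h e k with hDg
  have hD0 : ∀ ω k, 0 ≤ c * Dg ω k := fun ω k => mul_nonneg hc0 (Finset.sum_nonneg fun e _ =>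
    mul_nonneg (add_nonneg (coinValue_nonneg _) (h0 e)) (hh e k))
  have hmat : ∀ ω, ∑ e, (coinValue (ω e) + p e) • (H e * H e) = Matrix.diagonal (Dg ω) := by
    intro ω
    ext i j
    simp only [hHh, Matrix.sum_apply, Matrix.smul_apply, smul_eq_mul, hDg, Matrix.diagonal_apply]
    split_ifs <;> simp
  have key := coinExpect_trace_pow_le h0 h1 hH q
  simp only [hmat] at key
  set X := coinExpect p (fun ω => (centeredSum p H ω ^ (2 * (q + 1))).trace) with hX
  have step : (q + 1) * (c * coinExpect p (fun ω =>
      (Matrix.diagonal (Dg ω) * centeredSum p H ω ^ (2 * q)).trace)) ≤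
      c ^ (q + 1) * ∑ k, coinExpect p (fun ω => Dg ω k ^ (q + 1)) + q * X := by
    rw [hX, ← coinExpect_sum, ← coinExpect_const_mul, ← coinExpect_const_mul,
      ← coinExpect_const_mul, ← coinExpect_const_mul, ← coinExpect_add]
    refine coinExpect_mono h0 h1 fun ω => ?_
    have := succ_mul_trace_diagonal_mul_pow_le (isSymm_centeredSum p hH ω) (hD0 ω) q
    have e1 : Matrix.diagonal (fun k => c * Dg ω k) = c • Matrix.diagonal (Dg ω) := by
      rw [← Matrix.diagonal_smul]; rfl
    rw [e1, Matrix.smul_mul, Matrix.trace_smul, smul_eq_mul] at this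
    simpa only [mul_pow, ← Finset.mul_sum] using this
  -- Young's inequality returns `q * X`, strictly less than the `(q + 1) * X` on the left, so the
  -- moment can be absorbed.
  have : (q + 1) * X ≤ c ^ (q + 1) * ∑ k, coinExpect p (fun ω => Dg ω k ^ (q + 1)) + q * X :=
    (mul_le_mul_of_nonneg_left key (by positivity)).trans step
  linarith

theorem exp_sub_one_le_two_mul {u : ℝ} (h0 : 0 ≤ u) (h1 : u ≤ 1) : Real.exp u - 1 ≤ 2 * u := by
  have h := Real.exp_bound' h0 h1 (n := 2) (by norm_num)
  norm_num [Finset.sum_range_succ, Nat.factorial] at h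
  nlinarith

/-- Moments of a sum of independent Bernoulli variables whose mean is at most `ρ`. -/
theorem coinExpect_sum_pow_le {p : ι → ℝ} (h0 : ∀ e, 0 ≤ p e) (h1 : ∀ e, p e ≤ 1) {h : ι → ℝ}
    (hh : ∀ e, h e = 0 ∨ h e = 1) {ρ : ℝ} (hρ : 0 < ρ) (hp : ∑ e, p e * h e ≤ ρ) {s : ℕ}
    (hs : s ≤ ρ) :
    coinExpect p (fun ω => (∑ e, (coinValue (ω e) + p e) * h e) ^ s) ≤
      ρ ^ s * Real.exp (3 * s) := by
  have hh0 : ∀ e, 0 ≤ h e := fun e => by rcases hh e with h | h <;> rw [h]; norm_num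
  set u : ℝ := s / ρ with hu
  have hu0 : 0 ≤ u := by positivity
  have hu1 : u ≤ 1 := (div_le_one hρ).2 hs
  have hsu : (s : ℝ) = u * ρ := by rw [hu]; field_simp
  -- The power is dominated by an exponential through `y ≤ exp y` at `y = d / ρ + 1`. The rate is `u
  -- = s / ρ`, and `s ≤ ρ` keeps it in the range where `exp u - 1 ≤ 2 * u`.
  have pt : ∀ ω : ι → Bool, (∑ e, (coinValue (ω e) + p e) * h e) ^ s ≤
      ρ ^ s * Real.exp s * ∏ e, Real.exp (u * (coinValue (ω e) * h e)) := by
    intro ω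
    set d := ∑ e, coinValue (ω e) * h e with hd
    have hd0 : 0 ≤ d := Finset.sum_nonneg fun e _ => mul_nonneg (coinValue_nonneg _) (hh0 e)
    have e1 : ∑ e, (coinValue (ω e) + p e) * h e ≤ d + ρ := by
      simp only [add_mul, Finset.sum_add_distrib]; linarith
    have e0 : 0 ≤ ∑ e, (coinValue (ω e) + p e) * h e := Finset.sum_nonneg fun e _ =>
      mul_nonneg (add_nonneg (coinValue_nonneg _) (h0 e)) (hh0 e)
    have e2 : d + ρ ≤ ρ * Real.exp (d / ρ + 1) := by
      have := Real.add_one_le_exp (d / ρ + 1)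
      have h2 : d / ρ + 1 ≤ Real.exp (d / ρ + 1) := by linarith
      calc d + ρ = ρ * (d / ρ + 1) := by field_simp
        _ ≤ _ := mul_le_mul_of_nonneg_left h2 hρ.le
    refine (pow_le_pow_left₀ e0 (e1.trans e2) s).trans (le_of_eq ?_)
    rw [mul_pow, ← Real.exp_nat_mul, ← Real.exp_sum, mul_assoc, ← Real.exp_add]
    congr 2
    rw [← Finset.mul_sum, ← hd, hu]
    field_simp
    ring
  refine (coinExpect_mono h0 h1 pt).trans ?_
  rw [coinExpect_const_mul, coinExpect_prod p (fun e b => Real.exp (u * (coinValue b * h e)))]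
  have fac : ∀ e, ∑ b, coinWeight (p e) b * Real.exp (u * (coinValue b * h e)) ≤
      Real.exp (2 * u * (p e * h e)) := by
    intro e
    rcases hh e with h | h
    · simp [h, coinWeight]
    · have k1 : ∑ b, coinWeight (p e) b * Real.exp (u * (coinValue b * 1)) =
          p e * (Real.exp u - 1) + 1 := by
        simp [coinWeight, coinValue]; ring
      rw [h, k1]
      refine le_trans ?_ (Real.add_one_le_exp _)
      have := mul_le_mul_of_nonneg_left (exp_sub_one_le_two_mul hu0 hu1) (h0 e)
      linarith
  have fac0 : ∀ e, 0 ≤ ∑ b, coinWeight (p e) b * Real.exp (u * (coinValue b * h e)) := fun e =>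
    Finset.sum_nonneg fun b _ => mul_nonneg (coinWeight_nonneg (h0 e) (h1 e) b) (Real.exp_pos _).le
  have tot : ∏ e, ∑ b, coinWeight (p e) b * Real.exp (u * (coinValue b * h e)) ≤
      Real.exp (2 * s) := by
    refine (Finset.prod_le_prod (fun e _ => fac0 e) fun e _ => fac e).trans ?_
    rw [← Real.exp_sum, ← Finset.mul_sum]
    refine Real.exp_le_exp.2 ?_
    rw [hsu]
    nlinarith
  refine (mul_le_mul_of_nonneg_left tot (by positivity)).trans (le_of_eq ?_)
  rw [mul_assoc, ← Real.exp_add]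
  congr 2; ring

end BernoulliMoments

end

end LatentGraph

namespace LatentGraph

noncomputable section

/-! ### Operator norm concentration of the adjacency matrix. -/

section AdjacencyConcentration

theorem norm_toEuclideanLin_sq {m n : ℕ} (M : Matrix (Fin m) (Fin n) ℝ)
    (v : EuclideanSpace ℝ (Fin n)) :
    ‖Matrix.toEuclideanLin M v‖ ^ 2 = (M *ᵥ v.ofLp) ⬝ᵥ (M *ᵥ v.ofLp) := by
  rw [EuclideanSpace.norm_sq_eq]
  simp [Matrix.toLpLin_apply, dotProduct, sq]

theorem norm_sq_eq_dotProduct {n : ℕ} (v : EuclideanSpace ℝ (Fin n)) :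
    ‖v‖ ^ 2 = v.ofLp ⬝ᵥ v.ofLp := by
  rw [EuclideanSpace.norm_sq_eq]
  simp [dotProduct, sq]

/-- A bound for the trace of an even power of a symmetric matrix bounds its operator norm. -/
theorem norm_toEuclideanLin_le_of_trace_pow_le {n : ℕ} {Y : Matrix (Fin n) (Fin n) ℝ}
    (hY : Y.IsSymm) {t : ℝ} (ht : 0 ≤ t) {s : ℕ} (hs : s ≠ 0)
    (h : (Y ^ (2 * s)).trace ≤ t ^ (2 * s)) (v : EuclideanSpace ℝ (Fin n)) :
    ‖Matrix.toEuclideanLin Y v‖ ≤ t * ‖v‖ := by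
  obtain ⟨U, y, hU1, hU2, hUy⟩ := exists_orthogonal_diagonalization hY
  have htr : (Y ^ (2 * s)).trace = ∑ j, y j ^ (2 * s) := by
    rw [hUy, Matrix.trace_mul_comm, ← Matrix.mul_assoc, hU1, one_mul, Matrix.trace_diagonal]
  have hyt : ∀ j, y j ^ 2 ≤ t ^ 2 := by
    intro j
    have h1 : y j ^ (2 * s) ≤ t ^ (2 * s) := by
      refine le_trans ?_ (htr ▸ h)
      exact Finset.single_le_sum (f := fun j => y j ^ (2 * s))
        (fun i _ => (even_two_mul s).pow_nonneg _) (Finset.mem_univ j)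
    rw [pow_mul, pow_mul] at h1
    exact le_of_not_gt fun h2 => absurd h1 (not_le.2 (pow_lt_pow_left₀ h2 (sq_nonneg t) hs))
  refine le_of_sq_le_sq ?_ (by positivity)
  rw [mul_pow, norm_toEuclideanLin_sq, norm_sq_eq_dotProduct]
  set w := v.ofLp
  have e1 : (Y *ᵥ w) ⬝ᵥ (Y *ᵥ w) = ∑ j, y j ^ 2 * (Uᵀ *ᵥ w) j ^ 2 := by
    have : (Y *ᵥ w) ⬝ᵥ (Y *ᵥ w) = w ⬝ᵥ (Y ^ 2 *ᵥ w) := by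
      rw [sq, ← Matrix.mulVec_mulVec, Matrix.dotProduct_mulVec w, ← Matrix.mulVec_transpose, hY.eq]
    rw [this, hUy, ← Matrix.mulVec_mulVec, ← Matrix.mulVec_mulVec, Matrix.dotProduct_mulVec w,
      ← Matrix.mulVec_transpose, dotProduct]
    refine Finset.sum_congr rfl fun j _ => ?_
    rw [Matrix.mulVec_diagonal]; ring
  have e2 : w ⬝ᵥ w = ∑ j, (Uᵀ *ᵥ w) j ^ 2 := by
    have : w ⬝ᵥ w = w ⬝ᵥ (U *ᵥ (Uᵀ *ᵥ w)) := by rw [Matrix.mulVec_mulVec, hU2, Matrix.one_mulVec]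
    rw [this, Matrix.dotProduct_mulVec w, ← Matrix.mulVec_transpose, dotProduct]
    exact Finset.sum_congr rfl fun j _ => by ring
  rw [e1, e2, Finset.mul_sum]
  exact Finset.sum_le_sum fun j _ => mul_le_mul_of_nonneg_right (hyt j) (sq_nonneg _)

variable {n : ℕ}

/-- The adjacency matrix of the graph with the single edge `e`. -/
def edgeMatrix (e : Sym2 (Fin n)) : Matrix (Fin n) (Fin n) ℝ :=
  Matrix.of fun k l => if s(k, l) = e then 1 else 0

theorem isSymm_edgeMatrix (e : Sym2 (Fin n)) : (edgeMatrix e).IsSymm := by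
  ext k l
  simp [edgeMatrix, Sym2.eq_swap]

theorem sum_edgeMatrix_row (e : Sym2 (Fin n)) (k : Fin n) :
    ∑ l, edgeMatrix e k l = if k ∈ e then 1 else 0 := by
  simp only [edgeMatrix, Matrix.of_apply]
  split_ifs with h
  · obtain ⟨l, rfl⟩ := h
    simp only [Sym2.congr_right]
    simp
  · refine Finset.sum_eq_zero fun l _ => ?_
    rw [if_neg]
    rintro rfl
    exact h (Sym2.mem_mk_left k l)

/-- A single edge or loop gives each vertex at most one neighbour, and going there and back returns
to the start; hence the square is the projection onto the end points. -/
theorem edgeMatrix_mul_self (e : Sym2 (Fin n)) :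
    edgeMatrix e * edgeMatrix e = Matrix.diagonal (fun k => if k ∈ e then 1 else 0) := by
  ext k m
  rw [Matrix.mul_apply, Matrix.diagonal_apply]
  split_ifs with h1 h2
  · subst h1
    have := sum_edgeMatrix_row e k
    rw [if_pos h2] at this
    rw [← this]
    refine Finset.sum_congr rfl fun l _ => ?_
    simp [edgeMatrix, Sym2.eq_swap (a := l)]
  · subst h1
    refine Finset.sum_eq_zero fun l _ => ?_
    have : edgeMatrix e k l = 0 := by
      rw [edgeMatrix, Matrix.of_apply, if_neg]
      rintro rfl
      exact h2 (Sym2.mem_mk_left k l)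
    rw [this, zero_mul]
  · refine Finset.sum_eq_zero fun l _ => ?_
    simp only [edgeMatrix, Matrix.of_apply]
    split_ifs with h3 h4
    · exact absurd (by rw [← h4, Sym2.eq_swap (a := l), Sym2.congr_left] at h3; exact h3) h1
    all_goals simp

theorem centeredSum_edgeMatrix (p : Sym2 (Fin n) → ℝ) (ω : Sym2 (Fin n) → Bool) :
    centeredSum p edgeMatrix ω =
      adjacency ω - Matrix.of (fun k l => p s(k, l)) := by
  ext k l
  simp [centeredSum, edgeMatrix, Matrix.sum_apply, adjacency, coinValue]

theorem sum_mul_mem_eq (p : Sym2 (Fin n) → ℝ) (k : Fin n) :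
    ∑ e, p e * (if k ∈ e then 1 else 0) = ∑ l, p s(k, l) := by
  simp only [← sum_edgeMatrix_row, Finset.mul_sum]
  rw [Finset.sum_comm]
  simp [edgeMatrix]

theorem edgeProb_mk (κ : SmallWorldKernel) {C : ℝ} (hC : 1 ≤ C) (x : Fin n → I) (i j : Fin n) :
    (edgeProb κ C x s(i, j) : ℝ) = κ.val (x i) (x j) / C := by
  unfold edgeProb
  rw [Sym2.lift_mk, Set.projIcc_of_mem]
  have hC0 : 0 < C := one_pos.trans_le hC
  exact ⟨(div_pos (κ.val_pos _ _) hC0).le,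
    (div_le_one hC0).2 ((κ.val_le_one _ _).trans hC)⟩

theorem edgeKernel_singleton (κ : SmallWorldKernel) (C : ℝ) (x : Fin n → I)
    (ω : Sym2 (Fin n) → Bool) :
    edgeKernel κ C n x {ω} =
      ENNReal.ofReal (prodWeight (fun e => (edgeProb κ C x e : ℝ)) ω) := by
  change Measure.pi (fun e => bernoulliMeasure true false (edgeProb κ C x e)) {ω} = _
  rw [Measure.pi_singleton, prodWeight, ENNReal.ofReal_prod_of_nonneg
    fun e _ => coinWeight_nonneg (edgeProb κ C x e).2.1 (edgeProb κ C x e).2.2 _]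
  refine Finset.prod_congr rfl fun e _ => ?_
  have hp := (edgeProb κ C x e).2
  rw [bernoulliMeasure_def]
  have key : ∀ q : I, ((unitInterval.toNNReal q : NNReal) : ENNReal) = ENNReal.ofReal q := by
    intro q
    rw [ENNReal.ofReal, Real.toNNReal_of_nonneg q.2.1]
    rfl
  simp only [Measure.add_apply, Measure.smul_apply, ENNReal.smul_def, smul_eq_mul, key,
    coinWeight]
  cases ω e <;> simp

/-- The expected trace of an even power of the centered adjacency matrix. -/
theorem coinExpect_trace_adjacency_le (κ : SmallWorldKernel) {C ρ : ℝ} (hC : 1 ≤ C)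
    (hρ : ρ = n / C) (hρ0 : 0 < ρ) (x : Fin n → I) {s : ℕ} (hs : s ≠ 0) (hsρ : s ≤ ρ) :
    coinExpect (fun e => (edgeProb κ C x e : ℝ))
      (fun ω => ((adjacency ω - C⁻¹ • gramMatrix κ x) ^ (2 * s)).trace) ≤
      n * (s * ρ * Real.exp 3) ^ s := by
  obtain ⟨q, rfl⟩ := Nat.exists_eq_succ_of_ne_zero hs
  set p : Sym2 (Fin n) → ℝ := fun e => (edgeProb κ C x e : ℝ) with hp
  have h0 : ∀ e, 0 ≤ p e := fun e => (edgeProb κ C x e).2.1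
  have h1 : ∀ e, p e ≤ 1 := fun e => (edgeProb κ C x e).2.2
  have hC0 : 0 < C := one_pos.trans_le hC
  have hY : ∀ ω, adjacency ω - C⁻¹ • gramMatrix κ x = centeredSum p edgeMatrix ω := by
    intro ω
    rw [centeredSum_edgeMatrix]
    congr 1
    ext i j
    simp only [hp, Matrix.of_apply, edgeProb_mk κ hC, gramMatrix, Matrix.smul_apply, smul_eq_mul]
    rw [div_eq_inv_mul]
  simp only [hY]
  refine (coinExpect_trace_pow_le_sum h0 h1 isSymm_edgeMatrix
    (h := fun e k => if k ∈ e then 1 else 0) (fun e k => by split_ifs <;> norm_num)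
    edgeMatrix_mul_self q).trans ?_
  have hk : ∀ k, coinExpect p (fun ω => (∑ e, (coinValue (ω e) + p e) *
      (if k ∈ e then 1 else 0)) ^ (q + 1)) ≤ ρ ^ (q + 1) * Real.exp (3 * (q + 1 : ℕ)) := by
    -- For the vertex `k` the diagonal entry is its degree plus its expected degree, and the
    -- expected degree is at most `n / C = ρ`.
    intro k
    refine coinExpect_sum_pow_le h0 h1 (fun e => by split_ifs <;> simp) hρ0 ?_ hsρ
    rw [sum_mul_mem_eq, hρ]
    calc ∑ l, p s(k, l) ≤ ∑ _l : Fin n, 1 / C := by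
          refine Finset.sum_le_sum fun l _ => ?_
          simp only [hp, edgeProb_mk κ hC]
          exact div_le_div_of_nonneg_right (κ.val_le_one _ _) hC0.le
      _ = n / C := by simp [div_eq_mul_inv]
  have hq : ((2 * q + 1) / 2 : ℝ) ≤ (q + 1 : ℕ) := by push_cast; linarith
  calc ((2 * q + 1) / 2 : ℝ) ^ (q + 1) * ∑ k, coinExpect p (fun ω => (∑ e, (coinValue (ω e) + p e) *
        (if k ∈ e then 1 else 0)) ^ (q + 1))
      ≤ ((2 * q + 1) / 2 : ℝ) ^ (q + 1) *
        ∑ _k : Fin n, ρ ^ (q + 1) * Real.exp (3 * (q + 1 : ℕ)) :=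
        mul_le_mul_of_nonneg_left (Finset.sum_le_sum fun k _ => hk k) (by positivity)
    _ ≤ ((q + 1 : ℕ) : ℝ) ^ (q + 1) *
        ∑ _k : Fin n, ρ ^ (q + 1) * Real.exp (3 * (q + 1 : ℕ)) :=
        mul_le_mul_of_nonneg_right (pow_le_pow_left₀ (by positivity) hq _) (by positivity)
    _ = n * ((q + 1 : ℕ) * ρ * Real.exp 3) ^ (q + 1) := by
        rw [mul_comm (3 : ℝ), Real.exp_nat_mul, Finset.sum_const, Finset.card_univ,
          Fintype.card_fin, nsmul_eq_mul, mul_pow, mul_pow]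
        ring

theorem lintegral_edgeKernel (κ : SmallWorldKernel) (C : ℝ) (x : Fin n → I)
    {f : (Sym2 (Fin n) → Bool) → ℝ} (hf : ∀ ω, 0 ≤ f ω) :
    ∫⁻ ω, ENNReal.ofReal (f ω) ∂(edgeKernel κ C n x) =
      ENNReal.ofReal (coinExpect (fun e => (edgeProb κ C x e : ℝ)) f) := by
  have hw := prodWeight_nonneg (p := fun e => (edgeProb κ C x e : ℝ))
    (fun e => (edgeProb κ C x e).2.1) (fun e => (edgeProb κ C x e).2.2)
  rw [lintegral_fintype, coinExpect,
    ENNReal.ofReal_sum_of_nonneg fun ω _ => mul_nonneg (hw ω) (hf ω)]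
  refine Finset.sum_congr rfl fun ω _ => ?_
  rw [edgeKernel_singleton, ENNReal.ofReal_mul (hw ω), mul_comm]

theorem trace_even_pow_nonneg {Y : Matrix (Fin n) (Fin n) ℝ} (hY : Y.IsSymm) (s : ℕ) :
    0 ≤ (Y ^ (2 * s)).trace := by
  have := trace_mul_self_mul_pow_nonneg (Matrix.isSymm_one (n := Fin n) (α := ℝ)) hY s
  simpa using this

theorem isSymm_adjacency (ω : Sym2 (Fin n) → Bool) : (adjacency ω).IsSymm := by
  ext i j
  simp [adjacency, Sym2.eq_swap]

theorem isSymm_gramMatrix (κ : SmallWorldKernel) (x : Fin n → I) : (gramMatrix κ x).IsSymm := by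
  ext i j
  simp [gramMatrix, κ.val_comm (x i)]

/-- Conditionally on the latent positions, the adjacency matrix is close to its expectation in
operator norm. -/
theorem edgeKernel_trace_pow_gt_le (κ : SmallWorldKernel) {C ρ t : ℝ} (hC : 1 ≤ C)
    (hρ : ρ = n / C) (hρ0 : 0 < ρ) (ht : 0 < t) (x : Fin n → I) {s : ℕ} (hs : s ≠ 0)
    (hsρ : s ≤ ρ) :
    edgeKernel κ C n x
      {ω | t ^ (2 * s) < ((adjacency ω - C⁻¹ • gramMatrix κ x) ^ (2 * s)).trace} ≤
      ENNReal.ofReal (n * (s * ρ * Real.exp 3 / t ^ 2) ^ s) := by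
  set f : (Sym2 (Fin n) → Bool) → ℝ :=
    fun ω => ((adjacency ω - C⁻¹ • gramMatrix κ x) ^ (2 * s)).trace with hf
  have hf0 : ∀ ω, 0 ≤ f ω := fun ω => trace_even_pow_nonneg
    ((isSymm_adjacency ω).sub ((isSymm_gramMatrix κ x).smul _)) s
  have ht2 : 0 < t ^ (2 * s) := by positivity
  -- Markov's inequality for the trace moment.
  have hmark := mul_meas_ge_le_lintegral (μ := edgeKernel κ C n x)
    (f := fun ω => ENNReal.ofReal (f ω)) (measurable_of_countable _) (ENNReal.ofReal (t ^ (2 * s)))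
  rw [lintegral_edgeKernel κ C x hf0] at hmark
  have hle : edgeKernel κ C n x {ω | t ^ (2 * s) < f ω} ≤
      edgeKernel κ C n x {ω | ENNReal.ofReal (t ^ (2 * s)) ≤ ENNReal.ofReal (f ω)} :=
    measure_mono fun ω hω => ENNReal.ofReal_le_ofReal (le_of_lt hω)
  have hE := coinExpect_trace_adjacency_le κ hC hρ hρ0 x hs hsρ
  have e : (n : ℝ) * (s * ρ * Real.exp 3 / t ^ 2) ^ s =
      n * (s * ρ * Real.exp 3) ^ s / t ^ (2 * s) := by
    rw [div_pow, pow_mul]; ring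
  rw [e, ENNReal.ofReal_div_of_pos ht2]
  rw [ENNReal.le_div_iff_mul_le (Or.inl (by simpa using ht2)) (Or.inl ENNReal.ofReal_ne_top),
    mul_comm]
  exact (mul_le_mul_right hle _).trans (hmark.trans (ENNReal.ofReal_le_ofReal hE))

/-- The noise event is formulated with a trace rather than an operator norm because the trace is
visibly continuous in positions and edges. -/
theorem measurableSet_trace_pow_gt (κ : SmallWorldKernel) (C t : ℝ) (s : ℕ) :
    MeasurableSet {ω : (Fin n → I) × (Sym2 (Fin n) → Bool) |
      t ^ (2 * s) < ((adjacency ω.2 - C⁻¹ • gramMatrix κ ω.1) ^ (2 * s)).trace} := by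
  have hcont : Continuous fun ω : (Fin n → I) × (Sym2 (Fin n) → Bool) =>
      ((adjacency ω.2 - C⁻¹ • gramMatrix κ ω.1) ^ (2 * s)).trace := by
    have h1 : Continuous fun ω : (Fin n → I) × (Sym2 (Fin n) → Bool) => adjacency ω.2 := by
      refine continuous_matrix fun i j => ?_
      exact (continuous_of_discreteTopology (f := fun b : Bool => if b then (1 : ℝ) else 0)).comp
        ((continuous_apply s(i, j)).comp continuous_snd)
    have h2 : Continuous fun ω : (Fin n → I) × (Sym2 (Fin n) → Bool) => gramMatrix κ ω.1 := by
      refine continuous_matrix fun i j => ?_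
      exact κ.continuous_val.comp
        (by fun_prop : Continuous fun ω : (Fin n → I) × (Sym2 (Fin n) → Bool) => (ω.1 i, ω.1 j))
    exact ((h1.sub (h2.const_smul C⁻¹)).pow (2 * s)).matrix_trace
  exact measurableSet_lt measurable_const hcont.measurable

theorem modelLaw_trace_pow_gt_le (κ : SmallWorldKernel) (D : Measure I) [IsProbabilityMeasure D]
    {C ρ t : ℝ} (hC : 1 ≤ C) (hρ : ρ = n / C) (hρ0 : 0 < ρ) (ht : 0 < t) {s : ℕ} (hs : s ≠ 0)
    (hsρ : s ≤ ρ) :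
    modelLaw κ D C n
      {ω | t ^ (2 * s) < ((adjacency ω.2 - C⁻¹ • gramMatrix κ ω.1) ^ (2 * s)).trace} ≤
      ENNReal.ofReal (n * (s * ρ * Real.exp 3 / t ^ 2) ^ s) := by
  rw [modelLaw, Measure.compProd_apply (measurableSet_trace_pow_gt κ C t s)]
  refine (lintegral_mono fun x =>
    edgeKernel_trace_pow_gt_le κ hC hρ hρ0 ht x hs hsρ).trans ?_
  simp

theorem modelLaw_fst_preimage (κ : SmallWorldKernel) (D : Measure I) [IsProbabilityMeasure D]
    (C : ℝ) {S : Set (Fin n → I)} (hS : MeasurableSet S) :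
    modelLaw κ D C n {ω | ω.1 ∈ S} = Measure.pi (fun _ : Fin n => D) S := by
  have := Measure.fst_compProd (Measure.pi fun _ : Fin n => D) (edgeKernel κ C n)
  rw [← this, Measure.fst_apply hS]
  rfl

end AdjacencyConcentration

end

end LatentGraph

namespace LatentGraph

noncomputable section

/-! ### Max-min principles for quadratic forms and singular values. -/

section FormBound

variable {E F : Type*} [NormedAddCommGroup E] [InnerProductSpace ℝ E]
  [NormedAddCommGroup F] [InnerProductSpace ℝ F]

/-- The quadratic form of `T` is at least `θ` times the squared norm on some `k`-dimensional
subspace. -/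
def HasFormBound (T : E →ₗ[ℝ] E) (θ : ℝ) (k : ℕ) : Prop :=
  ∃ ι : (Fin k → ℝ) →ₗ[ℝ] E, Function.Injective ι ∧
    ∀ w, θ * ‖ι w‖ ^ 2 ≤ inner ℝ (T (ι w)) (ι w)

/-- Since `θ - η > 0`, a nonzero vector of the subspace keeps a positive form after applying `J`; so
`J` is injective there, and a contraction can only improve the ratio of form to squared norm. No
lower bound for `‖J f‖` is needed. -/
theorem HasFormBound.transport {T : E →ₗ[ℝ] E} {S : F →ₗ[ℝ] F} {J : E →ₗ[ℝ] F} {η θ : ℝ} {k : ℕ}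
    (h : HasFormBound T θ k) (hηθ : η < θ) (hJ : ∀ f, ‖J f‖ ≤ ‖f‖)
    (hform : ∀ f, inner ℝ (T f) f ≤ inner ℝ (S (J f)) (J f) + η * ‖f‖ ^ 2) :
    HasFormBound S (θ - η) k := by
  obtain ⟨ι, hι, hb⟩ := h
  have key : ∀ w, (θ - η) * ‖ι w‖ ^ 2 ≤ inner ℝ (S (J (ι w))) (J (ι w)) := by
    intro w
    have h1 := hb w
    have h2 := hform (ι w)
    linarith
  refine ⟨J ∘ₗ ι, ?_, fun w => ?_⟩
  · rw [injective_iff_map_eq_zero]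
    intro w hw
    have h1 := key w
    rw [LinearMap.comp_apply] at hw
    rw [hw, inner_zero_right] at h1
    have h2 : ‖ι w‖ ^ 2 ≤ 0 := by
      by_contra h3
      exact absurd h1 (not_le.2 (mul_pos (sub_pos.2 hηθ) (not_le.1 h3)))
    have h3 : ι w = 0 := by
      rw [← norm_eq_zero]; exact pow_eq_zero_iff (two_ne_zero) |>.1 (le_antisymm h2 (sq_nonneg _))
    exact (map_eq_zero_iff ι hι).1 h3
  · rw [LinearMap.comp_apply]
    refine le_trans ?_ (key w)
    exact mul_le_mul_of_nonneg_left (pow_le_pow_left₀ (norm_nonneg _) (hJ _) 2)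
      (sub_nonneg.2 hηθ.le)

theorem hasFormBound_one {T : E →ₗ[ℝ] E} {θ : ℝ} {v : E} (hv : v ≠ 0)
    (h : θ * ‖v‖ ^ 2 ≤ inner ℝ (T v) v) : HasFormBound T θ 1 := by
  refine ⟨(LinearMap.toSpanSingleton ℝ E v) ∘ₗ (LinearMap.proj 0), ?_, fun w => ?_⟩
  · rw [injective_iff_map_eq_zero]
    intro w hw
    simp only [LinearMap.comp_apply, LinearMap.proj_apply, LinearMap.toSpanSingleton_apply,
      smul_eq_zero, hv, or_false] at hw
    ext i
    rw [Subsingleton.elim i 0, hw]; rfl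
  · simp only [LinearMap.comp_apply, LinearMap.proj_apply, LinearMap.toSpanSingleton_apply,
      map_smul, norm_smul, inner_smul_left, inner_smul_right, Real.norm_eq_abs, mul_pow, sq_abs]
    simp only [conj_trivial]
    nlinarith [sq_nonneg (w 0)]

theorem not_hasFormBound_one {T : E →ₗ[ℝ] E} {θ : ℝ} (h : ∀ v, inner ℝ (T v) v ≤ 0)
    (hθ : 0 < θ) : ¬ HasFormBound T θ 1 := by
  rintro ⟨ι, hι, hb⟩
  have h1 := (hb (fun _ => 1)).trans (h _)
  have h2 : ι (fun _ => 1) ≠ 0 := by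
    rw [Ne, map_eq_zero_iff ι hι]
    intro h
    exact one_ne_zero (congrFun h 0)
  exact absurd h1 (not_le.2 (mul_pos hθ (by positivity)))

theorem HasFormBound.le_finrank {T : E →ₗ[ℝ] E} {θ : ℝ} {k : ℕ} [FiniteDimensional ℝ E]
    (h : HasFormBound T θ k) : k ≤ Module.finrank ℝ E := by
  obtain ⟨ι, hι, -⟩ := h
  simpa using LinearMap.finrank_le_finrank_of_injective hι

theorem hasFormBound_of_orthonormal {T : E →ₗ[ℝ] E} {k : ℕ} {u : Fin k → E}
    (hu : Orthonormal ℝ u) {a : Fin k → ℝ} (hT : ∀ i, T (u i) = a i • u i) {θ : ℝ}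
    (hθ : ∀ i, θ ≤ a i) : HasFormBound T θ k := by
  refine ⟨Fintype.linearCombination ℝ u, hu.linearIndependent.fintypeLinearCombination_injective,
    fun w => ?_⟩
  have h1 : T (Fintype.linearCombination ℝ u w) = ∑ i, (a i * w i) • u i := by
    rw [Fintype.linearCombination_apply, map_sum]
    exact Finset.sum_congr rfl fun i _ => by rw [map_smul, hT, smul_smul, mul_comm]
  have h2 := hu.inner_sum (fun i => a i * w i) w Finset.univ
  have h3 := hu.inner_sum w w Finset.univ
  simp only [conj_trivial] at h2 h3
  rw [h1, ← real_inner_self_eq_norm_sq, Fintype.linearCombination_apply, h2, h3, Finset.mul_sum]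
  refine Finset.sum_le_sum fun i _ => ?_
  rw [mul_assoc]
  exact mul_le_mul_of_nonneg_right (hθ i) (mul_self_nonneg _)

variable [FiniteDimensional ℝ E] [FiniteDimensional ℝ F]

theorem norm_sq_apply_eq_sum_singularValues (T : E →ₗ[ℝ] F) (v : E) :
    ‖T v‖ ^ 2 = ∑ i : Fin (Module.finrank ℝ E), T.singularValues i ^ 2 *
      (T.isSymmetric_adjoint_comp_self.eigenvectorBasis rfl).repr v i ^ 2 := by
  set b := T.isSymmetric_adjoint_comp_self.eigenvectorBasis rfl with hb
  have h1 : ‖T v‖ ^ 2 = inner ℝ ((LinearMap.adjoint T ∘ₗ T) v) v := by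
    rw [LinearMap.comp_apply, LinearMap.adjoint_inner_left, real_inner_self_eq_norm_sq]
  rw [h1, ← b.sum_inner_mul_inner]
  refine Finset.sum_congr rfl fun i _ => ?_
  have h2 := T.isSymmetric_adjoint_comp_self.eigenvectorBasis_apply_self_apply rfl v i
  rw [← hb] at h2
  rw [real_inner_comm, ← b.repr_apply_apply, ← b.repr_apply_apply, h2, T.sq_singularValues_fin rfl]
  simp only [RCLike.ofReal_real_eq_id, id_eq]
  ring

/-- Max-min principle, lower bound for a singular value. -/
theorem le_singularValues_of_forall_le {T : E →ₗ[ℝ] F} {k : ℕ} {θ : ℝ}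
    (ι : (Fin (k + 1) → ℝ) →ₗ[ℝ] E) (hι : Function.Injective ι)
    (h : ∀ w, θ * ‖ι w‖ ≤ ‖T (ι w)‖) : θ ≤ T.singularValues k := by
  have hk : k < Module.finrank ℝ E := by
    have := LinearMap.finrank_le_finrank_of_injective hι
    simp at this
    omega
  set b := T.isSymmetric_adjoint_comp_self.eigenvectorBasis rfl with hb
  -- By dimension some nonzero vector of the subspace is orthogonal to the first `k` right singular
  -- vectors.
  let g : (Fin (k + 1) → ℝ) →ₗ[ℝ] (Fin k → ℝ) := LinearMap.pi fun i =>
    (innerₛₗ ℝ (b ⟨i, i.2.trans hk⟩)) ∘ₗ ι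
  have hg : LinearMap.ker g ≠ ⊥ := LinearMap.ker_ne_bot_of_finrank_lt (by simp)
  obtain ⟨w, hw, hw0⟩ := (Submodule.ne_bot_iff _).1 hg
  have hv : ι w ≠ 0 := by rwa [Ne, map_eq_zero_iff ι hι]
  have hz : ∀ i : Fin (Module.finrank ℝ E), (i : ℕ) < k → b.repr (ι w) i = 0 := by
    intro i hi
    have := congrFun (LinearMap.mem_ker.1 hw) ⟨i, hi⟩
    rw [b.repr_apply_apply]
    simpa [g] using this
  have hle : ‖T (ι w)‖ ^ 2 ≤ (T.singularValues k * ‖ι w‖) ^ 2 := by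
    rw [norm_sq_apply_eq_sum_singularValues, mul_pow, ← b.sum_sq_norm_inner_right, Finset.mul_sum]
    refine Finset.sum_le_sum fun i _ => ?_
    rw [← b.repr_apply_apply, Real.norm_eq_abs, sq_abs, ← hb]
    rcases lt_or_ge (i : ℕ) k with hi | hi
    · rw [hz i hi]; simp
    · exact mul_le_mul_of_nonneg_right (pow_le_pow_left₀ (T.singularValues_nonneg _)
        (T.singularValues_antitone hi) 2) (sq_nonneg _)
  have hle' : ‖T (ι w)‖ ≤ T.singularValues k * ‖ι w‖ :=
    le_of_sq_le_sq hle (mul_nonneg (T.singularValues_nonneg _) (norm_nonneg _))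
  exact le_of_mul_le_mul_right ((h w).trans hle') (norm_pos_iff.2 hv)

/-- The linear combinations of the first `k` vectors of an orthonormal basis. -/
def initialSpan {m : ℕ} (b : OrthonormalBasis (Fin m) ℝ E) {k : ℕ} (hk : k ≤ m) :
    (Fin k → ℝ) →ₗ[ℝ] E :=
  Fintype.linearCombination ℝ (fun i : Fin k => b (Fin.castLE hk i))

theorem initialSpan_injective {m : ℕ} (b : OrthonormalBasis (Fin m) ℝ E) {k : ℕ} (hk : k ≤ m) :
    Function.Injective (initialSpan b hk) := by
  have : LinearIndependent ℝ (fun i : Fin k => b (Fin.castLE hk i)) :=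
    (b.orthonormal.comp _ (Fin.castLE_injective hk)).linearIndependent
  exact this.fintypeLinearCombination_injective

theorem repr_initialSpan {m : ℕ} (b : OrthonormalBasis (Fin m) ℝ E) {k : ℕ} (hk : k ≤ m)
    (w : Fin k → ℝ) {i : Fin m} (hi : k ≤ i) : b.repr (initialSpan b hk w) i = 0 := by
  rw [b.repr_apply_apply, initialSpan, Fintype.linearCombination_apply, inner_sum]
  refine Finset.sum_eq_zero fun j _ => ?_
  rw [inner_smul_right, b.orthonormal.2, mul_zero]
  intro h
  have := congrArg Fin.val h
  simp only [Fin.val_castLE] at this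
  omega

/-- Max-min principle: the optimal subspace for a singular value. -/
theorem exists_forall_singularValues_mul_norm_le (T : E →ₗ[ℝ] F) {k : ℕ}
    (hk : k < Module.finrank ℝ E) :
    ∃ ι : (Fin (k + 1) → ℝ) →ₗ[ℝ] E, Function.Injective ι ∧
      ∀ w, T.singularValues k * ‖ι w‖ ≤ ‖T (ι w)‖ := by
  set b := T.isSymmetric_adjoint_comp_self.eigenvectorBasis rfl with hb
  refine ⟨initialSpan b hk, initialSpan_injective b _, fun w => ?_⟩
  refine le_of_sq_le_sq ?_ (norm_nonneg _)
  rw [norm_sq_apply_eq_sum_singularValues, mul_pow, ← b.sum_sq_norm_inner_right, Finset.mul_sum]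
  refine Finset.sum_le_sum fun i _ => ?_
  rw [← b.repr_apply_apply, Real.norm_eq_abs, sq_abs, ← hb]
  rcases le_or_gt (k + 1) (i : ℕ) with hi | hi
  · rw [repr_initialSpan b _ w hi]; simp
  · exact mul_le_mul_of_nonneg_right (pow_le_pow_left₀ (T.singularValues_nonneg _)
      (T.singularValues_antitone (Nat.lt_succ_iff.1 hi)) 2) (sq_nonneg _)

theorem singularValues_le_add {T S : E →ₗ[ℝ] F} {ε : ℝ} (h : ∀ v, ‖(T - S) v‖ ≤ ε * ‖v‖)
    (hε : 0 ≤ ε) (k : ℕ) : T.singularValues k ≤ S.singularValues k + ε := by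
  rcases lt_or_ge k (Module.finrank ℝ E) with hk | hk
  · obtain ⟨ι, hι, hb⟩ := exists_forall_singularValues_mul_norm_le T hk
    have : T.singularValues k - ε ≤ S.singularValues k := by
      refine le_singularValues_of_forall_le ι hι fun w => ?_
      have h1 := hb w
      have h2 := h (ι w)
      have h3 := norm_sub_norm_le (T (ι w)) (S (ι w))
      rw [← LinearMap.sub_apply] at h3
      linarith
    linarith
  · rw [T.singularValues_of_finrank_le hk]
    exact add_nonneg (S.singularValues_nonneg _) hε

/-- Weyl's inequality for singular values. -/
theorem abs_singularValues_sub_le {T S : E →ₗ[ℝ] F} {ε : ℝ} (h : ∀ v, ‖(T - S) v‖ ≤ ε * ‖v‖)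
    (hε : 0 ≤ ε) (k : ℕ) : |T.singularValues k - S.singularValues k| ≤ ε := by
  have h' : ∀ v, ‖(S - T) v‖ ≤ ε * ‖v‖ := fun v => by
    rw [← neg_sub T S, LinearMap.neg_apply, norm_neg]; exact h v
  rw [abs_sub_le_iff]
  exact ⟨by linarith [singularValues_le_add h hε k], by linarith [singularValues_le_add h' hε k]⟩

theorem mul_singularValues_le_smul (T : E →ₗ[ℝ] F) {c : ℝ} (hc : 0 ≤ c) (k : ℕ) :
    c * T.singularValues k ≤ (c • T).singularValues k := by
  rcases lt_or_ge k (Module.finrank ℝ E) with hk | hk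
  · obtain ⟨ι, hι, hb⟩ := exists_forall_singularValues_mul_norm_le T hk
    refine le_singularValues_of_forall_le ι hι fun w => ?_
    rw [LinearMap.smul_apply, norm_smul, Real.norm_of_nonneg hc, mul_assoc]
    exact mul_le_mul_of_nonneg_left (hb w) hc
  · rw [T.singularValues_of_finrank_le hk, mul_zero]
    exact LinearMap.singularValues_nonneg _ _

theorem singularValues_smul (T : E →ₗ[ℝ] F) {c : ℝ} (hc : 0 < c) (k : ℕ) :
    (c • T).singularValues k = c * T.singularValues k := by
  refine le_antisymm ?_ (mul_singularValues_le_smul T hc.le k)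
  -- The reverse inequality is the first one applied to `c • T` and the factor `c⁻¹`.
  have := mul_singularValues_le_smul (c • T) (inv_nonneg.2 hc.le) k
  rw [smul_smul, inv_mul_cancel₀ hc.ne', one_smul, inv_mul_le_iff₀ hc] at this
  exact this

theorem HasFormBound.le_singularValues {T : E →ₗ[ℝ] E} {k : ℕ} {θ : ℝ}
    (h : HasFormBound T θ (k + 1)) : θ ≤ T.singularValues k := by
  obtain ⟨ι, hι, hb⟩ := h
  refine le_singularValues_of_forall_le ι hι fun w => ?_
  rcases eq_or_ne (ι w) 0 with h0 | h0
  · rw [h0]; simp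
  · have h1 := (hb w).trans (real_inner_le_norm _ _)
    rw [sq, ← mul_assoc] at h1
    exact le_of_mul_le_mul_right h1 (norm_pos_iff.2 h0)

/-- The vector `T v - s • v` would be an eigenvector for `-s`, which is below the lower bound `-η`
of the form, so it vanishes. This makes singular vectors of an almost positive operator
eigenvectors, with no choice of sign. -/
theorem apply_eq_smul_of_sq_apply {T : E →ₗ[ℝ] E} {η s : ℝ}
    (hη : ∀ v, -η * ‖v‖ ^ 2 ≤ inner ℝ (T v) v) (hs : η < s) {v : E}
    (hv : T (T v) = s ^ 2 • v) : T v = s • v := by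
  set u := T v - s • v with hu
  have h1 : T u = -s • u := by
    rw [hu, map_sub, map_smul, hv, smul_sub, smul_smul]
    module
  have h2 := hη u
  rw [h1, inner_smul_left, real_inner_self_eq_norm_sq, conj_trivial] at h2
  have h3 : ‖u‖ ^ 2 ≤ 0 := by nlinarith [sq_nonneg ‖u‖]
  have h4 : ‖u‖ = 0 := pow_eq_zero_iff two_ne_zero |>.1 (le_antisymm h3 (sq_nonneg _))
  exact sub_eq_zero.1 (norm_eq_zero.1 h4)

/-- Almost positivity is essential: in general a large singular value may come from a negative
eigenvalue. Above `η` the right singular vectors are eigenvectors with positive eigenvalues. -/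
theorem hasFormBound_singularValues {T : E →ₗ[ℝ] E} (hT : T.IsSymmetric) {η : ℝ}
    (hη0 : 0 ≤ η) (hη : ∀ v, -η * ‖v‖ ^ 2 ≤ inner ℝ (T v) v) {k : ℕ}
    (hk : η < T.singularValues k) : HasFormBound T (T.singularValues k) (k + 1) := by
  have hkn : k < Module.finrank ℝ E := by
    by_contra hcon
    rw [T.singularValues_of_finrank_le (not_lt.1 hcon)] at hk
    linarith
  set b := T.isSymmetric_adjoint_comp_self.eigenvectorBasis rfl with hb
  have hadj : LinearMap.adjoint T = T := (LinearMap.isSymmetric_iff_isSelfAdjoint T).1 hT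
  have hTb : ∀ i : Fin (k + 1), T (b (Fin.castLE hkn i)) =
      T.singularValues i • b (Fin.castLE hkn i) := by
    intro i
    refine apply_eq_smul_of_sq_apply hη
      (hk.trans_le (T.singularValues_antitone (Nat.lt_succ_iff.1 i.2))) ?_
    have h := T.isSymmetric_adjoint_comp_self.apply_eigenvectorBasis rfl (Fin.castLE hkn i)
    rw [← hb, ← T.sq_singularValues_fin rfl, LinearMap.comp_apply, hadj] at h
    exact h
  exact hasFormBound_of_orthonormal (b.orthonormal.comp _ (Fin.castLE_injective hkn)) hTb
    fun i => T.singularValues_antitone (Nat.lt_succ_iff.1 i.2)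

end FormBound

end

end LatentGraph

namespace LatentGraph

noncomputable section

/-! ### Discretizing an integral form over finitely many cells. -/

section Discretization

variable {Ω : Type*} [MeasurableSpace Ω] {m : ℕ}

/-- The mass of the cell `a`. -/
def cellMass (μ : Measure Ω) (c : Ω → Fin m) (a : Fin m) : ℝ :=
  Measure.real μ (Set.preimage c {a})

/-- The normalized integral of `f` over the cell `a`. -/
def cellAverage (μ : Measure Ω) (c : Ω → Fin m) (f : Ω → ℝ) (a : Fin m) : ℝ :=
  (∫ x in c ⁻¹' {a}, f x ∂μ) / √(cellMass μ c a)

/-- The step function with normalized values `w`. -/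
def cellStep (μ : Measure Ω) (c : Ω → Fin m) (w : Fin m → ℝ) (x : Ω) : ℝ :=
  w (c x) / √(cellMass μ c (c x))

/-- The kernel matrix of a discretized integral operator. -/
def cellMatrix (p : Fin m → ℝ) (B : Fin m → Fin m → ℝ) : Matrix (Fin m) (Fin m) ℝ :=
  Matrix.of fun a b => √(p a) * B a b * √(p b)

theorem cellMass_nonneg (μ : Measure Ω) (c : Ω → Fin m) (a : Fin m) : 0 ≤ cellMass μ c a :=
  measureReal_nonneg

theorem integral_comp_mul {μ : Measure Ω} {c : Ω → Fin m} (hc : Measurable c) (g : Fin m → ℝ)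
    {f : Ω → ℝ} (hf : Integrable f μ) :
    ∫ x, g (c x) * f x ∂μ = ∑ a, g a * ∫ x in c ⁻¹' {a}, f x ∂μ := by
  have hm : ∀ a, MeasurableSet (c ⁻¹' {a}) := fun a => hc (measurableSet_singleton a)
  have e : ∀ x, g (c x) * f x = ∑ a, (c ⁻¹' {a}).indicator (fun x => g a * f x) x := by
    intro x
    rw [Finset.sum_eq_single (c x)]
    · simp
    · intro b _ hb
      exact Set.indicator_of_notMem (by simpa using hb.symm) _
    · simp
  simp only [e]
  rw [integral_finsetSum _ fun a _ => (hf.const_mul (g a)).indicator (hm a)]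
  refine Finset.sum_congr rfl fun a _ => ?_
  rw [integral_indicator (hm a), integral_const_mul]

variable {μ : Measure Ω} [IsProbabilityMeasure μ] {c : Ω → Fin m}

theorem cellMass_le_one (a : Fin m) : cellMass μ c a ≤ 1 := measureReal_le_one

/-- Cauchy–Schwarz, as the discriminant condition for the nonnegative quadratic `r ↦ ∫ (f - r)²`
over `s`. -/
theorem setIntegral_sq_le {s : Set Ω} {f : Ω → ℝ} (hf : MemLp f 2 μ) :
    (∫ x in s, f x ∂μ) ^ 2 ≤ μ.real s * ∫ x in s, f x ^ 2 ∂μ := by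
  have h2 : Integrable (fun x => f x ^ 2) (μ.restrict s) := (hf.restrict s).integrable_sq
  have h1 : Integrable f (μ.restrict s) := (hf.restrict s).integrable one_le_two
  set P := μ.real s with hP
  set X := ∫ x in s, f x ∂μ with hX
  set Z := ∫ x in s, f x ^ 2 ∂μ with hZ
  have key : ∀ r : ℝ, 0 ≤ P * (r * r) + (-2 * X) * r + Z := by
    intro r
    have : 0 ≤ ∫ x in s, (f x - r) ^ 2 ∂μ := integral_nonneg fun x => sq_nonneg _
    have e : ∫ x in s, (f x - r) ^ 2 ∂μ = P * (r * r) + (-2 * X) * r + Z := by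
      have e1 : ∀ x, (f x - r) ^ 2 = f x ^ 2 - 2 * r * f x + r ^ 2 := fun x => by ring
      simp only [e1]
      have h3 : Integrable (fun x => 2 * r * f x) (μ.restrict s) := h1.const_mul _
      rw [integral_add (f := fun x => f x ^ 2 - 2 * r * f x) (h2.sub h3) (integrable_const _),
        integral_sub h2 h3, integral_const_mul, integral_const]
      simp only [measureReal_restrict_apply_univ, smul_eq_mul]
      rw [← hX, ← hZ, ← hP]
      ring
    linarith
  have := discrim_le_zero key
  rw [discrim] at this
  nlinarith

theorem sum_cellAverage_sq_le (hc : Measurable c) {f : Ω → ℝ} (hf : MemLp f 2 μ) :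
    ∑ a, cellAverage μ c f a ^ 2 ≤ ∫ x, f x ^ 2 ∂μ := by
  have h := integral_comp_mul hc (fun _ => 1) hf.integrable_sq
  simp only [one_mul] at h
  rw [h]
  refine Finset.sum_le_sum fun a _ => ?_
  have hp := cellMass_nonneg μ c a
  rw [cellAverage, div_pow, Real.sq_sqrt hp]
  refine div_le_of_le_mul₀ hp (integral_nonneg fun x => sq_nonneg _) ?_
  rw [mul_comm]
  exact setIntegral_sq_le hf

/-- Also true on a cell of mass zero: the division there has the value `0`, and so does the
integral. -/
theorem cellAverage_mul_sqrt {f : Ω → ℝ} (hf : MemLp f 2 μ) (a : Fin m) :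
    √(cellMass μ c a) * cellAverage μ c f a = ∫ x in c ⁻¹' {a}, f x ∂μ := by
  rcases (cellMass_nonneg μ c a).eq_or_lt with h | h
  · have := setIntegral_sq_le (s := c ⁻¹' {a}) hf
    rw [show μ.real (c ⁻¹' {a}) = 0 from h.symm, zero_mul] at this
    rw [← h, Real.sqrt_zero, zero_mul]
    exact (pow_eq_zero_iff two_ne_zero |>.1 (le_antisymm this (sq_nonneg _))).symm
  · rw [cellAverage, mul_div_cancel₀ _ (Real.sqrt_pos.2 h).ne']

theorem inner_cellMatrix (p : Fin m → ℝ) (B : Fin m → Fin m → ℝ) (w : EuclideanSpace ℝ (Fin m)) :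
    inner ℝ (Matrix.toEuclideanLin (cellMatrix p B) w) w =
      ∑ a, ∑ b, B a b * (√(p a) * w a) * (√(p b) * w b) := by
  simp only [PiLp.inner_apply, Matrix.toLpLin_apply, cellMatrix, Matrix.mulVec, dotProduct,
    Matrix.of_apply, RCLike.inner_apply, conj_trivial, Finset.mul_sum]
  exact Finset.sum_congr rfl fun a _ => Finset.sum_congr rfl fun b _ => by ring

theorem integral_abs_sq_le {f : Ω → ℝ} (hf : MemLp f 2 μ) :
    (∫ x, |f x| ∂μ) ^ 2 ≤ ∫ x, f x ^ 2 ∂μ := by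
  have := setIntegral_sq_le (s := Set.univ) hf.abs
  simpa using this

/-- The quadratic form of an integral operator is close to that of its discretization. -/
theorem abs_form_sub_le (hc : Measurable c) {k : Ω → Ω → ℝ} {B : Fin m → Fin m → ℝ} {η : ℝ}
    (hk : ∀ x, Measurable (k x)) (hkB : ∀ x y, |k x y - B (c x) (c y)| ≤ η)
    {f : Ω → ℝ} (hf : MemLp f 2 μ)
    (hfk : Integrable (fun x => (∫ y, k x y * f y ∂μ) * f x) μ) :
    |∫ x, (∫ y, k x y * f y ∂μ) * f x ∂μ - inner ℝ
      (Matrix.toEuclideanLin (cellMatrix (cellMass μ c) B) (WithLp.toLp 2 (cellAverage μ c f)))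
      (WithLp.toLp 2 (cellAverage μ c f))| ≤ η * ∫ x, f x ^ 2 ∂μ := by
  have hf1 : Integrable f μ := hf.integrable one_le_two
  have hη : 0 ≤ η := by
    obtain ⟨x⟩ : Nonempty Ω := μ.nonempty_of_neZero
    exact (abs_nonneg _).trans (hkB x x)
  rw [inner_cellMatrix]
  simp only [cellAverage_mul_sqrt hf]
  have e1 : ∀ a, ∫ y, B a (c y) * f y ∂μ = ∑ b, B a b * ∫ x in c ⁻¹' {b}, f x ∂μ :=
    fun a => integral_comp_mul hc (B a) hf1
  have e2 : ∑ a, ∑ b, B a b * (∫ x in c ⁻¹' {a}, f x ∂μ) * ∫ x in c ⁻¹' {b}, f x ∂μ =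
      ∫ x, (∫ y, B (c x) (c y) * f y ∂μ) * f x ∂μ := by
    rw [integral_comp_mul hc (fun a => ∫ y, B a (c y) * f y ∂μ) hf1]
    refine Finset.sum_congr rfl fun a _ => ?_
    rw [e1, Finset.sum_mul]
    exact Finset.sum_congr rfl fun b _ => by ring
  have hBm : ∀ a, Measurable fun y => B a (c y) := fun a =>
    (measurable_of_countable (B a)).comp hc
  have hBi : ∀ a, Integrable (fun y => B a (c y) * f y) μ := fun a => by
    refine Integrable.bdd_mul (c := ∑ b, |B a b|) hf1 (hBm a).aestronglyMeasurable
      (Eventually.of_forall fun y => ?_)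
    exact Finset.single_le_sum (f := fun b => |B a b|) (fun _ _ => abs_nonneg _)
      (Finset.mem_univ (c y))
  have hki : ∀ x, Integrable (fun y => k x y * f y) μ := fun x => by
    have hd : Integrable (fun y => (k x y - B (c x) (c y)) * f y) μ :=
      Integrable.bdd_mul (c := η) hf1 ((hk x).sub (hBm _)).aestronglyMeasurable
        (Eventually.of_forall fun y => hkB x y)
    have := hd.add (hBi (c x))
    refine this.congr (Eventually.of_forall fun y => ?_)
    simp only [Pi.add_apply]; ring
  have hI2 : Integrable (fun x => (∫ y, B (c x) (c y) * f y ∂μ) * f x) μ := by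
    refine Integrable.bdd_mul (c := ∑ a, |∫ y, B a (c y) * f y ∂μ|) hf1 ?_
      (Eventually.of_forall fun x => ?_)
    · exact ((measurable_of_countable fun a => ∫ y, B a (c y) * f y ∂μ).comp
        hc).aestronglyMeasurable
    · exact Finset.single_le_sum (f := fun a => |∫ y, B a (c y) * f y ∂μ|)
        (fun _ _ => abs_nonneg _) (Finset.mem_univ (c x))
  rw [e2, ← integral_sub hfk hI2]
  -- The uniform kernel error `η` costs `η` times the squared `L¹` norm of `f`, which is at most the
  -- squared `L²` norm as `μ` is a probability measure.
  have pt : ∀ x, ‖(∫ y, k x y * f y ∂μ) * f x - (∫ y, B (c x) (c y) * f y ∂μ) * f x‖ ≤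
      (η * ∫ y, |f y| ∂μ) * |f x| := by
    intro x
    rw [← sub_mul, norm_mul, ← integral_sub (hki x) (hBi (c x))]
    refine mul_le_mul_of_nonneg_right ?_ (norm_nonneg _)
    rw [← integral_const_mul]
    refine norm_integral_le_of_norm_le (hf1.abs.const_mul η) (Eventually.of_forall fun y => ?_)
    rw [← sub_mul, norm_mul]
    exact mul_le_mul_of_nonneg_right (hkB x y) (abs_nonneg _)
  rw [← Real.norm_eq_abs]
  refine (norm_integral_le_of_norm_le (hf1.abs.const_mul _) (Eventually.of_forall pt)).trans ?_
  rw [integral_const_mul, mul_assoc, ← sq]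
  exact mul_le_mul_of_nonneg_left (integral_abs_sq_le hf) hη

theorem measurable_cellStep (hc : Measurable c) (w : Fin m → ℝ) : Measurable (cellStep μ c w) :=
  (measurable_of_countable fun a => w a / √(cellMass μ c a)).comp hc

theorem memLp_cellStep (hc : Measurable c) (w : Fin m → ℝ) : MemLp (cellStep μ c w) 2 μ := by
  refine MemLp.of_bound (C := ∑ a, |w a / √(cellMass μ c a)|)
    (measurable_cellStep hc w).aestronglyMeasurable (Eventually.of_forall fun x => ?_)
  exact Finset.single_le_sum (f := fun a => |w a / √(cellMass μ c a)|)
    (fun _ _ => abs_nonneg _) (Finset.mem_univ (c x))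

theorem integral_cellStep_sq_le (hc : Measurable c) (w : Fin m → ℝ) :
    ∫ x, cellStep μ c w x ^ 2 ∂μ ≤ ∑ a, w a ^ 2 := by
  have h := integral_comp_mul (μ := μ) hc (fun a => (w a / √(cellMass μ c a)) ^ 2)
    (integrable_const (1 : ℝ))
  simp only [mul_one] at h
  change ∫ x, (w (c x) / √(cellMass μ c (c x))) ^ 2 ∂μ ≤ _
  rw [h]
  refine Finset.sum_le_sum fun a _ => ?_
  rw [setIntegral_const, smul_eq_mul, mul_one, div_pow, Real.sq_sqrt (cellMass_nonneg μ c a)]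
  change _ * cellMass μ c a ≤ _
  rcases (cellMass_nonneg μ c a).eq_or_lt with h | h
  · rw [← h, mul_zero]; exact sq_nonneg _
  · rw [div_mul_cancel₀ _ h.ne']

theorem cellAverage_cellStep (hc : Measurable c) (w : Fin m → ℝ) (a : Fin m) :
    √(cellMass μ c a) * cellAverage μ c (cellStep μ c w) a = √(cellMass μ c a) * w a := by
  rw [cellAverage_mul_sqrt (memLp_cellStep hc w)]
  have hm : MeasurableSet (c ⁻¹' {a}) := hc (measurableSet_singleton a)
  have : ∫ x in c ⁻¹' {a}, cellStep μ c w x ∂μ =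
      ∫ x in c ⁻¹' {a}, w a / √(cellMass μ c a) ∂μ := by
    refine setIntegral_congr_fun hm fun x hx => ?_
    have : c x = a := hx
    simp only [cellStep, this]
  rw [this, setIntegral_const, smul_eq_mul]
  change cellMass μ c a * _ = _
  have hp := cellMass_nonneg μ c a
  rcases hp.eq_or_lt with h | h
  · rw [← h]; simp
  · have hs := Real.sqrt_pos.2 h
    nth_rewrite 1 [← Real.mul_self_sqrt hp]
    field_simp

/-- Averaging undoes the step map except on null cells, and the form sees each coordinate only
multiplied by the root of its cell mass. -/
theorem inner_cellMatrix_cellAverage_cellStep (hc : Measurable c) (B : Fin m → Fin m → ℝ)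
    (w : EuclideanSpace ℝ (Fin m)) :
    inner ℝ (Matrix.toEuclideanLin (cellMatrix (cellMass μ c) B)
      (WithLp.toLp 2 (cellAverage μ c (cellStep μ c w))))
      (WithLp.toLp 2 (cellAverage μ c (cellStep μ c w))) =
    inner ℝ (Matrix.toEuclideanLin (cellMatrix (cellMass μ c) B) w) w := by
  simp only [inner_cellMatrix, cellAverage_cellStep hc]

theorem abs_sqrt_sub_sqrt_le {a b : ℝ} (ha : 0 ≤ a) (hb : 0 ≤ b) : |√a - √b| ≤ √|a - b| := by
  refine Real.le_sqrt_of_sq_le ?_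
  rw [sq_abs]
  have h1 := Real.sq_sqrt ha
  have h2 := Real.sq_sqrt hb
  have h3 := Real.sqrt_nonneg a
  have h4 := Real.sqrt_nonneg b
  rcases le_total (√a) (√b) with h | h
  · refine le_trans ?_ (neg_le_abs _)
    nlinarith
  · refine le_trans ?_ (le_abs_self _)
    nlinarith

/-- Perturbation of the cell masses. -/
theorem inner_cellMatrix_le {p p' : Fin m → ℝ} (hp0 : ∀ a, 0 ≤ p a) (hp1 : ∀ a, p a ≤ 1)
    (hp0' : ∀ a, 0 ≤ p' a) (hp1' : ∀ a, p' a ≤ 1) {τ : ℝ} (hτ : ∀ a, |p a - p' a| ≤ τ)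
    {B : Fin m → Fin m → ℝ} (hB : ∀ a b, |B a b| ≤ 1) (w : EuclideanSpace ℝ (Fin m)) :
    |inner ℝ (Matrix.toEuclideanLin (cellMatrix p B) w) w -
      inner ℝ (Matrix.toEuclideanLin (cellMatrix p' B) w) w| ≤ 2 * m * √τ * ‖w‖ ^ 2 := by
  rw [inner_cellMatrix, inner_cellMatrix, ← Finset.sum_sub_distrib]
  have hd : ∀ a, |√(p a) - √(p' a)| ≤ √τ := fun a =>
    (abs_sqrt_sub_sqrt_le (hp0 a) (hp0' a)).trans (Real.sqrt_le_sqrt (hτ a))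
  have hs1 : ∀ a, |√(p a)| ≤ 1 := fun a => by
    rw [abs_of_nonneg (Real.sqrt_nonneg _)]; exact Real.sqrt_le_one.2 (hp1 a)
  have hs1' : ∀ a, |√(p' a)| ≤ 1 := fun a => by
    rw [abs_of_nonneg (Real.sqrt_nonneg _)]; exact Real.sqrt_le_one.2 (hp1' a)
  have pt : ∀ a b, |B a b * (√(p a) * w a) * (√(p b) * w b) -
      B a b * (√(p' a) * w a) * (√(p' b) * w b)| ≤ 2 * √τ * (|w a| * |w b|) := by
    intro a b
    have e : B a b * (√(p a) * w a) * (√(p b) * w b) - B a b * (√(p' a) * w a) * (√(p' b) * w b) =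
        B a b * ((√(p a) - √(p' a)) * √(p b) + √(p' a) * (√(p b) - √(p' b))) * (w a * w b) := by
      ring
    rw [e, abs_mul, abs_mul, abs_mul (w a)]
    refine mul_le_mul_of_nonneg_right ?_ (by positivity)
    have h1 : |(√(p a) - √(p' a)) * √(p b) + √(p' a) * (√(p b) - √(p' b))| ≤ 2 * √τ := by
      refine (abs_add_le _ _).trans ?_
      rw [abs_mul, abs_mul]
      have k1 := mul_le_mul (hd a) (hs1 b) (abs_nonneg _) (Real.sqrt_nonneg τ)
      have k2 := mul_le_mul (hs1' a) (hd b) (abs_nonneg _) zero_le_one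
      linarith
    calc |B a b| * |(√(p a) - √(p' a)) * √(p b) + √(p' a) * (√(p b) - √(p' b))|
        ≤ 1 * (2 * √τ) := mul_le_mul (hB a b) h1 (abs_nonneg _) zero_le_one
      _ = 2 * √τ := one_mul _
  -- Cauchy–Schwarz; this is the source of the factor `m` in the bound.
  have hw : (∑ a, |w a|) ^ 2 ≤ m * ‖w‖ ^ 2 := by
    have := sq_sum_le_card_mul_sum_sq (s := Finset.univ) (f := fun a => |w a|)
    rw [EuclideanSpace.norm_sq_eq]
    simpa using this
  calc |∑ a, (∑ b, B a b * (√(p a) * w a) * (√(p b) * w b) -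
        ∑ b, B a b * (√(p' a) * w a) * (√(p' b) * w b))|
      ≤ ∑ a, ∑ b, 2 * √τ * (|w a| * |w b|) := by
        refine (Finset.abs_sum_le_sum_abs _ _).trans (Finset.sum_le_sum fun a _ => ?_)
        rw [← Finset.sum_sub_distrib]
        exact (Finset.abs_sum_le_sum_abs _ _).trans (Finset.sum_le_sum fun b _ => pt a b)
    _ = 2 * √τ * (∑ a, |w a|) ^ 2 := by
        rw [sq, Finset.sum_mul_sum, Finset.mul_sum]
        simp only [Finset.mul_sum]
    _ ≤ 2 * √τ * (m * ‖w‖ ^ 2) := mul_le_mul_of_nonneg_left hw (by positivity)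
    _ = _ := by ring

end Discretization

end

end LatentGraph

namespace LatentGraph

noncomputable section

/-! ### Comparing the integral operator with the Gram matrix through cells. -/

section Comparison

variable {E F : Type*} [NormedAddCommGroup E] [InnerProductSpace ℝ E]
  [NormedAddCommGroup F] [InnerProductSpace ℝ F]

theorem HasFormBound.transport_smul {T : E →ₗ[ℝ] E} {S : F →ₗ[ℝ] F} (J : E →ₗ[ℝ] F) {a η θ : ℝ}
    {k : ℕ} (ha : |a| ≤ 1) (h : HasFormBound (a • T) θ k) (hηθ : η < θ) (hJ : ∀ f, ‖J f‖ ≤ ‖f‖)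
    (hform : ∀ f, |inner ℝ (T f) f - inner ℝ (S (J f)) (J f)| ≤ η * ‖f‖ ^ 2) :
    HasFormBound (a • S) (θ - η) k := by
  refine h.transport hηθ hJ fun f => ?_
  simp only [LinearMap.smul_apply, inner_smul_left, conj_trivial]
  have h1 : a * inner ℝ (T f) f - a * inner ℝ (S (J f)) (J f) ≤ η * ‖f‖ ^ 2 := by
    rw [← mul_sub]
    refine (le_abs_self _).trans ?_
    rw [abs_mul]
    exact (mul_le_of_le_one_left (abs_nonneg _) ha).trans (hform f)
  linarith

theorem norm_sq_Lp {Ω : Type*} [MeasurableSpace Ω] {μ : Measure Ω} (f : Lp ℝ 2 μ) :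
    ‖f‖ ^ 2 = ∫ x, f x ^ 2 ∂μ := by
  rw [← real_inner_self_eq_norm_sq, L2.inner_def]
  simp [sq]

theorem inner_integralOperator (κ : SmallWorldKernel) (D : Measure I) [IsProbabilityMeasure D]
    (f g : Lp ℝ 2 D) :
    inner ℝ (κ.integralOperator D f) g = ∫ x, (∫ y, κ.val x y * f y ∂D) * g x ∂D := by
  rw [L2.inner_def]
  refine integral_congr_ae ?_
  have h : (κ.integralOperator D f : I → ℝ) =ᵐ[D] fun x => ∫ y, κ.val x y * f y ∂D :=
    MemLp.coeFn_toLp (κ.memLp_integral D f)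
  filter_upwards [h] with x hx
  rw [hx]
  simp [mul_comm]

variable {m : ℕ}

theorem cellAverage_congr {Ω : Type*} [MeasurableSpace Ω] {μ : Measure Ω} {c : Ω → Fin m}
    {f g : Ω → ℝ} (h : f =ᵐ[μ] g) : cellAverage μ c f = cellAverage μ c g := by
  funext a
  rw [cellAverage, cellAverage, integral_congr_ae (ae_restrict_of_ae h)]

theorem cellAverage_add {Ω : Type*} [MeasurableSpace Ω] {μ : Measure Ω} {c : Ω → Fin m}
    {f g : Ω → ℝ} (hf : Integrable f μ) (hg : Integrable g μ) :
    cellAverage μ c (f + g) = cellAverage μ c f + cellAverage μ c g := by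
  funext a
  simp only [cellAverage, Pi.add_apply]
  rw [integral_add hf.integrableOn hg.integrableOn, add_div]

theorem cellAverage_smul {Ω : Type*} [MeasurableSpace Ω] {μ : Measure Ω} {c : Ω → Fin m}
    (r : ℝ) (f : Ω → ℝ) : cellAverage μ c (r • f) = r • cellAverage μ c f := by
  funext a
  simp only [cellAverage, Pi.smul_apply, smul_eq_mul]
  rw [integral_const_mul, mul_div_assoc]

theorem cellStep_add {Ω : Type*} [MeasurableSpace Ω] (μ : Measure Ω) (c : Ω → Fin m)
    (w w' : Fin m → ℝ) : cellStep μ c (w + w') = cellStep μ c w + cellStep μ c w' := by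
  funext x
  simp only [cellStep, Pi.add_apply, add_div]

theorem cellStep_smul {Ω : Type*} [MeasurableSpace Ω] (μ : Measure Ω) (c : Ω → Fin m)
    (r : ℝ) (w : Fin m → ℝ) : cellStep μ c (r • w) = r • cellStep μ c w := by
  funext x
  simp only [cellStep, Pi.smul_apply, smul_eq_mul, mul_div_assoc]

/-- Cell averages as a linear map on `L²`. -/
def averageMap (D : Measure I) [IsProbabilityMeasure D] (c : I → Fin m) :
    Lp ℝ 2 D →ₗ[ℝ] EuclideanSpace ℝ (Fin m) where
  toFun f := WithLp.toLp 2 (cellAverage D c f)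
  map_add' f g := by
    rw [cellAverage_congr (Lp.coeFn_add f g), cellAverage_add ((Lp.memLp f).integrable one_le_two)
      ((Lp.memLp g).integrable one_le_two), WithLp.toLp_add]
  map_smul' r f := by
    rw [cellAverage_congr (Lp.coeFn_smul r f), cellAverage_smul, WithLp.toLp_smul, RingHom.id_apply]

/-- Step functions as a linear map into `L²`. -/
def stepMap (D : Measure I) [IsProbabilityMeasure D] {c : I → Fin m} (hc : Measurable c) :
    EuclideanSpace ℝ (Fin m) →ₗ[ℝ] Lp ℝ 2 D where
  toFun w := (memLp_cellStep (μ := D) hc w).toLp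
  map_add' w w' := by
    rw [← MemLp.toLp_add]
    exact MemLp.toLp_congr _ _ (Eventually.of_forall fun x =>
      congrFun (cellStep_add D c w w') x)
  map_smul' r w := by
    rw [RingHom.id_apply, ← MemLp.toLp_const_smul]
    exact MemLp.toLp_congr _ _ (Eventually.of_forall fun x =>
      congrFun (cellStep_smul D c r w) x)

theorem norm_averageMap_le (D : Measure I) [IsProbabilityMeasure D] {c : I → Fin m}
    (hc : Measurable c) (f : Lp ℝ 2 D) : ‖averageMap D c f‖ ≤ ‖f‖ := by
  refine le_of_sq_le_sq ?_ (norm_nonneg _)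
  rw [norm_sq_Lp, EuclideanSpace.norm_sq_eq]
  simpa [averageMap] using sum_cellAverage_sq_le hc (Lp.memLp f)

theorem norm_stepMap_le (D : Measure I) [IsProbabilityMeasure D] {c : I → Fin m}
    (hc : Measurable c) (w : EuclideanSpace ℝ (Fin m)) : ‖stepMap D hc w‖ ≤ ‖w‖ := by
  refine le_of_sq_le_sq ?_ (norm_nonneg _)
  rw [norm_sq_Lp, EuclideanSpace.norm_sq_eq]
  have h : ∫ x, (stepMap D hc w : I → ℝ) x ^ 2 ∂D = ∫ x, cellStep D c w x ^ 2 ∂D := by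
    refine integral_congr_ae ?_
    filter_upwards [MemLp.coeFn_toLp (memLp_cellStep (μ := D) hc w)] with x hx
    exact congrArg (· ^ 2) hx
  rw [h]
  simpa using integral_cellStep_sq_le hc w

theorem abs_inner_integralOperator_sub_le (κ : SmallWorldKernel) (D : Measure I)
    [IsProbabilityMeasure D] {c : I → Fin m} (hc : Measurable c) {B : Fin m → Fin m → ℝ} {η : ℝ}
    (hB : ∀ x y, |κ.val x y - B (c x) (c y)| ≤ η) (f : Lp ℝ 2 D) :
    |inner ℝ (κ.integralOperator D f) f - inner ℝ
      (Matrix.toEuclideanLin (cellMatrix (cellMass D c) B) (averageMap D c f))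
      (averageMap D c f)| ≤ η * ‖f‖ ^ 2 := by
  rw [inner_integralOperator, norm_sq_Lp]
  refine abs_form_sub_le hc (fun x => ?_) hB (Lp.memLp f) ?_
  · exact (κ.continuous_val.comp (by fun_prop : Continuous fun y : I => (x, y))).measurable
  · exact (κ.memLp_integral D f).integrable_mul (Lp.memLp f)

theorem abs_inner_integralOperator_stepMap_sub_le (κ : SmallWorldKernel) (D : Measure I)
    [IsProbabilityMeasure D] {c : I → Fin m} (hc : Measurable c) {B : Fin m → Fin m → ℝ} {η : ℝ}
    (hη : 0 ≤ η) (hB : ∀ x y, |κ.val x y - B (c x) (c y)| ≤ η) (w : EuclideanSpace ℝ (Fin m)) :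
    |inner ℝ (Matrix.toEuclideanLin (cellMatrix (cellMass D c) B) w) w -
      inner ℝ (κ.integralOperator D (stepMap D hc w)) (stepMap D hc w)| ≤ η * ‖w‖ ^ 2 := by
  have h := abs_inner_integralOperator_sub_le κ D hc hB (stepMap D hc w)
  have e : averageMap D c (stepMap D hc w) =
      WithLp.toLp 2 (cellAverage D c (cellStep D c w)) := by
    exact congrArg (WithLp.toLp 2)
      (cellAverage_congr (MemLp.coeFn_toLp (memLp_cellStep (μ := D) hc w)))
  rw [e, inner_cellMatrix_cellAverage_cellStep hc] at h
  rw [abs_sub_comm]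
  exact h.trans (mul_le_mul_of_nonneg_left
    (pow_le_pow_left₀ (norm_nonneg _) (norm_stepMap_le D hc w) 2) hη)

/-- The uniform probability measure on `Fin n`. -/
def indexMeasure (n : ℕ) : Measure (Fin n) := (n : ENNReal)⁻¹ • Measure.count

variable {n : ℕ}

theorem isProbabilityMeasure_indexMeasure (hn : n ≠ 0) : IsProbabilityMeasure (indexMeasure n) := by
  constructor
  rw [indexMeasure, Measure.smul_apply, smul_eq_mul, Measure.count_apply MeasurableSet.univ]
  simp only [Set.encard_univ, ENat.card_eq_coe_fintype_card, Fintype.card_fin]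
  exact ENNReal.inv_mul_cancel (by simpa using hn) (by simp)

theorem integral_indexMeasure (f : Fin n → ℝ) :
    ∫ i, f i ∂(indexMeasure n) = (n : ℝ)⁻¹ * ∑ i, f i := by
  rw [indexMeasure, integral_smul_measure, integral_count]
  simp

theorem memLp_indexMeasure (hn : n ≠ 0) (f : Fin n → ℝ) : MemLp f 2 (indexMeasure n) := by
  have := isProbabilityMeasure_indexMeasure hn
  exact MemLp.of_bound (C := ∑ i, |f i|) (measurable_of_countable f).aestronglyMeasurable
    (Eventually.of_forall fun i => Finset.single_le_sum (f := fun i => |f i|)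
      (fun _ _ => abs_nonneg _) (Finset.mem_univ i))

/-- The rescaled kernel matrix `K / n`. -/
def scaledGram (κ : SmallWorldKernel) (x : Fin n → I) : Matrix (Fin n) (Fin n) ℝ :=
  (n : ℝ)⁻¹ • gramMatrix κ x

/-- The matrix `K / n` is itself an integral operator, for the uniform measure on the indices, under
the isometry `v ↦ √n v`. The discretization lemmas thus serve both sides. -/
theorem inner_scaledGram (κ : SmallWorldKernel) (hn : n ≠ 0) (x : Fin n → I)
    (v : EuclideanSpace ℝ (Fin n)) :
    inner ℝ (Matrix.toEuclideanLin (scaledGram κ x) v) v =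
      ∫ i, (∫ j, κ.val (x i) (x j) * (√n * v j) ∂(indexMeasure n)) * (√n * v i)
        ∂(indexMeasure n) := by
  have hn' : (0 : ℝ) < n := by positivity
  simp only [integral_indexMeasure, PiLp.inner_apply, Matrix.toLpLin_apply, scaledGram,
    gramMatrix, Matrix.mulVec, dotProduct, Matrix.of_apply, Matrix.smul_apply, smul_eq_mul,
    RCLike.inner_apply, conj_trivial, Finset.mul_sum, Finset.sum_mul]
  refine Finset.sum_congr rfl fun i _ => Finset.sum_congr rfl fun j _ => ?_
  have hs := Real.mul_self_sqrt hn'.le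
  calc v i * ((n : ℝ)⁻¹ * κ.val (x i) (x j) * v j)
      = (n : ℝ)⁻¹ * ((n : ℝ)⁻¹ * n) * κ.val (x i) (x j) * v j * v i := by
        rw [inv_mul_cancel₀ hn'.ne']; ring
    _ = _ := by nth_rewrite 3 [← hs]; ring

theorem norm_sq_eq_integral_indexMeasure (hn : n ≠ 0) (v : EuclideanSpace ℝ (Fin n)) :
    ‖v‖ ^ 2 = ∫ i, (√n * v i) ^ 2 ∂(indexMeasure n) := by
  have hn' : (0 : ℝ) < n := by positivity
  rw [integral_indexMeasure, EuclideanSpace.norm_sq_eq, Finset.mul_sum]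
  refine Finset.sum_congr rfl fun i _ => ?_
  rw [mul_pow, Real.sq_sqrt hn'.le, Real.norm_eq_abs, sq_abs,
    inv_mul_cancel_left₀ (ne_of_gt (show (0 : ℝ) < n by positivity))]

/-- Cell averages as a linear map on `ℝⁿ`. -/
def indexAverageMap (hn : n ≠ 0) (c : Fin n → Fin m) :
    EuclideanSpace ℝ (Fin n) →ₗ[ℝ] EuclideanSpace ℝ (Fin m) where
  toFun v := WithLp.toLp 2 (cellAverage (indexMeasure n) c (√n • v.ofLp))
  map_add' v v' := by
    have := isProbabilityMeasure_indexMeasure hn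
    rw [WithLp.ofLp_add, smul_add, cellAverage_add
      ((memLp_indexMeasure hn _).integrable one_le_two)
      ((memLp_indexMeasure hn _).integrable one_le_two), WithLp.toLp_add]
  map_smul' r v := by
    rw [WithLp.ofLp_smul, smul_comm, cellAverage_smul, WithLp.toLp_smul, RingHom.id_apply]

/-- Step functions as a linear map into `ℝⁿ`. -/
def indexStepMap (c : Fin n → Fin m) :
    EuclideanSpace ℝ (Fin m) →ₗ[ℝ] EuclideanSpace ℝ (Fin n) where
  toFun w := WithLp.toLp 2 ((√n)⁻¹ • cellStep (indexMeasure n) c w)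
  map_add' w w' := by
    rw [WithLp.ofLp_add, cellStep_add, smul_add, WithLp.toLp_add]
  map_smul' r w := by
    rw [WithLp.ofLp_smul, cellStep_smul, smul_comm, WithLp.toLp_smul, RingHom.id_apply]

theorem norm_indexAverageMap_le (hn : n ≠ 0) (c : Fin n → Fin m) (v : EuclideanSpace ℝ (Fin n)) :
    ‖indexAverageMap hn c v‖ ≤ ‖v‖ := by
  have := isProbabilityMeasure_indexMeasure hn
  refine le_of_sq_le_sq ?_ (norm_nonneg _)
  rw [norm_sq_eq_integral_indexMeasure hn v, EuclideanSpace.norm_sq_eq]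
  simpa [indexAverageMap] using sum_cellAverage_sq_le (measurable_of_countable c)
    (memLp_indexMeasure hn (√n • v.ofLp))

theorem sqrt_smul_indexStepMap (hn : n ≠ 0) (c : Fin n → Fin m) (w : EuclideanSpace ℝ (Fin m)) :
    √n • (indexStepMap c w).ofLp = cellStep (indexMeasure n) c w := by
  have hn' : (0 : ℝ) < n := by positivity
  change √n • ((√n)⁻¹ • cellStep (indexMeasure n) c w) = _
  rw [smul_smul, mul_inv_cancel₀ (Real.sqrt_pos.2 hn').ne', one_smul]

theorem norm_indexStepMap_le (hn : n ≠ 0) (c : Fin n → Fin m) (w : EuclideanSpace ℝ (Fin m)) :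
    ‖indexStepMap c w‖ ≤ ‖w‖ := by
  have := isProbabilityMeasure_indexMeasure hn
  refine le_of_sq_le_sq ?_ (norm_nonneg _)
  rw [norm_sq_eq_integral_indexMeasure hn, EuclideanSpace.norm_sq_eq]
  have h : ∀ i, √n * (indexStepMap c w) i = cellStep (indexMeasure n) c w i := fun i =>
    congrFun (sqrt_smul_indexStepMap hn c w) i
  simp only [h]
  simpa using integral_cellStep_sq_le (μ := indexMeasure n) (measurable_of_countable c) w

theorem abs_inner_scaledGram_sub_le (κ : SmallWorldKernel) (hn : n ≠ 0) (x : Fin n → I)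
    {c : I → Fin m} {B : Fin m → Fin m → ℝ} {η : ℝ}
    (hB : ∀ x y, |κ.val x y - B (c x) (c y)| ≤ η) (v : EuclideanSpace ℝ (Fin n)) :
    |inner ℝ (Matrix.toEuclideanLin (scaledGram κ x) v) v - inner ℝ
      (Matrix.toEuclideanLin (cellMatrix (cellMass (indexMeasure n) (c ∘ x)) B)
        (indexAverageMap hn (c ∘ x) v)) (indexAverageMap hn (c ∘ x) v)| ≤ η * ‖v‖ ^ 2 := by
  have := isProbabilityMeasure_indexMeasure hn
  rw [inner_scaledGram κ hn, norm_sq_eq_integral_indexMeasure hn]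
  exact abs_form_sub_le (μ := indexMeasure n) (c := c ∘ x) (k := fun i j => κ.val (x i) (x j))
    (measurable_of_countable _) (fun i => measurable_of_countable _) (fun i j => hB (x i) (x j))
    (memLp_indexMeasure hn (√n • v.ofLp))
    ((memLp_indexMeasure hn _).integrable one_le_two)

theorem abs_inner_scaledGram_indexStepMap_sub_le (κ : SmallWorldKernel) (hn : n ≠ 0)
    (x : Fin n → I) {c : I → Fin m} {B : Fin m → Fin m → ℝ} {η : ℝ} (hη : 0 ≤ η)
    (hB : ∀ x y, |κ.val x y - B (c x) (c y)| ≤ η) (w : EuclideanSpace ℝ (Fin m)) :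
    |inner ℝ (Matrix.toEuclideanLin (cellMatrix (cellMass (indexMeasure n) (c ∘ x)) B) w) w -
      inner ℝ (Matrix.toEuclideanLin (scaledGram κ x) (indexStepMap (c ∘ x) w))
        (indexStepMap (c ∘ x) w)| ≤ η * ‖w‖ ^ 2 := by
  have := isProbabilityMeasure_indexMeasure hn
  have h := abs_inner_scaledGram_sub_le κ hn x hB (indexStepMap (c ∘ x) w)
  have e : indexAverageMap hn (c ∘ x) (indexStepMap (c ∘ x) w) =
      WithLp.toLp 2 (cellAverage (indexMeasure n) (c ∘ x)
        (cellStep (indexMeasure n) (c ∘ x) w)) := by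
    change WithLp.toLp 2 (cellAverage (indexMeasure n) (c ∘ x)
      (√n • (indexStepMap (c ∘ x) w).ofLp)) = _
    rw [sqrt_smul_indexStepMap hn]
  rw [e, inner_cellMatrix_cellAverage_cellStep (measurable_of_countable _)] at h
  rw [abs_sub_comm]
  exact h.trans (mul_le_mul_of_nonneg_left
    (pow_le_pow_left₀ (norm_nonneg _) (norm_indexStepMap_le hn _ w) 2) hη)

/-- The integral operator and the rescaled kernel matrix have almost the same form bounds as soon
as the empirical cell masses are close to the true ones. -/
theorem hasFormBound_comparison (κ : SmallWorldKernel) (D : Measure I) [IsProbabilityMeasure D]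
    (hn : n ≠ 0) (x : Fin n → I) {c : I → Fin m} (hc : Measurable c) {B : Fin m → Fin m → ℝ}
    {η τ : ℝ} (hη : 0 ≤ η) (hB : ∀ x y, |κ.val x y - B (c x) (c y)| ≤ η)
    (hB1 : ∀ a b, |B a b| ≤ 1)
    (hτ : ∀ a, |cellMass D c a - cellMass (indexMeasure n) (c ∘ x) a| ≤ τ)
    {a θ : ℝ} (ha : |a| ≤ 1) (hθ : 2 * η + 2 * m * √τ < θ) (k : ℕ) :
    (HasFormBound (a • κ.integralOperator D) θ k →
      HasFormBound (a • Matrix.toEuclideanLin (scaledGram κ x)) (θ - (2 * η + 2 * m * √τ)) k) ∧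
    (HasFormBound (a • Matrix.toEuclideanLin (scaledGram κ x)) θ k →
      HasFormBound (a • κ.integralOperator D) (θ - (2 * η + 2 * m * √τ)) k) := by
  have := isProbabilityMeasure_indexMeasure hn
  have hr : 0 ≤ 2 * m * √τ := by positivity
  have hpert := inner_cellMatrix_le (cellMass_nonneg D c) cellMass_le_one
    (cellMass_nonneg (indexMeasure n) (c ∘ x)) cellMass_le_one hτ hB1
  have hpert' : ∀ w, |inner ℝ (Matrix.toEuclideanLin
      (cellMatrix (cellMass (indexMeasure n) (c ∘ x)) B) w) w -
      inner ℝ (Matrix.toEuclideanLin (cellMatrix (cellMass D c) B) w) w| ≤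
      2 * m * √τ * ‖w‖ ^ 2 := fun w => by rw [abs_sub_comm]; exact hpert w
  constructor
  · intro h
    -- Three transports: average over the cells, exchange true for empirical masses, spread out
    -- again as a step vector. They cost `η`, `2 * m * √τ` and `η`; the other direction is the
    -- mirror image.
    have h1 := h.transport_smul (averageMap D c) ha (η := η) (by linarith)
      (norm_averageMap_le D hc) (abs_inner_integralOperator_sub_le κ D hc hB)
    have h2 := h1.transport_smul LinearMap.id ha (by linarith) (fun w => le_rfl) hpert
    have h3 := h2.transport_smul (indexStepMap (c ∘ x)) ha (by linarith)
      (norm_indexStepMap_le hn _) (abs_inner_scaledGram_indexStepMap_sub_le κ hn x hη hB)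
    convert! h3 using 1
    ring
  · intro h
    have h1 := h.transport_smul (indexAverageMap hn (c ∘ x)) ha (η := η) (by linarith)
      (norm_indexAverageMap_le hn _) (abs_inner_scaledGram_sub_le κ hn x hB)
    have h2 := h1.transport_smul LinearMap.id ha (by linarith) (fun w => le_rfl) hpert'
    have h3 := h2.transport_smul (stepMap D hc) ha (by linarith)
      (norm_stepMap_le D hc) (abs_inner_integralOperator_stepMap_sub_le κ D hc hη hB)
    convert! h3 using 1
    ring

end Comparison

end

end LatentGraph

namespace LatentGraph

noncomputable section

/-! ### The Lipschitz kernel and the partition into intervals. -/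

section Cells

/-- A Lipschitz constant of the kernel. -/
def SmallWorldKernel.lip (κ : SmallWorldKernel) : ℝ := κ.c₀ * κ.Δ / κ.c₁ ^ 2

theorem SmallWorldKernel.lip_pos (κ : SmallWorldKernel) : 0 < κ.lip := by
  have h0 := κ.c₀_pos
  have h1 : 0 < κ.c₁ := h0.trans_le κ.c₀_le_c₁
  have h2 : 0 < κ.Δ := one_pos.trans κ.one_lt_Δ
  unfold lip; positivity

theorem abs_rpow_sub_rpow_le {p u v : ℝ} (hp : 1 ≤ p) (hu : u ∈ Set.Icc (0 : ℝ) 1)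
    (hv : v ∈ Set.Icc (0 : ℝ) 1) : |u ^ p - v ^ p| ≤ p * |u - v| := by
  have h := Convex.norm_image_sub_le_of_norm_hasDerivWithin_le (f := fun x : ℝ => x ^ p)
    (f' := fun x => p * x ^ (p - 1)) (C := p) (s := Set.Icc (0 : ℝ) 1) (x := v) (y := u)
    (fun x _ => (Real.hasDerivAt_rpow_const (Or.inr hp)).hasDerivWithinAt) (fun x hx => ?_)
    (convex_Icc 0 1) hv hu
  · exact h
  · have hp0 : 0 ≤ p := zero_le_one.trans hp
    rw [Real.norm_of_nonneg (mul_nonneg hp0 (Real.rpow_nonneg hx.1 _))]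
    exact mul_le_of_le_one_right hp0 (Real.rpow_le_one hx.1 hx.2 (by linarith))

theorem SmallWorldKernel.abs_val_sub_le (κ : SmallWorldKernel) (x y x' y' : I) :
    |κ.val x y - κ.val x' y'| ≤ κ.lip * (|(x : ℝ) - x'| + |(y : ℝ) - y'|) := by
  have h1 : 0 < κ.c₁ := κ.c₀_pos.trans_le κ.c₀_le_c₁
  have hmem : ∀ a b : I, |(a : ℝ) - b| ∈ Set.Icc (0 : ℝ) 1 := fun a b => by
    refine ⟨abs_nonneg _, abs_le.2 ⟨?_, ?_⟩⟩ <;> linarith [a.2.1, a.2.2, b.2.1, b.2.2]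
  have hd := κ.denom_pos x y
  have hd' := κ.denom_pos x' y'
  have hge : ∀ a b : I, κ.c₁ ≤ |(a : ℝ) - b| ^ κ.Δ + κ.c₁ := fun a b =>
    le_add_of_nonneg_left (Real.rpow_nonneg (abs_nonneg _) _)
  have hnum : |(|(x' : ℝ) - y'| ^ κ.Δ) - (|(x : ℝ) - y| ^ κ.Δ)| ≤
      κ.Δ * (|(x : ℝ) - x'| + |(y : ℝ) - y'|) := by
    refine (abs_rpow_sub_rpow_le κ.one_lt_Δ.le (hmem x' y') (hmem x y)).trans ?_
    refine mul_le_mul_of_nonneg_left ?_ (zero_le_one.trans κ.one_lt_Δ.le)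
    refine (abs_abs_sub_abs_le _ _).trans ?_
    have : (x' : ℝ) - y' - (x - y) = -((x : ℝ) - x') + ((y : ℝ) - y') := by ring
    rw [this]
    refine (abs_add_le _ _).trans ?_
    rw [abs_neg]
  unfold val
  have e : κ.c₀ / (|(x : ℝ) - y| ^ κ.Δ + κ.c₁) - κ.c₀ / (|(x' : ℝ) - y'| ^ κ.Δ + κ.c₁) =
      κ.c₀ * (|(x' : ℝ) - y'| ^ κ.Δ - |(x : ℝ) - y| ^ κ.Δ) /
        ((|(x : ℝ) - y| ^ κ.Δ + κ.c₁) * (|(x' : ℝ) - y'| ^ κ.Δ + κ.c₁)) := by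
    field_simp
    ring
  rw [e, abs_div, abs_mul, abs_of_pos κ.c₀_pos, abs_of_pos (mul_pos hd hd'), lip,
    div_mul_eq_mul_div, mul_assoc]
  have hS : 0 ≤ κ.Δ * (|(x : ℝ) - x'| + |(y : ℝ) - y'|) := (abs_nonneg _).trans hnum
  refine div_le_div₀ (mul_nonneg κ.c₀_pos.le hS) (mul_le_mul_of_nonneg_left hnum κ.c₀_pos.le)
    (by positivity) ?_
  rw [sq]
  exact mul_le_mul (hge x y) (hge x' y') h1.le hd.le

variable {m : ℕ}

/-- The index of the cell of length `1 / m` that contains a point of the unit interval. -/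
def cellIndex (hm : m ≠ 0) (x : I) : Fin m :=
  ⟨min ⌊(m : ℝ) * x⌋₊ (m - 1), by omega⟩

/-- The left end point of a cell. -/
def cellPoint (a : Fin m) : I :=
  ⟨(a : ℝ) / m, by positivity, div_le_one_of_le₀ (by exact_mod_cast a.2.le) (by positivity)⟩

theorem measurable_cellIndex (hm : m ≠ 0) : Measurable (cellIndex hm) := by
  have h1 : Measurable fun x : I => ⌊(m : ℝ) * x⌋₊ :=
    Nat.measurable_floor.comp (measurable_subtype_coe.const_mul _)
  exact (measurable_from_nat (f := fun j => (⟨min j (m - 1), by omega⟩ : Fin m))).comp h1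

theorem abs_sub_cellPoint_le (hm : m ≠ 0) (x : I) :
    |(x : ℝ) - cellPoint (cellIndex hm x)| ≤ 1 / m := by
  have hm' : (0 : ℝ) < m := by positivity
  have hx0 := x.2.1
  have hx1 := x.2.2
  -- The minimum puts the right end point `x = 1` into the last cell.
  have key : |(m : ℝ) * x - (min ⌊(m : ℝ) * x⌋₊ (m - 1) : ℕ)| ≤ 1 := by
    have h1 := Nat.floor_le (mul_nonneg hm'.le hx0)
    have h2 := Nat.lt_floor_add_one ((m : ℝ) * x)
    rcases le_total ⌊(m : ℝ) * x⌋₊ (m - 1) with h | h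
    · rw [min_eq_left h, abs_le]
      constructor <;> linarith
    · rw [min_eq_right h]
      have h3 : ((m - 1 : ℕ) : ℝ) ≤ ⌊(m : ℝ) * x⌋₊ := by exact_mod_cast h
      have h4 : ((m - 1 : ℕ) : ℝ) = m - 1 := by
        rw [Nat.cast_sub (Nat.one_le_iff_ne_zero.2 hm)]; simp
      rw [h4] at h3 ⊢
      have h5 : (m : ℝ) * x ≤ m := mul_le_of_le_one_right hm'.le hx1
      rw [abs_le]
      constructor <;> linarith
  have e : (x : ℝ) - cellPoint (cellIndex hm x) =
      ((m : ℝ) * x - (min ⌊(m : ℝ) * x⌋₊ (m - 1) : ℕ)) / m := by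
    rw [sub_div, mul_div_cancel_left₀ _ hm'.ne']
    rfl
  rw [e, abs_div, abs_of_pos hm']
  exact div_le_div_of_nonneg_right key (Nat.cast_nonneg m)

/-- The kernel sampled at the cell end points. -/
def cellKernel (κ : SmallWorldKernel) (m : ℕ) (a b : Fin m) : ℝ :=
  κ.val (cellPoint a) (cellPoint b)

theorem abs_cellKernel_le_one (κ : SmallWorldKernel) (a b : Fin m) : |cellKernel κ m a b| ≤ 1 := by
  rw [cellKernel, abs_of_pos (κ.val_pos _ _)]
  exact κ.val_le_one _ _

theorem abs_val_sub_cellKernel_le (κ : SmallWorldKernel) (hm : m ≠ 0) (x y : I) :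
    |κ.val x y - cellKernel κ m (cellIndex hm x) (cellIndex hm y)| ≤ κ.lip * (2 / m) := by
  refine (κ.abs_val_sub_le _ _ _ _).trans (mul_le_mul_of_nonneg_left ?_ κ.lip_pos.le)
  have h1 := abs_sub_cellPoint_le hm x
  have h2 := abs_sub_cellPoint_le hm y
  have : (2 : ℝ) / m = 1 / m + 1 / m := by ring
  linarith

theorem isSymm_cellMatrix (p : Fin m → ℝ) {B : Fin m → Fin m → ℝ} (hB : ∀ a b, B a b = B b a) :
    (cellMatrix p B).IsSymm := by
  ext a b
  simp only [cellMatrix, Matrix.transpose_apply, Matrix.of_apply, hB b a]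
  ring

end Cells

/-! ### Boundedness, symmetry and compactness of the integral operator. -/

section IntegralOperator

variable (κ : SmallWorldKernel) (D : Measure I) [IsProbabilityMeasure D]

theorem norm_integralOperator_le (f : Lp ℝ 2 D) : ‖κ.integralOperator D f‖ ≤ 1 * ‖f‖ := by
  have hf1 : Integrable f D := (Lp.memLp f).integrable one_le_two
  refine le_of_sq_le_sq ?_ (by positivity)
  rw [one_mul, norm_sq_Lp, norm_sq_Lp f]
  have h : (κ.integralOperator D f : I → ℝ) =ᵐ[D] fun x => ∫ y, κ.val x y * f y ∂D :=
    MemLp.coeFn_toLp (κ.memLp_integral D f)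
  have hb : ∀ x, |∫ y, κ.val x y * f y ∂D| ≤ ∫ y, |f y| ∂D := fun x => by
    rw [← Real.norm_eq_abs]
    refine norm_integral_le_of_norm_le hf1.abs (Eventually.of_forall fun y => ?_)
    rw [norm_mul, Real.norm_of_nonneg (κ.val_pos x y).le]
    exact mul_le_of_le_one_left (norm_nonneg _) (κ.val_le_one x y)
  calc ∫ x, (κ.integralOperator D f : I → ℝ) x ^ 2 ∂D
      = ∫ x, (∫ y, κ.val x y * f y ∂D) ^ 2 ∂D := by
        refine integral_congr_ae ?_
        filter_upwards [h] with x hx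
        rw [hx]
    _ ≤ ∫ _x, (∫ y, |f y| ∂D) ^ 2 ∂D := by
        refine integral_mono (κ.memLp_integral D f).integrable_sq (integrable_const _) fun x => ?_
        exact sq_le_sq' (neg_le_of_abs_le (hb x)) (le_of_abs_le (hb x))
    _ = (∫ y, |f y| ∂D) ^ 2 := by simp
    _ ≤ _ := integral_abs_sq_le (Lp.memLp f)

theorem isSymmetric_integralOperator : (κ.integralOperator D).IsSymmetric := by
  intro f g
  have hf1 : Integrable f D := (Lp.memLp f).integrable one_le_two
  have hg1 : Integrable g D := (Lp.memLp g).integrable one_le_two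
  rw [real_inner_comm (κ.integralOperator D g) f, inner_integralOperator, inner_integralOperator]
  simp only [← integral_mul_const]
  rw [integral_integral_swap]
  · refine integral_congr_ae (Eventually.of_forall fun y => ?_)
    refine integral_congr_ae (Eventually.of_forall fun x => ?_)
    simp only [κ.val_comm x y]
    ring
  · have h := hg1.mul_prod hf1
    have h2 : Integrable (fun z : I × I => κ.val z.1 z.2 * (g z.1 * f z.2)) (D.prod D) := by
      refine Integrable.bdd_mul (c := 1) h κ.continuous_val.aestronglyMeasurable
        (Eventually.of_forall fun z => ?_)
      rw [Real.norm_of_nonneg (κ.val_pos _ _).le]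
      exact κ.val_le_one _ _
    refine h2.congr (Eventually.of_forall fun z => ?_)
    simp only [Function.uncurry]
    ring

/-- The integral operator as a bounded operator. -/
def integralCLM : Lp ℝ 2 D →L[ℝ] Lp ℝ 2 D :=
  LinearMap.mkContinuous (κ.integralOperator D) 1 (norm_integralOperator_le κ D)

theorem norm_le_of_abs_inner_le {E : Type*} [NormedAddCommGroup E] [InnerProductSpace ℝ E]
    {S : E →L[ℝ] E} (hS : S.IsSymmetric) {η : ℝ} (hη : 0 ≤ η)
    (h : ∀ f, |inner ℝ (S f) f| ≤ η * ‖f‖ ^ 2) : ‖S‖ ≤ η := by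
  rw [S.norm_eq_iSup_rayleighQuotient hS]
  refine ciSup_le fun f => ?_
  rw [ContinuousLinearMap.rayleighQuotient, abs_div, abs_of_nonneg (sq_nonneg ‖f‖)]
  exact div_le_of_le_mul₀ (sq_nonneg _) hη (by simpa [ContinuousLinearMap.reApplyInnerSelf] using h f)

/-- The discretized operators `J* B J` factor through finite dimensional spaces and converge in
norm; for symmetric differences the norm is read off from the quadratic form. -/
theorem isCompactOperator_integralCLM : IsCompactOperator (integralCLM κ D) := by
  let J (m : ℕ) : Lp ℝ 2 D →L[ℝ] EuclideanSpace ℝ (Fin (m + 1)) :=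
    LinearMap.mkContinuous (averageMap D (cellIndex m.succ_ne_zero)) 1
      (fun f => by rw [one_mul]; exact norm_averageMap_le D (measurable_cellIndex _) f)
  let B (m : ℕ) : EuclideanSpace ℝ (Fin (m + 1)) →L[ℝ] EuclideanSpace ℝ (Fin (m + 1)) :=
    LinearMap.toContinuousLinearMap (Matrix.toEuclideanLin
      (cellMatrix (cellMass D (cellIndex m.succ_ne_zero)) (cellKernel κ (m + 1))))
  let F (m : ℕ) : Lp ℝ 2 D →L[ℝ] Lp ℝ 2 D :=
    (ContinuousLinearMap.adjoint (J m)).comp ((B m).comp (J m))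
  have hBs : ∀ m v w, inner ℝ (B m v) w = inner ℝ v (B m w) := by
    intro m
    have hs := isSymm_cellMatrix (cellMass D (cellIndex m.succ_ne_zero))
      (B := cellKernel κ (m + 1)) (fun a b => κ.val_comm _ _)
    have hH : (cellMatrix (cellMass D (cellIndex m.succ_ne_zero))
        (cellKernel κ (m + 1))).IsHermitian := by
      rw [Matrix.IsHermitian, Matrix.conjTranspose_eq_transpose_of_trivial]; exact hs
    exact Matrix.isSymmetric_toEuclideanLin_iff.2 hH
  have hF : ∀ m f g, inner ℝ (F m f) g = inner ℝ (B m (J m f)) (J m g) := fun m f g => by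
    change inner ℝ (ContinuousLinearMap.adjoint (J m) (B m (J m f))) g = _
    rw [ContinuousLinearMap.adjoint_inner_left]
  have hsym : ∀ m, (F m - integralCLM κ D).IsSymmetric := by
    intro m f g
    change inner ℝ (F m f - κ.integralOperator D f) g = inner ℝ f (F m g - κ.integralOperator D g)
    rw [inner_sub_left, inner_sub_right, hF, hBs, isSymmetric_integralOperator κ D f g,
      real_inner_comm (F m g) f, hF, real_inner_comm]
  have hnorm : ∀ m : ℕ, ‖F m - integralCLM κ D‖ ≤ κ.lip * (2 / (m + 1 : ℕ)) := by
    intro m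
    have h0 := κ.lip_pos.le
    refine norm_le_of_abs_inner_le (hsym m) (by positivity) fun f => ?_
    have h := abs_inner_integralOperator_sub_le κ D (measurable_cellIndex m.succ_ne_zero)
      (abs_val_sub_cellKernel_le κ m.succ_ne_zero) f
    change |inner ℝ (F m f - κ.integralOperator D f) f| ≤ _
    rw [inner_sub_left, hF, abs_sub_comm]
    exact h
  have hlim : Tendsto F atTop (nhds (integralCLM κ D)) := by
    rw [tendsto_iff_norm_sub_tendsto_zero]
    refine squeeze_zero (fun m => norm_nonneg _) hnorm ?_
    have h1 : Tendsto (fun m : ℕ => (2 : ℝ) / (m + 1 : ℕ)) atTop (nhds 0) :=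
      (tendsto_const_nhds.div_atTop tendsto_natCast_atTop_atTop).comp (tendsto_add_atTop_nat 1)
    simpa using h1.const_mul κ.lip
  refine isCompactOperator_of_tendsto hlim (Eventually.of_forall fun m => ?_)
  exact (isCompactOperator_of_locallyCompactSpace_dom ((B m).comp (J m))).clm_comp
    (ContinuousLinearMap.adjoint (J m))

end IntegralOperator

end

end LatentGraph

namespace LatentGraph

noncomputable section

/-! ### Quadratic forms of compact symmetric operators. -/

section CompactSymmetric

open Module.End

variable {E : Type*} [NormedAddCommGroup E] [InnerProductSpace ℝ E] [CompleteSpace E]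

theorem inner_eq_zero_of_eigenspace {T : E →ₗ[ℝ] E} (hT : T.IsSymmetric) {μ ν : ℝ} (h : μ ≠ ν)
    {u v : E} (hu : T u = μ • u) (hv : T v = ν • v) : inner ℝ u v = 0 := by
  have h1 := hT u v
  rw [hu, hv, inner_smul_left, inner_smul_right, conj_trivial] at h1
  have : (μ - ν) * inner ℝ u v = 0 := by rw [sub_mul]; linarith
  exact (mul_eq_zero.1 this).resolve_left (sub_ne_zero.2 h)

/-- The quadratic form of a compact symmetric operator is bounded by its eigenvalues. -/
theorem inner_le_of_forall_eigenvalue_le {T : E →L[ℝ] E} (hT : IsCompactOperator T)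
    (hs : T.IsSymmetric) {s : ℝ} (h : ∀ μ, HasEigenvalue (T : Module.End ℝ E) μ → μ ≤ s) (v : E) :
    inner ℝ (T v) v ≤ s * ‖v‖ ^ 2 := by
  -- The spectral theorem: eigenvectors span a dense subspace. The bound is closed, so finite sums
  -- of orthogonal eigenvectors suffice.
  have hdense : (⨆ μ, eigenspace (T : Module.End ℝ E) μ).topologicalClosure = ⊤ := by
    rw [Submodule.topologicalClosure_eq_top_iff]
    exact ContinuousLinearMap.orthogonalComplement_iSup_eigenspaces_eq_bot hT hs
  have hclosed : IsClosed {v : E | inner ℝ (T v) v ≤ s * ‖v‖ ^ 2} :=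
    isClosed_le (T.continuous.inner continuous_id) (continuous_const.mul (continuous_norm.pow 2))
  have hsub : ((⨆ μ, eigenspace (T : Module.End ℝ E) μ : Submodule ℝ E) : Set E) ⊆
      {v : E | inner ℝ (T v) v ≤ s * ‖v‖ ^ 2} := by
    intro v hv
    obtain ⟨f, hf, rfl⟩ := (Submodule.mem_iSup_iff_exists_finsupp _ _).1 hv
    have hTf : ∀ μ, T (f μ) = μ • f μ := fun μ => mem_eigenspace_iff.1 (hf μ)
    have horth : ∀ μ ν, μ ≠ ν → inner ℝ (f μ) (f ν) = 0 := fun μ ν hne =>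
      inner_eq_zero_of_eigenspace hs hne (hTf μ) (hTf ν)
    have e1 : ∀ g : ℝ → ℝ, inner ℝ (∑ μ ∈ f.support, g μ • f μ) (∑ μ ∈ f.support, f μ) =
        ∑ μ ∈ f.support, g μ * ‖f μ‖ ^ 2 := by
      intro g
      rw [sum_inner]
      refine Finset.sum_congr rfl fun μ hμ => ?_
      rw [inner_sum, Finset.sum_eq_single μ]
      · rw [inner_smul_left, conj_trivial, real_inner_self_eq_norm_sq]
      · intro ν _ hne
        rw [inner_smul_left, horth μ ν hne.symm, mul_zero]
      · exact fun h => absurd hμ h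
    have e2 : ‖∑ μ ∈ f.support, f μ‖ ^ 2 = ∑ μ ∈ f.support, ‖f μ‖ ^ 2 := by
      have := e1 (fun _ => 1)
      simpa only [one_smul, one_mul, real_inner_self_eq_norm_sq] using this
    have e3 : T (∑ μ ∈ f.support, f μ) = ∑ μ ∈ f.support, μ • f μ := by
      rw [map_sum]; exact Finset.sum_congr rfl fun μ _ => hTf μ
    change inner ℝ (T (∑ μ ∈ f.support, f μ)) (∑ μ ∈ f.support, f μ) ≤
      s * ‖∑ μ ∈ f.support, f μ‖ ^ 2
    rw [e3, e1 (fun μ => μ), e2, Finset.mul_sum]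
    refine Finset.sum_le_sum fun μ hμ => mul_le_mul_of_nonneg_right (h μ ?_) (sq_nonneg _)
    exact hasEigenvalue_of_hasEigenvector ⟨hf μ, Finsupp.mem_support_iff.1 hμ⟩
  have hv : v ∈ closure ((⨆ μ, eigenspace (T : Module.End ℝ E) μ : Submodule ℝ E) : Set E) := by
    rw [← Submodule.topologicalClosure_coe, hdense]; trivial
  exact closure_minimal hsub hclosed hv

/-- The quadratic form of a compact symmetric operator on the orthogonal complement of the
eigenspaces of large eigenvalues. -/
theorem inner_le_of_orthogonal {T : E →L[ℝ] E} (hT : IsCompactOperator T) (hs : T.IsSymmetric)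
    {s : ℝ} {v : E}
    (h : ∀ μ, s < μ → ∀ u ∈ eigenspace (T : Module.End ℝ E) μ, inner ℝ u v = 0) :
    inner ℝ (T v) v ≤ s * ‖v‖ ^ 2 := by
  set V : Submodule ℝ E := ⨆ μ : Set.Ioi s, eigenspace (T : Module.End ℝ E) μ with hV
  have hinv : ∀ u ∈ V, T u ∈ V := by
    have : V ≤ V.comap (T : E →ₗ[ℝ] E) := by
      refine iSup_le fun μ u hu => ?_
      change T u ∈ V
      have : T u = (μ : ℝ) • u := mem_eigenspace_iff.1 hu
      rw [this]
      exact V.smul_mem _ (le_iSup (fun μ : Set.Ioi s => eigenspace (T : Module.End ℝ E) μ) μ hu)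
    exact this
  have hinv' : ∀ u ∈ Vᗮ, (T : E →ₗ[ℝ] E) u ∈ Vᗮ := by
    intro u hu w hw
    have := hs w u
    change inner ℝ w (T u) = 0
    change inner ℝ (T w) u = inner ℝ w (T u) at this
    rw [← this]
    exact hu _ (hinv w hw)
  have hvV : v ∈ Vᗮ := by
    have : V ≤ (Submodule.span ℝ {v})ᗮ := by
      refine iSup_le fun μ u hu => ?_
      rw [Submodule.mem_orthogonal_singleton_iff_inner_left]
      exact h μ μ.2 u hu
    intro w hw
    exact (Submodule.mem_orthogonal_singleton_iff_inner_left).1 (this hw)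
  -- An eigenvector of the restriction with eigenvalue above `s` would lie both in `V` and in its
  -- complement.
  let S : Vᗮ →L[ℝ] Vᗮ := T.restrict hinv'
  have hSc : IsCompactOperator S := hT.restrict' hinv'
  have hSs : S.IsSymmetric := hs.restrict_invariant hinv'
  have key := inner_le_of_forall_eigenvalue_le hSc hSs (s := s) ?_ ⟨v, hvV⟩
  · exact key
  · intro μ hμ
    by_contra hlt
    obtain ⟨u, hu⟩ := hμ.exists_hasEigenvector
    have hu1 : T (u : E) = μ • (u : E) := congrArg Subtype.val (mem_eigenspace_iff.1 hu.1)
    have hu2 : (u : E) ∈ V :=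
      le_iSup (fun μ : Set.Ioi s => eigenspace (T : Module.End ℝ E) μ) ⟨μ, not_le.1 hlt⟩
        (mem_eigenspace_iff.2 hu1)
    have hu3 : inner ℝ (u : E) (u : E) = 0 := u.2 _ hu2
    exact hu.2 (Subtype.ext (inner_self_eq_zero.1 hu3))

end CompactSymmetric

/-! ### Max-min characterization of an eigenvalue sequence. -/

section EigenvalueSequence

open Module.End

variable {E : Type} [NormedAddCommGroup E] [InnerProductSpace ℝ E] [CompleteSpace E]
  {T : E →L[ℝ] E} {lam : ℕ → ℝ}

/-- Orthonormal eigenvectors that realize an eigenvalue sequence. -/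
theorem IsEigenvalueSequence.exists_eigenvectors (h : IsEigenvalueSequence (T : Module.End ℝ E) lam)
    (hT : IsCompactOperator T) (hs : T.IsSymmetric) :
    ∃ e : ℕ → E, (∀ i, lam i ≠ 0 → T (e i) = lam i • e i) ∧
      (∀ i j, lam i ≠ 0 → lam j ≠ 0 → inner ℝ (e i) (e j) = if i = j then (1 : ℝ) else 0) ∧
      ∀ μ, μ ≠ 0 → ∀ u ∈ eigenspace (T : Module.End ℝ E) μ, ∀ v,
        (∀ i, lam i = μ → inner ℝ (e i) v = 0) → inner ℝ u v = 0 := by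
  have hb : ∀ μ : ℝ, ∃ g : {i // lam i = μ} → E, μ ≠ 0 →
      (∀ i, T (g i) = μ • g i) ∧ Orthonormal ℝ g ∧
      ∀ u ∈ eigenspace (T : Module.End ℝ E) μ, ∀ v, (∀ i, inner ℝ (g i) v = 0) →
        inner ℝ u v = 0 := by
    intro μ
    rcases eq_or_ne μ 0 with h0 | h0
    · exact ⟨fun _ => 0, fun h => absurd h0 h⟩
    have hfin : FiniteDimensional ℝ (eigenspace (T : Module.End ℝ E) μ) :=
      T.finite_dimensional_eigenspace hT μ h0
    have hcard := h.multiplicity μ h0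
    rw [← Module.finrank_eq_rank, ← Cardinal.mk_fin] at hcard
    -- Compactness makes the eigenspace finite dimensional, so the multiplicity condition matches
    -- the indices with value `μ` to an orthonormal basis.
    obtain ⟨q⟩ := Cardinal.eq.1 hcard
    set b := stdOrthonormalBasis ℝ (eigenspace (T : Module.End ℝ E) μ) with hbdef
    refine ⟨fun i => (b (q i) : E), fun _ => ⟨fun i => mem_eigenspace_iff.1 (b (q i)).2, ?_, ?_⟩⟩
    · exact (b.orthonormal.comp_linearIsometry
        (eigenspace (T : Module.End ℝ E) μ).subtypeₗᵢ).comp _ q.injective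
    · intro u hu v hv
      have hrep := b.sum_repr ⟨u, hu⟩
      have hrep' : u = ∑ j, b.repr ⟨u, hu⟩ j • (b j : E) := by
        have := congrArg Subtype.val hrep
        simpa using this.symm
      rw [hrep', sum_inner]
      refine Finset.sum_eq_zero fun j _ => ?_
      have := hv (q.symm j)
      simp only [Equiv.apply_symm_apply] at this
      rw [inner_smul_left, this, mul_zero]
  choose g hg using hb
  refine ⟨fun i => g (lam i) ⟨i, rfl⟩, fun i hi => (hg _ hi).1 _, fun i j hi hj => ?_,
    fun μ hμ u hu v hv => ?_⟩
  · rcases eq_or_ne (lam i) (lam j) with heq | hne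
    · have e : g (lam j) ⟨j, rfl⟩ = g (lam i) ⟨j, heq.symm⟩ := by
        have : ∀ (μ : ℝ) (hμ : lam j = μ), g (lam j) ⟨j, rfl⟩ = g μ ⟨j, hμ⟩ := by
          rintro μ rfl; rfl
        exact this _ _
      change inner ℝ (g (lam i) ⟨i, rfl⟩) (g (lam j) ⟨j, rfl⟩) = _
      rw [e, orthonormal_iff_ite.1 (hg _ hi).2.1]
      simp
    · rw [if_neg (fun h => hne (by rw [h]))]
      exact inner_eq_zero_of_eigenspace hs hne ((hg _ hi).1 _) ((hg _ hj).1 _)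
  · refine (hg μ hμ).2.2 u hu v fun i => ?_
    obtain ⟨i, rfl⟩ := i
    exact hv i rfl

theorem IsEigenvalueSequence.hasFormBound (h : IsEigenvalueSequence (T : Module.End ℝ E) lam)
    (hT : IsCompactOperator T) (hs : T.IsSymmetric) {k : ℕ} (hk : 0 < lam k) :
    HasFormBound (T : E →ₗ[ℝ] E) (lam k) (k + 1) := by
  obtain ⟨e, he1, he2, -⟩ := h.exists_eigenvectors hT hs
  have hpos : ∀ i : Fin (k + 1), lam k ≤ lam i := fun i => h.antitone (Nat.lt_succ_iff.1 i.2)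
  have hne : ∀ i : Fin (k + 1), lam i ≠ 0 := fun i => (hk.trans_le (hpos i)).ne'
  refine hasFormBound_of_orthonormal (u := fun i : Fin (k + 1) => e i)
    (a := fun i : Fin (k + 1) => lam i) ?_ (fun i => he1 i (hne i)) hpos
  rw [orthonormal_iff_ite]
  intro i j
  rw [he2 i j (hne i) (hne j)]
  simp [Fin.ext_iff]

theorem IsEigenvalueSequence.le_of_hasFormBound
    (h : IsEigenvalueSequence (T : Module.End ℝ E) lam) (hT : IsCompactOperator T)
    (hs : T.IsSymmetric) {k : ℕ} {θ : ℝ} (hk : HasFormBound (T : E →ₗ[ℝ] E) θ (k + 1)) :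
    θ ≤ lam k := by
  obtain ⟨e, -, -, he⟩ := h.exists_eigenvectors hT hs
  obtain ⟨ι, hι, hb⟩ := hk
  -- A vector orthogonal to `e 0, …, e (k - 1)` is orthogonal to every eigenspace above `lam k`,
  -- because monotonicity confines the indices of those eigenvalues to `i < k`.
  let g : (Fin (k + 1) → ℝ) →ₗ[ℝ] (Fin k → ℝ) := LinearMap.pi fun i => (innerₛₗ ℝ (e i)) ∘ₗ ι
  have hg : LinearMap.ker g ≠ ⊥ := LinearMap.ker_ne_bot_of_finrank_lt (by simp)
  obtain ⟨w, hw, hw0⟩ := (Submodule.ne_bot_iff _).1 hg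
  have hv : ι w ≠ 0 := by rwa [Ne, map_eq_zero_iff ι hι]
  have hle : inner ℝ (T (ι w)) (ι w) ≤ lam k * ‖ι w‖ ^ 2 := by
    refine inner_le_of_orthogonal hT hs fun μ hμ u hu => ?_
    refine he μ ((h.nonneg k).trans_lt hμ).ne' u hu (ι w) fun i hi => ?_
    have hik : i < k := by
      by_contra hcon
      have := h.antitone (not_lt.1 hcon)
      linarith
    have := congrFun (LinearMap.mem_ker.1 hw) ⟨i, hik⟩
    simpa [g] using this
  exact le_of_mul_le_mul_right ((hb w).trans hle) (by positivity)

/-- A negative eigenvalue is the value of no index, so the multiplicity condition makes its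
eigenspace trivial. -/
theorem IsEigenvalueSequence.inner_nonneg (h : IsEigenvalueSequence (T : Module.End ℝ E) lam)
    (hT : IsCompactOperator T) (hs : T.IsSymmetric) (v : E) : 0 ≤ inner ℝ (T v) v := by
  have hTn : IsCompactOperator (-T) := hT.neg
  have hsn : (-T).IsSymmetric := fun x y => by
    change inner ℝ (-T x) y = inner ℝ x (-T y)
    rw [inner_neg_left, inner_neg_right]
    exact congrArg _ (hs x y)
  have := inner_le_of_forall_eigenvalue_le hTn hsn (s := 0) (fun μ hμ => ?_) v
  · change inner ℝ (-T v) v ≤ _ at this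
    rw [inner_neg_left] at this
    linarith
  · by_contra hcon
    obtain ⟨u, hu⟩ := hμ.exists_hasEigenvector
    have hu1 : -T u = μ • u := mem_eigenspace_iff.1 hu.1
    have hu2 : u ∈ eigenspace (T : Module.End ℝ E) (-μ) := by
      rw [mem_eigenspace_iff]
      change T u = _
      rw [neg_smul, ← hu1, neg_neg]
    have hempty : IsEmpty {i // lam i = -μ} :=
      ⟨fun i => absurd (h.nonneg i) (by rw [i.2]; linarith)⟩
    have hrank := h.multiplicity (-μ) (by linarith)
    rw [Cardinal.mk_eq_zero] at hrank
    have hbot := Submodule.rank_eq_zero.1 hrank.symm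
    rw [hbot] at hu2
    exact hu.2 hu2

end EigenvalueSequence

end

end LatentGraph

namespace LatentGraph

noncomputable section

/-! ### Spectrum of the Gram matrix against the eigenvalue sequence. -/

section SpectrumComparison

variable {κ : SmallWorldKernel} {D : Measure I} [IsProbabilityMeasure D] {lam : ℕ → ℝ}

theorem isSymmetric_toEuclideanLin {n : ℕ} {M : Matrix (Fin n) (Fin n) ℝ} (hM : M.IsSymm) :
    (Matrix.toEuclideanLin M).IsSymmetric := by
  refine Matrix.isSymmetric_toEuclideanLin_iff.2 ?_
  rw [Matrix.IsHermitian, Matrix.conjTranspose_eq_transpose_of_trivial]; exact hM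

/-- If the empirical cell masses are close to the true ones, then `K / n` is almost positive and its
singular values are close to the eigenvalues of the integral operator. -/
theorem singularValues_scaledGram_close (hlam : IsEigenvalueSequence (κ.integralOperator D) lam)
    {n m : ℕ} (hn : n ≠ 0) (hm : m ≠ 0) (x : Fin n → I) {τ η : ℝ}
    (hτ : ∀ a, |cellMass D (cellIndex hm) a -
      cellMass (indexMeasure n) (cellIndex hm ∘ x) a| ≤ τ)
    (hη : η = 2 * (κ.lip * (2 / m)) + 2 * m * √τ) :
    (∀ v, -η * ‖v‖ ^ 2 ≤ inner ℝ (Matrix.toEuclideanLin (scaledGram κ x) v) v) ∧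
    ∀ k, |(Matrix.toEuclideanLin (scaledGram κ x)).singularValues k - lam k| ≤ η := by
  have hl := κ.lip_pos
  have hη0 : 0 ≤ η := by rw [hη]; positivity
  -- Used with `a = -1` for the lower bound of the form and with `a = 1` for the singular values.
  have cmp := fun {a θ : ℝ} (ha : |a| ≤ 1) (hθ : η < θ) (k : ℕ) =>
    hasFormBound_comparison κ D hn x (measurable_cellIndex hm) (by positivity)
      (abs_val_sub_cellKernel_le κ hm) (abs_cellKernel_le_one κ) hτ ha (hη ▸ hθ) k
  rw [← hη] at cmp
  have hC := isCompactOperator_integralCLM κ D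
  have hS : (integralCLM κ D).IsSymmetric := isSymmetric_integralOperator κ D
  have hlam' : IsEigenvalueSequence (integralCLM κ D : Module.End ℝ (Lp ℝ 2 D)) lam := hlam
  have hneg : ∀ v, -η * ‖v‖ ^ 2 ≤ inner ℝ (Matrix.toEuclideanLin (scaledGram κ x) v) v := by
    intro v
    by_contra hcon
    rw [not_le] at hcon
    have hv : v ≠ 0 := by rintro rfl; simp at hcon
    have hv2 : 0 < ‖v‖ ^ 2 := by positivity
    set θ := -inner ℝ (Matrix.toEuclideanLin (scaledGram κ x) v) v / ‖v‖ ^ 2 with hθ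
    have hθη : η < θ := by rw [hθ, lt_div_iff₀ hv2]; linarith
    have h1 : HasFormBound ((-1 : ℝ) • Matrix.toEuclideanLin (scaledGram κ x)) θ 1 := by
      refine hasFormBound_one hv (le_of_eq ?_)
      rw [hθ, div_mul_cancel₀ _ hv2.ne', LinearMap.smul_apply, inner_smul_left]
      simp
    have h2 := (cmp (a := -1) (by norm_num) hθη 1).2 h1
    refine not_hasFormBound_one (fun f => ?_) (sub_pos.2 hθη) h2
    have := hlam'.inner_nonneg hC hS f
    rw [LinearMap.smul_apply, inner_smul_left]
    simp only [conj_trivial, neg_mul, one_mul, Left.neg_nonpos_iff]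
    exact this
  refine ⟨hneg, fun k => ?_⟩
  rw [abs_sub_le_iff]
  constructor
  · by_contra hcon
    have hnn := hlam.nonneg k
    have hk : η < (Matrix.toEuclideanLin (scaledGram κ x)).singularValues k := by linarith
    have h1 := hasFormBound_singularValues
      (isSymmetric_toEuclideanLin ((isSymm_gramMatrix κ x).smul _)) hη0 hneg hk
    have h2 := (cmp (a := 1) (by norm_num) hk (k + 1)).2 (by rwa [one_smul])
    rw [one_smul] at h2
    have := hlam'.le_of_hasFormBound hC hS h2
    linarith
  · by_contra hcon
    have hnn := (Matrix.toEuclideanLin (scaledGram κ x)).singularValues_nonneg k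
    have hk : η < lam k := by linarith
    have h1 := hlam'.hasFormBound hC hS (hη0.trans_lt hk)
    have h2 := (cmp (a := 1) (by norm_num) hk (k + 1)).1 (by rw [one_smul]; exact h1)
    rw [one_smul] at h2
    have := h2.le_singularValues
    linarith

/-- The constant function `1` is a test vector, since the kernel is bounded below by `c₀ / (1 +
c₁)`. -/
theorem eigenvalue_zero_pos (hlam : IsEigenvalueSequence (κ.integralOperator D) lam) :
    0 < lam 0 := by
  have hC := isCompactOperator_integralCLM κ D
  have hS : (integralCLM κ D).IsSymmetric := isSymmetric_integralOperator κ D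
  have hlam' : IsEigenvalueSequence (integralCLM κ D : Module.End ℝ (Lp ℝ 2 D)) lam := hlam
  have hone : MemLp (fun _ : I => (1 : ℝ)) 2 D := memLp_const 1
  set f : Lp ℝ 2 D := hone.toLp with hf
  have hfa : (f : I → ℝ) =ᵐ[D] fun _ => 1 := MemLp.coeFn_toLp hone
  have hnorm : ‖f‖ ^ 2 = 1 := by
    rw [norm_sq_Lp]
    have : ∫ x, (f : I → ℝ) x ^ 2 ∂D = ∫ _x, (1 : ℝ) ∂D := by
      refine integral_congr_ae ?_
      filter_upwards [hfa] with x hx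
      rw [hx]; norm_num
    rw [this]; simp
  set δ := κ.c₀ / (1 + κ.c₁) with hδ
  have hc1 : 0 < κ.c₁ := κ.c₀_pos.trans_le κ.c₀_le_c₁
  have hδ0 : 0 < δ := div_pos κ.c₀_pos (by positivity)
  have hκ : ∀ x y, δ ≤ κ.val x y := fun x y => by
    refine div_le_div_of_nonneg_left κ.c₀_pos.le (κ.denom_pos x y) ?_
    have : |(x : ℝ) - y| ^ κ.Δ ≤ 1 := Real.rpow_le_one (abs_nonneg _)
      (abs_le.2 ⟨by linarith [x.2.1, y.2.2], by linarith [x.2.2, y.2.1]⟩)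
      (zero_le_one.trans κ.one_lt_Δ.le)
    linarith
  have hint : ∀ x, δ ≤ ∫ y, κ.val x y * f y ∂D := fun x => by
    have e : ∫ y, κ.val x y * f y ∂D = ∫ y, κ.val x y ∂D := by
      refine integral_congr_ae ?_
      filter_upwards [hfa] with y hy
      rw [hy, mul_one]
    have hi : Integrable (fun y => κ.val x y) D := by
      refine (κ.integrable_val_mul D f x).congr ?_
      filter_upwards [hfa] with y hy
      rw [hy, mul_one]
    have := integral_mono (integrable_const δ) hi (fun y => hκ x y)
    rw [e]
    simpa using this
  have hform : δ * ‖f‖ ^ 2 ≤ inner ℝ (κ.integralOperator D f) f := by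
    rw [hnorm, mul_one, inner_integralOperator]
    have hi := (κ.memLp_integral D f).integrable one_le_two
    have e : ∫ x, (∫ y, κ.val x y * f y ∂D) * f x ∂D = ∫ x, ∫ y, κ.val x y * f y ∂D ∂D := by
      refine integral_congr_ae ?_
      filter_upwards [hfa] with x hx
      rw [hx, mul_one]
    rw [e]
    have := integral_mono (integrable_const δ) hi hint
    simpa using this
  have hf0 : f ≠ 0 := by
    intro h
    rw [h] at hnorm
    simp at hnorm
  exact hδ0.trans_le (hlam'.le_of_hasFormBound hC hS (hasFormBound_one hf0 hform))

/-- A larger `lam k` would survive the discretization into `m` cells and give `k + 1 > m`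
independent vectors in `ℝᵐ`. -/
theorem eigenvalue_le_of_le (hlam : IsEigenvalueSequence (κ.integralOperator D) lam) {m k : ℕ}
    (hm : m ≠ 0) (hk : m ≤ k) : lam k ≤ κ.lip * (2 / m) := by
  have hC := isCompactOperator_integralCLM κ D
  have hS : (integralCLM κ D).IsSymmetric := isSymmetric_integralOperator κ D
  have hlam' : IsEigenvalueSequence (integralCLM κ D : Module.End ℝ (Lp ℝ 2 D)) lam := hlam
  by_contra hcon
  have hl := κ.lip_pos
  have h0 : 0 ≤ κ.lip * (2 / m) := by positivity
  have h1 : HasFormBound ((1 : ℝ) • κ.integralOperator D) (lam k) (k + 1) := by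
    rw [one_smul]; exact hlam'.hasFormBound hC hS (h0.trans_lt (not_le.1 hcon))
  have h2 := h1.transport_smul (averageMap D (cellIndex hm)) (by norm_num) (not_le.1 hcon)
    (norm_averageMap_le D (measurable_cellIndex hm))
    (abs_inner_integralOperator_sub_le κ D (measurable_cellIndex hm)
      (abs_val_sub_cellKernel_le κ hm))
  have h3 := h2.le_finrank
  simp at h3
  omega

theorem exists_eigengap_pos (hlam : IsEigenvalueSequence (κ.integralOperator D) lam) :
    ∃ k, 1 ≤ k ∧ 0 < eigengap lam k := by
  by_contra hcon
  push Not at hcon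
  have hconst : ∀ k, lam 0 ≤ lam k := by
    intro k
    induction k with
    | zero => exact le_rfl
    | succ k ih =>
      have := hcon (k + 1) (by omega)
      rw [eigengap, Nat.add_sub_cancel] at this
      linarith
  have h0 := eigenvalue_zero_pos hlam
  have hl := κ.lip_pos
  obtain ⟨m, hm⟩ := exists_nat_gt (κ.lip * 2 / lam 0)
  have hm0 : (0 : ℝ) < m := lt_trans (by positivity) hm
  have hm1 : m ≠ 0 := by rintro rfl; simp at hm0
  have h1 := (hconst m).trans (eigenvalue_le_of_le hlam hm1 le_rfl)
  rw [div_lt_iff₀ h0] at hm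
  rw [← mul_div_assoc, le_div_iff₀ hm0] at h1
  linarith

end SpectrumComparison

end

end LatentGraph

namespace LatentGraph

noncomputable section

/-! ### Hoeffding bounds for the empirical cell masses. -/

section CellConcentration

variable {D : Measure I} [IsProbabilityMeasure D] {n m : ℕ}

/-- Hoeffding's inequality for a sample from `D`. -/
theorem pi_sum_sub_integral_ge_le (hn : n ≠ 0) {g : I → ℝ} (hg : Measurable g)
    (hg0 : ∀ x, 0 ≤ g x) (hg1 : ∀ x, g x ≤ 1) {τ : ℝ} (hτ : 0 ≤ τ) :
    Measure.pi (fun _ : Fin n => D) {x | n * τ ≤ ∑ i, (g (x i) - ∫ y, g y ∂D)} ≤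
      ENNReal.ofReal (Real.exp (-(2 * n * τ ^ 2))) := by
  have hn' : (0 : ℝ) < n := by positivity
  set P := Measure.pi (fun _ : Fin n => D) with hP
  have hind : iIndepFun (fun (i : Fin n) (x : Fin n → I) => g (x i) - ∫ y, g y ∂D) P :=
    iIndepFun_pi (X := fun _ y => g y - ∫ y, g y ∂D)
      (fun i => (hg.sub_const _).aemeasurable)
  have hmean : ∀ i : Fin n, ∫ x : Fin n → I, g (x i) ∂P = ∫ y, g y ∂D := fun i =>
    integral_comp_eval (μ := fun _ : Fin n => D) (i := i) hg.aestronglyMeasurable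
  have hsub : ∀ i ∈ (Finset.univ : Finset (Fin n)),
      HasSubgaussianMGF (fun x : Fin n → I => g (x i) - ∫ y, g y ∂D) ((‖(1 : ℝ) - 0‖₊ / 2) ^ 2) P := by
    intro i _
    rw [← hmean i]
    exact hasSubgaussianMGF_of_mem_Icc (hg.comp (measurable_pi_apply i)).aemeasurable
      (Eventually.of_forall fun x => ⟨hg0 _, hg1 _⟩)
  have h := HasSubgaussianMGF.measure_sum_ge_le_of_iIndepFun hind hsub
    (ε := n * τ) (by positivity)
  have e : -(n * τ) ^ 2 / (2 * ((∑ _i : Fin n, (‖(1 : ℝ) - 0‖₊ / 2) ^ 2 : NNReal) : ℝ)) =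
      -(2 * n * τ ^ 2) := by
    simp only [sub_zero, nnnorm_one, Finset.sum_const, Finset.card_univ, Fintype.card_fin,
      nsmul_eq_mul]
    push_cast
    field_simp
  rw [← ofReal_measureReal]
  refine ENNReal.ofReal_le_ofReal (h.trans (le_of_eq ?_))
  rw [← e]

/-- The event that some empirical cell mass deviates by more than `τ`. -/
def cellDeviation (D : Measure I) (n : ℕ) (hm : m ≠ 0) (τ : ℝ) : Set (Fin n → I) :=
  {x | ∃ a, τ < |cellMass D (cellIndex hm) a -
    cellMass (indexMeasure n) (cellIndex hm ∘ x) a|}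

theorem cellMass_indexMeasure (c : Fin n → Fin m) (a : Fin m) :
    cellMass (indexMeasure n) c a = (n : ℝ)⁻¹ * ∑ i, ({a} : Set (Fin m)).indicator 1 (c i) := by
  rw [cellMass, ← integral_indicator_one (measurable_of_countable c (measurableSet_singleton a)),
    integral_indexMeasure]
  rfl

theorem measurableSet_cellDeviation (hm : m ≠ 0) (τ : ℝ) :
    MeasurableSet (cellDeviation D n hm τ) := by
  have : cellDeviation D n hm τ = ⋃ a, {x | τ < |cellMass D (cellIndex hm) a -
      cellMass (indexMeasure n) (cellIndex hm ∘ x) a|} := by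
    ext x; simp [cellDeviation]
  rw [this]
  refine MeasurableSet.iUnion fun a => measurableSet_lt measurable_const ?_
  simp only [cellMass_indexMeasure]
  have h : ∀ i : Fin n, Measurable fun x : Fin n → I =>
      ({a} : Set (Fin m)).indicator (1 : Fin m → ℝ) ((cellIndex hm ∘ x) i) := fun i =>
    (measurable_of_countable (({a} : Set (Fin m)).indicator (1 : Fin m → ℝ))).comp
      ((measurable_cellIndex hm).comp (measurable_pi_apply i))
  exact ((((Finset.univ.measurable_fun_sum fun i _ => h i).const_mul _).const_sub _)).abs

theorem pi_cellDeviation_le (hn : n ≠ 0) (hm : m ≠ 0) {τ : ℝ} (hτ : 0 ≤ τ) :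
    Measure.pi (fun _ : Fin n => D) (cellDeviation D n hm τ) ≤
      ENNReal.ofReal (2 * m * Real.exp (-(2 * n * τ ^ 2))) := by
  have hn' : (0 : ℝ) < n := by positivity
  set P := Measure.pi (fun _ : Fin n => D) with hP
  set r := Real.exp (-(2 * n * τ ^ 2)) with hr
  let g (a : Fin m) (x : I) : ℝ := ({a} : Set (Fin m)).indicator 1 (cellIndex hm x)
  have hg : ∀ a, Measurable (g a) := fun a =>
    (measurable_of_countable (({a} : Set (Fin m)).indicator (1 : Fin m → ℝ))).comp
      (measurable_cellIndex hm)
  have hg0 : ∀ a x, 0 ≤ g a x := fun a x => Set.indicator_nonneg (fun _ _ => zero_le_one) _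
  have hg1 : ∀ a x, g a x ≤ 1 := fun a x =>
    Set.indicator_le_self' (f := (1 : Fin m → ℝ)) (fun _ _ => zero_le_one) _
  have hgint : ∀ a, Integrable (g a) D := fun a =>
    Integrable.of_mem_Icc 0 1 (hg a).aemeasurable (Eventually.of_forall fun x => ⟨hg0 a x, hg1 a x⟩)
  have hmass : ∀ a, ∫ y, g a y ∂D = cellMass D (cellIndex hm) a := fun a => by
    rw [cellMass, ← integral_indicator_one
      (measurable_cellIndex hm (measurableSet_singleton a))]
    rfl
  -- The lower tail for `g a` is the upper tail for `1 - g a`, so the one-sided bound is enough.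
  have hsub : cellDeviation D n hm τ ⊆ ⋃ a,
      ({x | n * τ ≤ ∑ i, (g a (x i) - ∫ y, g a y ∂D)} ∪
        {x | n * τ ≤ ∑ i, ((1 - g a (x i)) - ∫ y, (1 - g a y) ∂D)}) := by
    rintro x ⟨a, ha⟩
    refine Set.mem_iUnion.2 ⟨a, ?_⟩
    have e1 : ∑ i, (g a (x i) - ∫ y, g a y ∂D) = n * (cellMass (indexMeasure n)
        (cellIndex hm ∘ x) a - cellMass D (cellIndex hm) a) := by
      rw [Finset.sum_sub_distrib, hmass, cellMass_indexMeasure, mul_sub, mul_inv_cancel_left₀ hn'.ne']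
      simp [g]
    have e2 : ∑ i, ((1 - g a (x i)) - ∫ y, (1 - g a y) ∂D) =
        -∑ i, (g a (x i) - ∫ y, g a y ∂D) := by
      rw [integral_sub (integrable_const _) (hgint a), ← Finset.sum_neg_distrib]
      refine Finset.sum_congr rfl fun i _ => ?_
      simp
    rcases lt_abs.1 ha with h | h
    · right
      change n * τ ≤ _
      rw [e2, e1, ← mul_neg]
      exact mul_le_mul_of_nonneg_left (by linarith) hn'.le
    · left
      change n * τ ≤ _
      rw [e1]
      exact mul_le_mul_of_nonneg_left (by linarith) hn'.le
  refine (measure_mono hsub).trans ((measure_iUnion_le _).trans ?_)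
  rw [tsum_fintype]
  calc ∑ a, P ({x | n * τ ≤ ∑ i, (g a (x i) - ∫ y, g a y ∂D)} ∪
        {x | n * τ ≤ ∑ i, ((1 - g a (x i)) - ∫ y, (1 - g a y) ∂D)})
      ≤ ∑ _a : Fin m, (ENNReal.ofReal r + ENNReal.ofReal r) := by
        refine Finset.sum_le_sum fun a _ => (measure_union_le _ _).trans (add_le_add ?_ ?_)
        · exact pi_sum_sub_integral_ge_le hn (hg a) (hg0 a) (hg1 a) hτ
        · exact pi_sum_sub_integral_ge_le (g := fun x => 1 - g a x) hn (measurable_const.sub (hg a))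
            (fun x => sub_nonneg.2 (hg1 a x)) (fun x => by linarith [hg0 a x]) hτ
    _ = ENNReal.ofReal (2 * m * r) := by
        rw [← ENNReal.ofReal_add (Real.exp_pos _).le (Real.exp_pos _).le, Finset.sum_const,
          Finset.card_univ, Fintype.card_fin, nsmul_eq_mul, ← ENNReal.ofReal_natCast,
          ← ENNReal.ofReal_mul (by positivity)]
        congr 1
        ring

end CellConcentration

end

end LatentGraph

namespace LatentGraph

noncomputable section

/-! ### The polar factor of an almost orthogonal matrix. -/

section Polar

theorem sum_sq_eq_trace {m n : ℕ} (M : Matrix (Fin m) (Fin n) ℝ) :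
    ∑ i, ∑ j, M i j ^ 2 = (Mᵀ * M).trace := by
  simp only [Matrix.trace, Matrix.diag, Matrix.mul_apply, Matrix.transpose_apply]
  rw [Finset.sum_comm]
  exact Finset.sum_congr rfl fun i _ => Finset.sum_congr rfl fun j _ => by ring

/-- A matrix that is almost orthogonal is close to an orthogonal matrix. -/
theorem exists_orthogonal_close {d : ℕ} {G : Matrix (Fin d) (Fin d) ℝ} {q : ℝ}
    (hq : ∑ i, ∑ j, (Gᵀ * G - 1) i j ^ 2 ≤ q) (hq1 : q < 1) :
    ∃ W ∈ Matrix.orthogonalGroup (Fin d) ℝ, ∑ i, ∑ j, (W - G) i j ^ 2 ≤ q := by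
  have hsymm : (Gᵀ * G).IsSymm := by simp [Matrix.IsSymm, Matrix.transpose_mul]
  obtain ⟨R, D, hR1, hR2, hRD⟩ := exists_orthogonal_diagonalization hsymm
  have hGG : Gᵀ * G = R * Matrix.diagonal D * Rᵀ := by simpa using hRD 1
  have conj_sq : ∀ g : Fin d → ℝ, ∑ i, ∑ j, (R * Matrix.diagonal g * Rᵀ) i j ^ 2 =
      ∑ j, g j ^ 2 := by
    intro g
    rw [sum_sq_eq_trace]
    have : (R * Matrix.diagonal g * Rᵀ)ᵀ * (R * Matrix.diagonal g * Rᵀ) =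
        R * (Matrix.diagonal g * (Rᵀ * R) * Matrix.diagonal g * Rᵀ) := by
      simp only [Matrix.transpose_mul, Matrix.transpose_transpose, Matrix.diagonal_transpose,
        Matrix.mul_assoc]
    rw [this, hR1, mul_one, Matrix.diagonal_mul_diagonal, Matrix.trace_mul_comm, Matrix.mul_assoc,
      hR1, mul_one, Matrix.trace_diagonal]
    exact Finset.sum_congr rfl fun j _ => by ring
  have conj_one : ∀ g : Fin d → ℝ, R * Matrix.diagonal g * Rᵀ - 1 =
      R * Matrix.diagonal (fun j => g j - 1) * Rᵀ := by
    intro g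
    have : Matrix.diagonal (fun j => g j - 1) = Matrix.diagonal g - (1 : Matrix _ _ ℝ) := by
      rw [← Matrix.diagonal_one, Matrix.diagonal_sub]
    rw [this, Matrix.mul_sub, Matrix.sub_mul, mul_one, hR2]
  have conj_mul : ∀ g g' : Fin d → ℝ, (R * Matrix.diagonal g * Rᵀ) * (R * Matrix.diagonal g' * Rᵀ) =
      R * Matrix.diagonal (fun j => g j * g' j) * Rᵀ := by
    intro g g'
    calc (R * Matrix.diagonal g * Rᵀ) * (R * Matrix.diagonal g' * Rᵀ)
        = R * (Matrix.diagonal g * (Rᵀ * R) * Matrix.diagonal g') * Rᵀ := by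
          simp only [Matrix.mul_assoc]
      _ = _ := by rw [hR1, mul_one, Matrix.diagonal_mul_diagonal]
  have conj_one' : R * Matrix.diagonal (fun _ => (1 : ℝ)) * Rᵀ = 1 := by
    rw [Matrix.diagonal_one, mul_one, hR2]
  have hD : ∑ j, (D j - 1) ^ 2 ≤ q := by
    rw [← conj_sq, ← conj_one, ← hGG]; exact hq
  have hDpos : ∀ j, 0 < D j := by
    intro j
    have h1 : (D j - 1) ^ 2 ≤ q := (Finset.single_le_sum (f := fun j => (D j - 1) ^ 2)
      (fun i _ => sq_nonneg _) (Finset.mem_univ j)).trans hD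
    by_contra hcon
    nlinarith
  -- `S` is the square root of `Gᵀ * G`, `T` is its inverse, and `G * T` is the polar factor. The
  -- final estimate is `|√D - 1| ≤ |D - 1|` on the eigenvalues.
  set S := R * Matrix.diagonal (fun j => √(D j)) * Rᵀ with hS
  set T := R * Matrix.diagonal (fun j => (√(D j))⁻¹) * Rᵀ with hT
  have hTt : Tᵀ = T := by
    rw [hT]; simp only [Matrix.transpose_mul, Matrix.transpose_transpose,
      Matrix.diagonal_transpose, Matrix.mul_assoc]
  have hsq : ∀ j, √(D j) ≠ 0 := fun j => (Real.sqrt_pos.2 (hDpos j)).ne'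
  have hTS : T * S = 1 := by
    rw [hT, hS, conj_mul, ← conj_one']
    simp only [inv_mul_cancel₀ (hsq _)]
  have hW : (G * T)ᵀ * (G * T) = 1 := by
    have : (G * T)ᵀ * (G * T) = T * (Gᵀ * G) * T := by
      rw [Matrix.transpose_mul, hTt]; simp only [Matrix.mul_assoc]
    rw [this, hGG, hT, conj_mul, conj_mul, ← conj_one']
    congr 3
    funext j
    have h1 := Real.mul_self_sqrt (hDpos j).le
    nth_rewrite 2 [← h1]
    field_simp [hsq j]
  refine ⟨G * T, (Matrix.mem_orthogonalGroup_iff' (Fin d) ℝ).2 hW, ?_⟩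
  · have e1 : G * T - G = -((G * T) * (S - 1)) := by
      rw [Matrix.mul_sub, mul_one, Matrix.mul_assoc, hTS, mul_one]; abel
    have e2 : ∑ i, ∑ j, (G * T - G) i j ^ 2 = ∑ i, ∑ j, (S - 1) i j ^ 2 := by
      rw [sum_sq_eq_trace, sum_sq_eq_trace, e1, Matrix.transpose_neg, Matrix.neg_mul,
        Matrix.mul_neg, neg_neg, Matrix.transpose_mul, Matrix.mul_assoc,
        ← Matrix.mul_assoc (G * T)ᵀ, hW, one_mul]
    rw [e2, hS, conj_one, conj_sq]
    refine le_trans (Finset.sum_le_sum fun j _ => ?_) hD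
    have h1 := Real.mul_self_sqrt (hDpos j).le
    have h2 := Real.sqrt_nonneg (D j)
    have e3 : D j - 1 = (√(D j) - 1) * (√(D j) + 1) := by
      nth_rewrite 1 [← h1]; ring
    rw [e3, mul_pow]
    refine le_mul_of_one_le_right (sq_nonneg _) ?_
    nlinarith

end Polar

/-! ### Perturbation of eigenspaces and of square roots. -/

section SubspacePerturbation

variable {E : Type*} [NormedAddCommGroup E] [InnerProductSpace ℝ E] {d : ℕ}

theorem norm_sq_sum_smul {u : Fin d → E} (hu : Orthonormal ℝ u) (a : Fin d → ℝ) :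
    ‖∑ i, a i • u i‖ ^ 2 = ∑ i, a i ^ 2 := by
  rw [← real_inner_self_eq_norm_sq]
  have := hu.inner_sum a a Finset.univ
  simp only [conj_trivial] at this
  rw [this]
  exact Finset.sum_congr rfl fun i _ => by ring

theorem inner_sum_smul {u : Fin d → E} (hu : Orthonormal ℝ u) (a : Fin d → ℝ) (i : Fin d) :
    inner ℝ (u i) (∑ j, a j • u j) = a i :=
  hu.inner_right_fintype a i

theorem sum_inner_sq_le {u : Fin d → E} (hu : Orthonormal ℝ u) (w : E) :
    ∑ i, inner ℝ (u i) w ^ 2 ≤ ‖w‖ ^ 2 := by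
  have := hu.sum_inner_products_le w (s := Finset.univ)
  simpa using this

/-- The component of an approximate eigenvector orthogonal to an invariant subspace is small. -/
theorem gap_mul_norm_sub_proj_le {P : E →ₗ[ℝ] E} {u : Fin d → E}
    (hu : Orthonormal ℝ u) {s : Fin d → ℝ} (hPu : ∀ i, P (u i) = s i • u i) {s' : ℝ}
    (hoff : ∀ y, (∀ i, inner ℝ (u i) y = 0) → ‖P y‖ ≤ s' * ‖y‖) {v : E} {l ε : ℝ}
    (hv : ‖P v - l • v‖ ≤ ε) (hgap : s' < l) :
    ‖v - ∑ i, inner ℝ (u i) v • u i‖ ≤ ε / (l - s') := by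
  set y := v - ∑ i, inner ℝ (u i) v • u i with hy
  have hyu : ∀ i, inner ℝ (u i) y = 0 := fun i => by
    rw [hy, inner_sub_right, inner_sum_smul hu, sub_self]
  have h1 : P y - l • y = (P v - l • v) - ∑ i, ((s i - l) * inner ℝ (u i) v) • u i := by
    have e : P (∑ i, inner ℝ (u i) v • u i) = ∑ i, (s i * inner ℝ (u i) v) • u i := by
      rw [map_sum]
      exact Finset.sum_congr rfl fun i _ => by rw [map_smul, hPu, smul_smul, mul_comm]
    rw [hy, map_sub, e, smul_sub, Finset.smul_sum]
    simp only [sub_mul, sub_smul, Finset.sum_sub_distrib, smul_smul]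
    abel
  -- Replacing `v` by `y` changes the residual only inside the span of the `u i`, to which `y` is
  -- orthogonal.
  have h2 : inner ℝ (P y) y - l * ‖y‖ ^ 2 = inner ℝ (P v - l • v) y := by
    have : inner ℝ (P y - l • y) y = inner ℝ (P y) y - l * ‖y‖ ^ 2 := by
      rw [inner_sub_left, inner_smul_left, real_inner_self_eq_norm_sq, conj_trivial]
    rw [← this, h1, inner_sub_left, sum_inner, sub_eq_self]
    exact Finset.sum_eq_zero fun i _ => by rw [inner_smul_left, hyu, mul_zero]
  have h3 : inner ℝ (P y) y ≤ s' * ‖y‖ ^ 2 := by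
    refine (real_inner_le_norm _ _).trans ?_
    rw [sq, ← mul_assoc]
    exact mul_le_mul_of_nonneg_right (hoff y hyu) (norm_nonneg _)
  have h4 : -(ε * ‖y‖) ≤ inner ℝ (P v - l • v) y := by
    have := neg_le_of_abs_le (abs_real_inner_le_norm (P v - l • v) y)
    have h5 := mul_le_mul_of_nonneg_right hv (norm_nonneg y)
    linarith
  rcases (norm_nonneg y).eq_or_lt with h0 | h0
  · rw [← h0]
    exact div_nonneg ((norm_nonneg _).trans hv) (sub_pos.2 hgap).le
  · rw [le_div_iff₀ (sub_pos.2 hgap)]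
    have : (‖y‖ * (l - s')) * ‖y‖ ≤ ε * ‖y‖ := by nlinarith
    exact le_of_mul_le_mul_right this h0

/-- Perturbation of the square root of a positive operator, tested on an eigenvector. -/
theorem sqrt_mul_norm_sqrt_sub_le {P : E →ₗ[ℝ] E} (hP : P.IsSymmetric) {u : Fin d → E}
    (hu : Orthonormal ℝ u) {s : Fin d → ℝ} (hs : ∀ i, 0 ≤ s i) (hPu : ∀ i, P (u i) = s i • u i)
    {v : E} {l ε r : ℝ} (hl : 0 ≤ l) (hv : ‖P v - l • v‖ ≤ ε)
    (hy : ‖v - ∑ i, inner ℝ (u i) v • u i‖ ≤ r) :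
    √l * ‖∑ i, (√(s i) * inner ℝ (u i) v) • u i - √l • v‖ ≤ ε + l * r := by
  set x := ∑ i, (√(s i) * inner ℝ (u i) v) • u i - √l • v with hx
  set z := ∑ i, (s i * inner ℝ (u i) v) • u i - l • v with hz
  have hzn : ‖z‖ ≤ ε + l * r := by
    have e : z = ∑ i, inner ℝ (u i) (P v - l • v) • u i -
        l • (v - ∑ i, inner ℝ (u i) v • u i) := by
      have e1 : ∀ i, inner ℝ (u i) (P v - l • v) =
          s i * inner ℝ (u i) v - l * inner ℝ (u i) v := fun i => by
        rw [inner_sub_right, ← hP (u i) v, hPu, inner_smul_left, inner_smul_right, conj_trivial]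
      simp only [e1, sub_smul, Finset.sum_sub_distrib, smul_sub, Finset.smul_sum, smul_smul, hz]
      abel
    rw [e]
    refine (norm_sub_le _ _).trans (add_le_add ?_ ?_)
    · refine le_trans (le_of_sq_le_sq ?_ (norm_nonneg _)) hv
      rw [norm_sq_sum_smul hu]
      exact sum_inner_sq_le hu _
    · rw [norm_smul, Real.norm_of_nonneg hl]
      exact mul_le_mul_of_nonneg_left hy hl
  have hux : ∀ i, inner ℝ (u i) x = √(s i) * inner ℝ (u i) v - √l * inner ℝ (u i) v := fun i => by
    rw [hx, inner_sub_right, inner_sum_smul hu, inner_smul_right]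
  -- With `R` the root of `P` on the span of the `u i`, this is `(R + √l)(R - √l) v = (R² - l) v`.
  -- Positivity of `R` then gives `√l ‖x‖ ≤ ‖z‖` without any gap condition.
  have hRx : ∑ i, (√(s i) * inner ℝ (u i) x) • u i + √l • x = z := by
    have e1 : ∀ i, √(s i) * inner ℝ (u i) x =
        s i * inner ℝ (u i) v - √l * (√(s i) * inner ℝ (u i) v) := fun i => by
      rw [hux, mul_sub, ← mul_assoc, Real.mul_self_sqrt (hs i)]; ring
    simp only [e1]
    simp only [sub_smul, Finset.sum_sub_distrib, hx, hz, smul_sub, Finset.smul_sum, smul_smul,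
      Real.mul_self_sqrt hl]
    abel
  have hpos : 0 ≤ inner ℝ (∑ i, (√(s i) * inner ℝ (u i) x) • u i) x := by
    rw [sum_inner]
    refine Finset.sum_nonneg fun i _ => ?_
    rw [inner_smul_left, conj_trivial, mul_assoc]
    exact mul_nonneg (Real.sqrt_nonneg _) (mul_self_nonneg _)
  have hkey : √l * ‖x‖ ^ 2 ≤ ‖z‖ * ‖x‖ := by
    have h1 := real_inner_le_norm z x
    rw [← hRx, inner_add_left, inner_smul_left, conj_trivial, real_inner_self_eq_norm_sq, hRx] at h1
    linarith
  rcases (norm_nonneg x).eq_or_lt with h0 | h0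
  · rw [← h0, mul_zero]; exact (norm_nonneg z).trans hzn
  · refine le_trans ?_ hzn
    have : (√l * ‖x‖) * ‖x‖ ≤ ‖z‖ * ‖x‖ := by rw [mul_assoc, ← sq]; exact hkey
    exact le_of_mul_le_mul_right this h0

/-- Alignment of two spectral embeddings. -/
theorem exists_orthogonal_alignment {P Q : E →ₗ[ℝ] E} (hP : P.IsSymmetric) {u v : Fin d → E}
    (hu : Orthonormal ℝ u) (hv : Orthonormal ℝ v) {s l : Fin d → ℝ}
    (hPu : ∀ i, P (u i) = s i • u i) (hQv : ∀ i, Q (v i) = l i • v i) {ε g s' b : ℝ}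
    (hg : 0 < g) (hPQ : ∀ w, ‖P w - Q w‖ ≤ ε * ‖w‖)
    (hoff : ∀ y, (∀ i, inner ℝ (u i) y = 0) → ‖P y‖ ≤ s' * ‖y‖) (hs' : 0 ≤ s')
    (hgap : ∀ j, s' + g ≤ l j) (hs0 : ∀ i, 0 ≤ s i) (hsb : ∀ i, s i ≤ b) (hlb : ∀ j, l j ≤ b)
    (hε : 0 ≤ ε) (hsmall : d * (ε / g) ^ 2 < 1) :
    ∃ W ∈ Matrix.orthogonalGroup (Fin d) ℝ,
      ∑ j, ‖∑ i, (√(s i) * W i j) • u i - √(l j) • v j‖ ^ 2 ≤ 10 * b * (d * (ε / g) ^ 2) := by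
  rcases Nat.eq_zero_or_pos d with rfl | hd
  · exact ⟨1, one_mem _, by simp⟩
  have hb : 0 < b := by
    have := hgap ⟨0, hd⟩
    have := hlb ⟨0, hd⟩
    linarith
  have hw : ∀ j, ‖P (v j) - l j • v j‖ ≤ ε := fun j => by
    have := hPQ (v j)
    rwa [hQv, hv.1 j, mul_one] at this
  have hy : ∀ j, ‖v j - ∑ i, inner ℝ (u i) (v j) • u i‖ ≤ ε / g := fun j => by
    refine (gap_mul_norm_sub_proj_le hu hPu hoff (hw j) (by linarith [hgap j])).trans ?_
    exact div_le_div_of_nonneg_left hε hg (by linarith [hgap j])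
  set G : Matrix (Fin d) (Fin d) ℝ := Matrix.of fun i j => inner ℝ (u i) (v j) with hG
  have hGG : ∑ i, ∑ j, (Gᵀ * G - 1) i j ^ 2 ≤ d * (ε / g) ^ 2 := by
    have e : ∀ i j, (Gᵀ * G - 1) i j =
        -inner ℝ (v i) (v j - ∑ k, inner ℝ (u k) (v j) • u k) := by
      intro i j
      have e1 : inner ℝ (v i) (v j) = (1 : Matrix (Fin d) (Fin d) ℝ) i j := by
        rw [orthonormal_iff_ite.1 hv, Matrix.one_apply]
      rw [inner_sub_right, inner_sum, e1, Matrix.sub_apply, Matrix.mul_apply, neg_sub]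
      congr 1
      refine Finset.sum_congr rfl fun k _ => ?_
      rw [inner_smul_right, real_inner_comm (u k) (v i), hG]
      simp only [Matrix.transpose_apply, Matrix.of_apply]
      ring
    rw [Finset.sum_comm]
    calc ∑ j, ∑ i, (Gᵀ * G - 1) i j ^ 2 ≤ ∑ _j : Fin d, (ε / g) ^ 2 := by
          refine Finset.sum_le_sum fun j _ => ?_
          simp only [e, neg_sq]
          exact (sum_inner_sq_le hv _).trans (pow_le_pow_left₀ (norm_nonneg _) (hy j) 2)
      _ = _ := by simp
  obtain ⟨W, hW, hWG⟩ := exists_orthogonal_close hGG hsmall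
  refine ⟨W, hW, ?_⟩
  -- As `g ≤ l j`, the error `ε + l j * (ε / g)` is at most `2 * l j * (ε / g)`; dividing by `√(l
  -- j)` leaves at most `2 * √b * (ε / g)`.
  have hx : ∀ j, ‖∑ i, (√(s i) * inner ℝ (u i) (v j)) • u i - √(l j) • v j‖ ≤
      2 * √b * (ε / g) := by
    intro j
    have hgl : g ≤ l j := by linarith [hgap j]
    have hl0 : 0 < l j := hg.trans_le hgl
    have h := sqrt_mul_norm_sqrt_sub_le hP hu hs0 hPu hl0.le (hw j) (hy j)
    have hsl : 0 < √(l j) := Real.sqrt_pos.2 hl0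
    have hslb : √(l j) ≤ √b := Real.sqrt_le_sqrt (hlb j)
    have h1 : ε + l j * (ε / g) ≤ √(l j) * (2 * √b * (ε / g)) := by
      have e1 : ε = g * (ε / g) := by field_simp
      have hr : 0 ≤ ε / g := div_nonneg hε hg.le
      have e2 : l j = √(l j) * √(l j) := (Real.mul_self_sqrt hl0.le).symm
      have e3 : √(l j) * √(l j) ≤ √(l j) * √b := mul_le_mul_of_nonneg_left hslb hsl.le
      calc ε + l j * (ε / g) = (g + l j) * (ε / g) := by rw [add_mul, ← e1]
        _ ≤ (2 * (√(l j) * √b)) * (ε / g) := mul_le_mul_of_nonneg_right (by linarith) hr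
        _ = _ := by ring
    exact le_of_mul_le_mul_left (h.trans h1) hsl
  -- Replacing `G` by `W` adds a second error. Squaring the sum and summing over columns yields `2 *
  -- 4 + 2 = 10`.
  have hcol : ∀ j, ‖∑ i, (√(s i) * W i j) • u i - √(l j) • v j‖ ^ 2 ≤
      2 * (2 * √b * (ε / g)) ^ 2 + 2 * (b * ∑ i, (W - G) i j ^ 2) := by
    intro j
    set x := ∑ i, (√(s i) * inner ℝ (u i) (v j)) • u i - √(l j) • v j with hxdef
    set z := ∑ i, (√(s i) * (W - G) i j) • u i with hzdef
    have e : ∑ i, (√(s i) * W i j) • u i - √(l j) • v j = x + z := by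
      simp only [hxdef, hzdef, Matrix.sub_apply, hG, Matrix.of_apply, mul_sub, sub_smul,
        Finset.sum_sub_distrib]
      abel
    have hz : ‖z‖ ^ 2 ≤ b * ∑ i, (W - G) i j ^ 2 := by
      rw [hzdef, norm_sq_sum_smul hu, Finset.mul_sum]
      refine Finset.sum_le_sum fun i _ => ?_
      rw [mul_pow, Real.sq_sqrt (hs0 i)]
      exact mul_le_mul_of_nonneg_right (hsb i) (sq_nonneg _)
    have hx2 := pow_le_pow_left₀ (norm_nonneg x) (hx j) 2
    rw [e]
    have h1 := pow_le_pow_left₀ (norm_nonneg _) (norm_add_le x z) 2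
    nlinarith [sq_nonneg (‖x‖ - ‖z‖)]
  refine (Finset.sum_le_sum fun j _ => hcol j).trans ?_
  rw [Finset.sum_add_distrib, Finset.sum_const, Finset.card_univ, Fintype.card_fin, nsmul_eq_mul,
    ← Finset.mul_sum, ← Finset.mul_sum, Finset.sum_comm]
  have h2 : (2 * √b * (ε / g)) ^ 2 = 4 * b * (ε / g) ^ 2 := by
    rw [mul_pow, mul_pow, Real.sq_sqrt hb.le]; ring
  rw [h2]
  have h3 := mul_le_mul_of_nonneg_left hWG hb.le
  linarith

end SubspacePerturbation

end

end LatentGraph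

namespace LatentGraph

noncomputable section

/-! ### From singular value decompositions to eigenvectors. -/

section SingularValueDecomposition

variable {n d : ℕ}

theorem frobeniusNorm_sq {m k : ℕ} (M : Matrix (Fin m) (Fin k) ℝ) :
    frobeniusNorm M ^ 2 = ∑ j, ‖(WithLp.toLp 2 (fun i => M i j) : EuclideanSpace ℝ (Fin m))‖ ^ 2 := by
  have h : frobeniusNorm M = (∑ i, ∑ j, ‖M i j‖ ^ (2 : ℝ)) ^ (1 / 2 : ℝ) :=
    Matrix.frobenius_norm_def M
  rw [h, ← Real.sqrt_eq_rpow, Real.sq_sqrt (by positivity), Finset.sum_comm]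
  refine Finset.sum_congr rfl fun j _ => ?_
  rw [EuclideanSpace.norm_sq_eq]
  simp

theorem frobeniusNorm_smul {m k : ℕ} {c : ℝ} (hc : 0 ≤ c) (M : Matrix (Fin m) (Fin k) ℝ) :
    frobeniusNorm (c • M) = c * frobeniusNorm M := by
  let _ := Matrix.frobeniusSeminormedAddCommGroup (m := Fin m) (n := Fin k) (α := ℝ)
  let _ := Matrix.frobeniusNormedSpace (m := Fin m) (n := Fin k) (α := ℝ) (R := ℝ)
  have := norm_smul c M
  rwa [Real.norm_of_nonneg hc] at this

theorem singularValue_smul {c : ℝ} (hc : 0 < c) (M : Matrix (Fin n) (Fin n) ℝ) (i : ℕ) :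
    singularValue (c • M) i = c * singularValue M i := by
  rw [singularValue, map_smul, singularValues_smul _ hc, singularValue]

theorem IsSVD.smul {c : ℝ} (hc : 0 < c) {M U V : Matrix (Fin n) (Fin n) ℝ} (h : IsSVD M U V) :
    IsSVD (c • M) U V := by
  refine ⟨h.1, h.2.1, ?_⟩
  have : (Matrix.diagonal fun i : Fin n => singularValue (c • M) (i + 1)) =
      c • Matrix.diagonal fun i : Fin n => singularValue M (i + 1) := by
    rw [← Matrix.diagonal_smul]
    congr 1
    funext i
    exact singularValue_smul hc M _
  rw [this, Matrix.mul_smul, Matrix.smul_mul]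
  exact congrArg _ h.2.2

theorem topEmbedding_smul {c : ℝ} (hc : 0 < c) (h : d ≤ n) (M U : Matrix (Fin n) (Fin n) ℝ) :
    topEmbedding h (c • M) U = √c • topEmbedding h M U := by
  unfold topEmbedding
  rw [← Matrix.mul_smul, ← Matrix.diagonal_smul]
  congr 2
  funext j
  rw [singularValue_smul hc, Real.sqrt_mul hc.le]
  rfl

/-- A column of a matrix as a Euclidean vector. -/
def columnVector (U : Matrix (Fin n) (Fin n) ℝ) (j : Fin n) : EuclideanSpace ℝ (Fin n) :=
  WithLp.toLp 2 fun i => U i j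

theorem orthonormal_columnVector {U : Matrix (Fin n) (Fin n) ℝ}
    (hU : U ∈ Matrix.orthogonalGroup (Fin n) ℝ) : Orthonormal ℝ (columnVector U) := by
  rw [orthonormal_iff_ite]
  intro i j
  have h : Uᵀ * U = 1 := (Matrix.mem_orthogonalGroup_iff' (Fin n) ℝ).1 hU
  have h1 := congrFun (congrFun h i) j
  rw [Matrix.mul_apply, Matrix.one_apply] at h1
  rw [← h1]
  simp [columnVector, PiLp.inner_apply, mul_comm]

variable {M U V : Matrix (Fin n) (Fin n) ℝ}

/-- Computing `M Mᵀ` eliminates `V`: any admissible `U` diagonalizes `M²`, whatever choices the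
decomposition made. -/
theorem IsSVD.mul_self_eq (h : IsSVD M U V) (hM : M.IsSymm) :
    M * M = U * Matrix.diagonal (fun i : Fin n => singularValue M (i + 1) ^ 2) * Uᵀ := by
  have hV : Vᵀ * V = 1 := (Matrix.mem_orthogonalGroup_iff' (Fin n) ℝ).1 h.2.1
  have h1 : M * M = M * Mᵀ := by rw [hM.eq]
  have h2 : M * Mᵀ = U * Matrix.diagonal (fun i : Fin n => singularValue M (i + 1)) * (Vᵀ * V) *
      Matrix.diagonal (fun i : Fin n => singularValue M (i + 1)) * Uᵀ := by
    have e := h.2.2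
    set S := Matrix.diagonal (fun i : Fin n => singularValue M (i + 1)) with hS
    have hSt : Sᵀ = S := Matrix.diagonal_transpose _
    clear_value S
    rw [e]
    simp only [Matrix.transpose_mul, Matrix.transpose_transpose, hSt, Matrix.mul_assoc]
  rw [h1, h2, hV, mul_one, Matrix.mul_assoc U, Matrix.diagonal_mul_diagonal]
  simp only [sq]

theorem toEuclideanLin_mul_apply (A B : Matrix (Fin n) (Fin n) ℝ) (w : EuclideanSpace ℝ (Fin n)) :
    Matrix.toEuclideanLin (A * B) w = Matrix.toEuclideanLin A (Matrix.toEuclideanLin B w) := by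
  simp [Matrix.toLpLin_apply, Matrix.mulVec_mulVec]

theorem IsSVD.apply_apply_columnVector (h : IsSVD M U V) (hM : M.IsSymm) (j : Fin n) :
    Matrix.toEuclideanLin M (Matrix.toEuclideanLin M (columnVector U j)) =
      singularValue M (j + 1) ^ 2 • columnVector U j := by
  have hU : Uᵀ * U = 1 := (Matrix.mem_orthogonalGroup_iff' (Fin n) ℝ).1 h.1
  have h1 : M * M * U = U * Matrix.diagonal (fun i : Fin n => singularValue M (i + 1) ^ 2) := by
    rw [h.mul_self_eq hM, Matrix.mul_assoc, hU, mul_one]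
  rw [← toEuclideanLin_mul_apply]
  ext i
  have h2 := congrFun (congrFun h1 i) j
  rw [Matrix.mul_diagonal, Matrix.mul_apply] at h2
  simp only [columnVector, Matrix.toLpLin_apply, Matrix.mulVec, dotProduct, PiLp.smul_apply,
    smul_eq_mul]
  rw [h2, mul_comm]

theorem IsSVD.norm_apply_le (h : IsSVD M U V) (hM : M.IsSymm) (hd : d ≤ n)
    {y : EuclideanSpace ℝ (Fin n)}
    (hy : ∀ i : Fin d, inner ℝ (columnVector U (Fin.castLE hd i)) y = 0) :
    ‖Matrix.toEuclideanLin M y‖ ≤ singularValue M (d + 1) * ‖y‖ := by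
  have hin : ∀ j, inner ℝ (columnVector U j) y = (Uᵀ *ᵥ y.ofLp) j := fun j => by
    simp [columnVector, PiLp.inner_apply, Matrix.mulVec, dotProduct, mul_comm]
  have hU2 : U * Uᵀ = 1 := (Matrix.mem_orthogonalGroup_iff (Fin n) ℝ).1 h.1
  have hsv0 : 0 ≤ singularValue M (d + 1) := LinearMap.singularValues_nonneg _ _
  refine le_of_sq_le_sq ?_ (mul_nonneg hsv0 (norm_nonneg _))
  rw [mul_pow, norm_toEuclideanLin_sq, norm_sq_eq_dotProduct]
  set w := y.ofLp
  have e1 : (M *ᵥ w) ⬝ᵥ (M *ᵥ w) =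
      ∑ j : Fin n, singularValue M (j + 1) ^ 2 * (Uᵀ *ᵥ w) j ^ 2 := by
    have : (M *ᵥ w) ⬝ᵥ (M *ᵥ w) = w ⬝ᵥ ((M * M) *ᵥ w) := by
      rw [← Matrix.mulVec_mulVec, Matrix.dotProduct_mulVec w, ← Matrix.mulVec_transpose, hM.eq]
    rw [this, h.mul_self_eq hM, ← Matrix.mulVec_mulVec, ← Matrix.mulVec_mulVec,
      Matrix.dotProduct_mulVec w, ← Matrix.mulVec_transpose, dotProduct]
    refine Finset.sum_congr rfl fun j _ => ?_
    rw [Matrix.mulVec_diagonal]; ring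
  have e2 : w ⬝ᵥ w = ∑ j, (Uᵀ *ᵥ w) j ^ 2 := by
    have : w ⬝ᵥ w = w ⬝ᵥ (U *ᵥ (Uᵀ *ᵥ w)) := by rw [Matrix.mulVec_mulVec, hU2, Matrix.one_mulVec]
    rw [this, Matrix.dotProduct_mulVec w, ← Matrix.mulVec_transpose, dotProduct]
    exact Finset.sum_congr rfl fun j _ => by ring
  rw [e1, e2, Finset.mul_sum]
  refine Finset.sum_le_sum fun j _ => ?_
  rcases lt_or_ge (j : ℕ) d with hj | hj
  · have := hy ⟨j, hj⟩
    rw [hin] at this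
    have e : Fin.castLE hd ⟨j, hj⟩ = j := rfl
    rw [e] at this
    rw [this]; simp
  · refine mul_le_mul_of_nonneg_right (pow_le_pow_left₀ (LinearMap.singularValues_nonneg _ _) ?_ 2)
      (sq_nonneg _)
    exact LinearMap.singularValues_antitone _ (by simpa using hj)

theorem topEmbedding_apply (h : d ≤ n) (M U : Matrix (Fin n) (Fin n) ℝ) (i : Fin n) (j : Fin d) :
    topEmbedding h M U i j = U i (Fin.castLE h j) * √(singularValue M (j + 1)) := by
  rw [topEmbedding, Matrix.mul_diagonal]
  rfl

/-- Perturbation bound for the leading spectral embedding of almost positive symmetric matrices. -/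
theorem exists_alignment_topEmbedding (hd : d ≤ n) {P Q UP VP UQ VQ : Matrix (Fin n) (Fin n) ℝ}
    (hP : P.IsSymm) (hQ : Q.IsSymm) (hUP : IsSVD P UP VP) (hUQ : IsSVD Q UQ VQ) {ε g η b : ℝ}
    (hε : 0 ≤ ε) (hg : 0 < g)
    (hPQ : ∀ w, ‖Matrix.toEuclideanLin (P - Q) w‖ ≤ ε * ‖w‖)
    (hPη : ∀ v, -η * ‖v‖ ^ 2 ≤ inner ℝ (Matrix.toEuclideanLin P v) v)
    (hQη : ∀ v, -η * ‖v‖ ^ 2 ≤ inner ℝ (Matrix.toEuclideanLin Q v) v)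
    (hPs : ∀ j : Fin d, η < singularValue P (j + 1))
    (hQs : ∀ j : Fin d, η < singularValue Q (j + 1))
    (hgap : ∀ j : Fin d, singularValue P (d + 1) + g ≤ singularValue Q (j + 1))
    (hPb : ∀ j : Fin d, singularValue P (j + 1) ≤ b)
    (hQb : ∀ j : Fin d, singularValue Q (j + 1) ≤ b) (hsmall : d * (ε / g) ^ 2 < 1) :
    ∃ W ∈ Matrix.orthogonalGroup (Fin d) ℝ,
      frobeniusNorm (topEmbedding hd P UP * W - topEmbedding hd Q UQ) ≤
        √(10 * b * (d * (ε / g) ^ 2)) := by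
  have hinj := Fin.castLE_injective hd
  obtain ⟨W, hW, hsum⟩ := exists_orthogonal_alignment (isSymmetric_toEuclideanLin hP)
    (Q := Matrix.toEuclideanLin Q)
    ((orthonormal_columnVector hUP.1).comp _ hinj) ((orthonormal_columnVector hUQ.1).comp _ hinj)
    (s := fun j : Fin d => singularValue P (j + 1)) (l := fun j : Fin d => singularValue Q (j + 1))
    (fun j => apply_eq_smul_of_sq_apply hPη (hPs j) (hUP.apply_apply_columnVector hP _))
    (fun j => apply_eq_smul_of_sq_apply hQη (hQs j) (hUQ.apply_apply_columnVector hQ _))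
    hg (fun w => by rw [← LinearMap.sub_apply, ← map_sub]; exact hPQ w)
    (fun y hy => hUP.norm_apply_le hP hd hy) (LinearMap.singularValues_nonneg _ _) hgap
    (fun j => LinearMap.singularValues_nonneg _ _) hPb hQb hε hsmall
  refine ⟨W, hW, Real.le_sqrt_of_sq_le ?_⟩
  rw [frobeniusNorm_sq]
  refine le_trans (le_of_eq (Finset.sum_congr rfl fun j _ => ?_)) hsum
  congr 2
  ext i
  simp only [Matrix.sub_apply, Matrix.mul_apply, topEmbedding_apply, Function.comp_apply,
    PiLp.sub_apply, PiLp.smul_apply, smul_eq_mul, WithLp.ofLp_sum, Finset.sum_apply,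
    WithLp.ofLp_smul, Pi.smul_apply, columnVector]
  rw [mul_comm (UQ _ _)]
  congr 1
  exact Finset.sum_congr rfl fun k _ => by ring

end SingularValueDecomposition

end

end LatentGraph

namespace LatentGraph

noncomputable section

/-! ### The deterministic conclusion on the good event. -/

section GoodEvent

variable {κ : SmallWorldKernel} {D : Measure I} [IsProbabilityMeasure D] {lam : ℕ → ℝ} {n : ℕ}

theorem eigengap_le_zeroth (hlam : IsEigenvalueSequence (κ.integralOperator D) lam) (d : ℕ) :
    eigengap lam d ≤ lam 0 := by
  have h1 := hlam.antitone (Nat.zero_le (d - 1))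
  have h2 := hlam.nonneg d
  rw [eigengap]; linarith

/-- The decay of the eigenvalues like `1 / m` prevents a large gap at a large index; this later
bounds the selected dimension. -/
theorem index_sub_one_mul_eigengap_le (hlam : IsEigenvalueSequence (κ.integralOperator D) lam)
    {d : ℕ} (hd : 1 ≤ d) : ((d : ℝ) - 1) * eigengap lam d ≤ 2 * κ.lip := by
  have hl := κ.lip_pos
  rcases hd.eq_or_lt with rfl | hd
  · simp [hl.le]
  have h1 := eigenvalue_le_of_le hlam (m := d - 1) (by omega) le_rfl
  have h2 := hlam.nonneg d
  have hd' : (0 : ℝ) < (d : ℝ) - 1 := by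
    have : (1 : ℝ) < d := by exact_mod_cast hd
    linarith
  rw [Nat.cast_sub hd.le, Nat.cast_one] at h1
  calc ((d : ℝ) - 1) * eigengap lam d ≤ ((d : ℝ) - 1) * (κ.lip * (2 / ((d : ℝ) - 1))) := by
        refine mul_le_mul_of_nonneg_left ?_ hd'.le
        rw [eigengap]; linarith
    _ = 2 * κ.lip := by field_simp

/-- The constant in the error bound. -/
def alignmentConstant (lam : ℕ → ℝ) : ℝ := 2 * √(10 * (lam 0 + 2)) * lam 0

theorem alignmentConstant_pos (h : 0 < lam 0) : 0 < alignmentConstant lam := by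
  unfold alignmentConstant
  positivity

/-- The left side has order `1 / δ`; writing it as `δ / δ²` and using `δ ≤ lam 0` produces the
stated form and the factor `lam 0` of the constant. -/
theorem mul_sqrt_le_alignmentConstant_mul {d : ℕ} {t ρ δ : ℝ} (h0 : 0 < lam 0) (ht : 0 < t)
    (hρ : 0 < ρ) (hδ : 0 < δ) (hδ0 : δ ≤ lam 0) :
    √n * √(10 * (lam 0 + 2) * (d * (t / ρ / (δ / 2)) ^ 2)) ≤
      alignmentConstant lam * (t * √(d * n) / (δ ^ 2 * ρ)) := by
  rw [alignmentConstant, Real.sqrt_mul (x := 10 * (lam 0 + 2)) (by positivity),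
    Real.sqrt_mul (Nat.cast_nonneg d), Real.sqrt_sq (by positivity),
    Real.sqrt_mul (Nat.cast_nonneg d)]
  have key : √n * (√(10 * (lam 0 + 2)) * (√d * (t / ρ / (δ / 2)))) =
      2 * √(10 * (lam 0 + 2)) * δ * (t * (√d * √n) / (δ ^ 2 * ρ)) := by
    field_simp
  rw [key]
  gcongr

/-- On the event that the noise is at most `t` in operator norm and that the empirical spectrum is
close to that of the integral operator, the threshold rule succeeds and the embeddings align. -/
theorem exists_thresholdIndex_alignment (hlam : IsEigenvalueSequence (κ.integralOperator D) lam)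
    (hn : n ≠ 0) {C ρ t h : ℝ} (hC : 1 ≤ C) (hρ : ρ = n / C) (ht : 0 < t)
    (hh : h = (t / ρ) ^ (2 / 29 : ℝ)) (x : Fin n → I) (e : Sym2 (Fin n) → Bool)
    (hnoise : ∀ v, ‖Matrix.toEuclideanLin (adjacency e - C⁻¹ • gramMatrix κ x) v‖ ≤ t * ‖v‖)
    (hform : ∀ v, -h * ‖v‖ ^ 2 ≤ inner ℝ (Matrix.toEuclideanLin (scaledGram κ x) v) v)
    (hsv : ∀ k, |(Matrix.toEuclideanLin (scaledGram κ x)).singularValues k - lam k| ≤ h)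
    (hε : t / ρ ≤ h ^ 3) (h1 : h ≤ 1) (hlip : κ.lip * h ≤ 1) {k₀ : ℕ} (hk1 : 1 ≤ k₀)
    (hkn : k₀ ≤ n) (hγ : 14 * h ≤ eigengap lam k₀) :
    ∃ (d : ℕ) (hd : d ≤ n), IsThresholdIndex (adjacency e) t ρ d ∧ 0 < eigengap lam d ∧
      ∀ UA VA UK VK : Matrix (Fin n) (Fin n) ℝ,
        IsSVD (adjacency e) UA VA → IsSVD (gramMatrix κ x) UK VK →
        ∃ W ∈ Matrix.orthogonalGroup (Fin d) ℝ,
          frobeniusNorm (√C • topEmbedding hd (adjacency e) UA * W -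
              topEmbedding hd (gramMatrix κ x) UK) ≤
            alignmentConstant lam * (t * √(d * n) / (eigengap lam d ^ 2 * ρ)) := by
  have hl := κ.lip_pos
  have hC0 : 0 < C := by linarith
  have hn0 : (0 : ℝ) < n := by positivity
  have hρ0 : 0 < ρ := by rw [hρ]; positivity
  set ε := t / ρ with hεdef
  have hε0 : 0 < ε := by positivity
  have hh0 : 0 < h := by rw [hh]; positivity
  have hεh : ε ≤ h := hε.trans (pow_le_of_le_one hh0.le h1 (by norm_num))
  set P := ρ⁻¹ • adjacency e with hPdef
  set Q := scaledGram κ x with hQdef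
  have hPQeq : P - Q = ρ⁻¹ • (adjacency e - C⁻¹ • gramMatrix κ x) := by
    rw [hPdef, hQdef, scaledGram, smul_sub, smul_smul, hρ]
    congr 2
    field_simp
  have hPQ : ∀ w, ‖Matrix.toEuclideanLin (P - Q) w‖ ≤ ε * ‖w‖ := by
    intro w
    rw [hPQeq, map_smul, LinearMap.smul_apply, norm_smul, Real.norm_of_nonneg (by positivity)]
    calc ρ⁻¹ * ‖Matrix.toEuclideanLin (adjacency e - C⁻¹ • gramMatrix κ x) w‖
        ≤ ρ⁻¹ * (t * ‖w‖) := by gcongr; exact hnoise w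
      _ = ε * ‖w‖ := by rw [hεdef]; ring
  have hPsv : ∀ k, |(Matrix.toEuclideanLin P).singularValues k - lam k| ≤ 2 * h := by
    intro k
    have hk := abs_singularValues_sub_le (T := Matrix.toEuclideanLin P)
      (S := Matrix.toEuclideanLin Q) (fun v => by rw [← map_sub]; exact hPQ v) hε0.le k
    have := abs_sub_le ((Matrix.toEuclideanLin P).singularValues k)
      ((Matrix.toEuclideanLin Q).singularValues k) (lam k)
    linarith [hsv k]
  have hPform : ∀ v, -(2 * h) * ‖v‖ ^ 2 ≤ inner ℝ (Matrix.toEuclideanLin P v) v := by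
    intro v
    have h2 : inner ℝ (Matrix.toEuclideanLin P v) v = inner ℝ (Matrix.toEuclideanLin Q v) v +
        inner ℝ (Matrix.toEuclideanLin (P - Q) v) v := by
      rw [← inner_add_left, map_sub, LinearMap.sub_apply, add_sub_cancel]
    have h3 := abs_real_inner_le_norm (Matrix.toEuclideanLin (P - Q) v) v
    have h4 := mul_le_mul_of_nonneg_right (hPQ v) (norm_nonneg v)
    have h5 := (abs_le.1 (h3.trans h4)).1
    have h6 := mul_le_mul_of_nonneg_right hεh (sq_nonneg ‖v‖)
    rw [h2]
    nlinarith [hform v]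
  have hQform : ∀ v, -(2 * h) * ‖v‖ ^ 2 ≤ inner ℝ (Matrix.toEuclideanLin Q v) v := fun v => by
    nlinarith [hform v, mul_nonneg hh0.le (sq_nonneg ‖v‖)]
  set S := {k : ℕ | 1 ≤ k ∧ k ≤ n ∧ 10 * ε ^ (2 / 29 : ℝ) ≤
    singularValue P k - singularValue P (k + 1)} with hS
  -- Two singular values, each moved by at most `2 * h`, cost `4 * h`: the gap `14 * h` at `k₀`
  -- leaves the required `10 * h`.
  have hSne : S.Nonempty := by
    refine ⟨k₀, hk1, hkn, ?_⟩
    rw [← hh]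
    have ha := (abs_le.1 (hPsv (k₀ - 1))).1
    have hb := (abs_le.1 (hPsv k₀)).2
    rw [eigengap] at hγ
    simp only [singularValue, Nat.add_sub_cancel]
    linarith
  have hSbdd : BddAbove S := ⟨n, fun k hk => hk.2.1⟩
  obtain ⟨d, hd⟩ : ∃ d, IsGreatest S d := ⟨sSup S, Nat.sSup_mem hSne hSbdd, fun k hk =>
    le_csSup hSbdd hk⟩
  have hd1 : 1 ≤ d := hd.1.1
  have hdn : d ≤ n := hd.1.2.1
  have hdgap := hd.1.2.2
  set δ := eigengap lam d with hδdef
  -- The same loss in reverse: `10 - 4 = 6`.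
  have hδ : 6 * h ≤ δ := by
    rw [← hh] at hdgap
    have ha := (abs_le.1 (hPsv (d - 1))).2
    have hb := (abs_le.1 (hPsv d)).1
    simp only [singularValue, Nat.add_sub_cancel] at hdgap
    rw [hδdef, eigengap]
    linarith
  have hδ0 : 0 < δ := by linarith
  have hlamj : ∀ j : Fin d, lam d + δ ≤ lam j := fun j => by
    have := hlam.antitone (show (j : ℕ) ≤ d - 1 by omega)
    rw [hδdef, eigengap]; linarith
  have hlamd := hlam.nonneg d
  have hlam0 : ∀ j, lam j ≤ lam 0 := fun j => hlam.antitone (Nat.zero_le j)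
  have hP : P.IsSymm := (isSymm_adjacency e).smul _
  have hQ : Q.IsSymm := (isSymm_gramMatrix κ x).smul _
  -- Here `ε ≤ h ^ 3` and `6 * h ≤ δ` make the ratio at most `h ^ 2 / 3`, while `(d - 1) * δ ≤ 2 *
  -- κ.lip` keeps `d * h` bounded.
  have hsmall : d * (ε / (δ / 2)) ^ 2 < 1 := by
    have h2 : ε / (δ / 2) ≤ h ^ 2 / 3 := by
      rw [div_le_iff₀ (by positivity)]
      calc ε ≤ h ^ 3 := hε
        _ = h ^ 2 / 3 * (6 * h / 2) := by ring
        _ ≤ h ^ 2 / 3 * (δ / 2) := by gcongr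
    have h3 : (d : ℝ) * h ≤ h + κ.lip / 3 := by
      have hd1' : (1 : ℝ) ≤ d := by exact_mod_cast hd1
      have := index_sub_one_mul_eigengap_le hlam hd1
      have := mul_le_mul_of_nonneg_left hδ (sub_nonneg.2 hd1')
      linarith
    have h4 : h ^ 3 ≤ 1 := pow_le_one₀ hh0.le h1
    have h5 : h ^ 2 ≤ 1 := pow_le_one₀ hh0.le h1
    calc (d : ℝ) * (ε / (δ / 2)) ^ 2 ≤ d * (h ^ 2 / 3) ^ 2 := by gcongr
      _ = (d * h) * (h ^ 3 / 9) := by ring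
      _ ≤ (h + κ.lip / 3) * (h ^ 3 / 9) := by gcongr
      _ = h * (h ^ 3 / 9) + (κ.lip * h) * (h ^ 2 / 27) := by ring
      _ ≤ 1 * (1 / 9) + 1 * (1 / 27) := by gcongr
      _ < 1 := by norm_num
  refine ⟨d, hdn, hd, hδ0, fun UA VA UK VK hA hK => ?_⟩
  have hsP : ∀ k : ℕ, |singularValue P (k + 1) - lam k| ≤ 2 * h := hPsv
  have hsQ : ∀ k : ℕ, |singularValue Q (k + 1) - lam k| ≤ h := hsv
  obtain ⟨W, hW, hbound⟩ := exists_alignment_topEmbedding hdn hP hQ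
    (hA.smul (inv_pos.2 hρ0)) (hK.smul (inv_pos.2 hn0)) hε0.le (half_pos hδ0) hPQ hPform hQform
    (fun j => by linarith [(abs_le.1 (hsP j)).1, hlamj j])
    (fun j => by linarith [(abs_le.1 (hsQ j)).1, hlamj j])
    -- The cross gap between `P` and `Q` is at least `δ - 3 * h`, hence at least `δ / 2`.
    (fun j => by linarith [(abs_le.1 (hsP d)).2, (abs_le.1 (hsQ j)).1, hlamj j])
    (b := lam 0 + 2) (fun j => by linarith [(abs_le.1 (hsP j)).2, hlam0 j])
    (fun j => by linarith [(abs_le.1 (hsQ j)).2, hlam0 j]) hsmall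
  refine ⟨W, hW, ?_⟩
  have e1 : √C • topEmbedding hdn (adjacency e) UA = √(n : ℝ) • topEmbedding hdn P UA := by
    rw [hPdef, topEmbedding_smul (inv_pos.2 hρ0), smul_smul, ← Real.sqrt_mul hn0.le, hρ]
    congr 2
    field_simp
  have e2 : topEmbedding hdn (gramMatrix κ x) UK = √(n : ℝ) • topEmbedding hdn Q UK := by
    rw [hQdef, scaledGram, topEmbedding_smul (inv_pos.2 hn0), smul_smul, ← Real.sqrt_mul hn0.le,
      mul_inv_cancel₀ hn0.ne', Real.sqrt_one, one_smul]
  rw [e1, e2, Matrix.smul_mul, ← smul_sub, frobeniusNorm_smul (Real.sqrt_nonneg _)]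
  exact (mul_le_mul_of_nonneg_left hbound (Real.sqrt_nonneg _)).trans
    (mul_sqrt_le_alignmentConstant_mul (eigenvalue_zero_pos hlam) ht hρ0 hδ0
      (eigengap_le_zeroth hlam d))

end GoodEvent

end

end LatentGraph

namespace LatentGraph

noncomputable section

/-! ### Choice of parameters and asymptotic estimates. -/

section Asymptotics

open Topology

theorem eventually_const_mul_log_le {f : ℕ → ℝ} (hf : ∀ᶠ n in atTop, 0 ≤ f n)
    (h : (fun n : ℕ => Real.log n) =o[atTop] f) {K : ℝ} (hK : 0 < K) :
    ∀ᶠ n : ℕ in atTop, K * Real.log n ≤ f n := by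
  filter_upwards [h.bound (inv_pos.2 hK), hf] with n hn h0
  rw [Real.norm_of_nonneg h0, ← div_eq_inv_mul, le_div_iff₀ hK] at hn
  linarith [mul_le_mul_of_nonneg_right (Real.le_norm_self (Real.log n)) hK.le]

theorem tendsto_natCast_rpow_atTop {a : ℝ} (ha : 0 < a) :
    Tendsto (fun n : ℕ => (n : ℝ) ^ a) atTop atTop :=
  (tendsto_rpow_atTop ha).comp tendsto_natCast_atTop_atTop

theorem eventually_one_le_log : ∀ᶠ n : ℕ in atTop, 1 ≤ Real.log n :=
  (Real.tendsto_log_atTop.comp tendsto_natCast_atTop_atTop).eventually_ge_atTop 1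

/-- The number of cells in the partition of `[0, 1]` for `n` sample points. -/
def cellCount (n : ℕ) : ℕ := ⌈(n : ℝ) ^ (1 / 10 : ℝ)⌉₊

theorem cellCount_ne_zero {n : ℕ} (hn : n ≠ 0) : cellCount n ≠ 0 :=
  (Nat.ceil_pos.2 (by positivity)).ne'

theorem le_cellCount (n : ℕ) : (n : ℝ) ^ (1 / 10 : ℝ) ≤ cellCount n := Nat.le_ceil _

theorem cellCount_le {n : ℕ} (hn : n ≠ 0) : (cellCount n : ℝ) ≤ 2 * (n : ℝ) ^ (1 / 10 : ℝ) := by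
  have h1 : (1 : ℝ) ≤ n := by exact_mod_cast Nat.one_le_iff_ne_zero.2 hn
  have h2 := Real.one_le_rpow h1 (show (0 : ℝ) ≤ 1 / 10 by norm_num)
  have h3 := Nat.ceil_lt_add_one (show 0 ≤ (n : ℝ) ^ (1 / 10 : ℝ) by positivity)
  rw [cellCount]; linarith

/-- With about `n^(1/10)` cells and mass error `τ = n^(-2/5)`, both `1 / m` and `m √τ` have order
`n^(-1/10)`, which is below `n^(-1/29)`. -/
theorem eventually_discretization_error_le (l : ℝ) (hl : 0 < l) :
    ∀ᶠ n : ℕ in atTop, 2 * (l * (2 / (cellCount n : ℝ))) +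
      2 * cellCount n * √((n : ℝ) ^ (-(2 / 5) : ℝ)) ≤ (n : ℝ) ^ (-(1 / 29) : ℝ) := by
  filter_upwards [eventually_ne_atTop 0, (tendsto_natCast_rpow_atTop
    (show (0 : ℝ) < 1 / 10 - 1 / 29 by norm_num)).eventually_ge_atTop (4 * l + 4)] with n hn hlarge
  have hn0 : (0 : ℝ) < n := by positivity
  have h1 : √((n : ℝ) ^ (-(2 / 5) : ℝ)) = (n : ℝ) ^ (-(1 / 10) : ℝ) * (n : ℝ) ^ (-(1 / 10) : ℝ) := by
    rw [Real.sqrt_eq_rpow, ← Real.rpow_mul hn0.le, ← Real.rpow_add hn0]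
    norm_num
  have h2 : (n : ℝ) ^ (1 / 10 : ℝ) * (n : ℝ) ^ (-(1 / 10) : ℝ) = 1 := by
    rw [← Real.rpow_add hn0]; norm_num
  have h3 : 2 / (cellCount n : ℝ) ≤ 2 * (n : ℝ) ^ (-(1 / 10) : ℝ) := by
    rw [Real.rpow_neg hn0.le, ← div_eq_mul_inv]
    exact div_le_div_of_nonneg_left zero_le_two (by positivity) (le_cellCount n)
  have h4 : (n : ℝ) ^ (1 / 10 - 1 / 29 : ℝ) * (n : ℝ) ^ (-(1 / 10) : ℝ) =
      (n : ℝ) ^ (-(1 / 29) : ℝ) := by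
    rw [← Real.rpow_add hn0]; norm_num
  rw [h1, ← h4]
  set y := (n : ℝ) ^ (-(1 / 10) : ℝ) with hy
  have hy0 : 0 < y := by positivity
  calc 2 * (l * (2 / (cellCount n : ℝ))) + 2 * cellCount n * (y * y)
      ≤ 2 * (l * (2 * y)) + 2 * (2 * (n : ℝ) ^ (1 / 10 : ℝ)) * (y * y) := by
        gcongr; exact cellCount_le hn
    _ = 4 * l * y + 4 * ((n : ℝ) ^ (1 / 10 : ℝ) * y) * y := by ring
    _ = (4 * l + 4) * y := by rw [h2]; ring
    _ ≤ _ := by gcongr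

/-- For the same `τ` the Hoeffding exponent is `2 n τ² = 2 n^(1/5)`, which beats every power of `n`.
-/
theorem eventually_discretization_tail_le (c : ℝ) :
    ∀ᶠ n : ℕ in atTop, 2 * (cellCount n : ℝ) *
      Real.exp (-(2 * n * ((n : ℝ) ^ (-(2 / 5) : ℝ)) ^ 2)) ≤ 1 / 4 * (1 / (n : ℝ) ^ c) := by
  have hlim := (tendsto_rpow_mul_exp_neg_mul_atTop_nhds_zero (1 / 2 + 5 * c) 2 two_pos).comp
    (tendsto_natCast_rpow_atTop (show (0 : ℝ) < 1 / 5 by norm_num))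
  filter_upwards [eventually_ne_atTop 0,
    hlim.eventually_le_const (show (0 : ℝ) < 1 / 16 by norm_num)] with n hn h
  have hn0 : (0 : ℝ) < n := by positivity
  have h1 : 2 * (n : ℝ) * ((n : ℝ) ^ (-(2 / 5) : ℝ)) ^ 2 = 2 * (n : ℝ) ^ (1 / 5 : ℝ) := by
    rw [← Real.rpow_natCast, ← Real.rpow_mul hn0.le, mul_assoc]
    congr 1
    nth_rewrite 1 [← Real.rpow_one (n : ℝ)]
    rw [← Real.rpow_add hn0]; norm_num
  have h2 : ((n : ℝ) ^ (1 / 5 : ℝ)) ^ (1 / 2 + 5 * c) = (n : ℝ) ^ (1 / 10 : ℝ) * (n : ℝ) ^ c := by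
    rw [← Real.rpow_mul hn0.le, ← Real.rpow_add hn0]
    congr 1; ring
  simp only [Function.comp_apply, h2] at h
  have hc0 : 0 < (n : ℝ) ^ c := by positivity
  rw [h1, ← mul_div_assoc, mul_one, le_div_iff₀ hc0]
  have h3 := mul_le_mul_of_nonneg_right (cellCount_le hn)
    (mul_nonneg (Real.exp_nonneg (-(2 * (n : ℝ) ^ (1 / 5 : ℝ)))) hc0.le)
  rw [neg_mul] at h
  linarith

theorem eventually_noise_tail_le {ρ t : ℕ → ℝ} (hρ : ∀ᶠ n in atTop, 0 < ρ n)
    (ht : ∀ᶠ n in atTop, 0 < t n) (hlogt : (fun n : ℕ => Real.log n) =o[atTop]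
      (fun n => t n ^ 2 / ρ n)) (c : ℝ) :
    ∀ᶠ n : ℕ in atTop, (n : ℝ) * (⌈(|c| + 3) * Real.log n⌉₊ * ρ n * Real.exp 3 / t n ^ 2) ^
      ⌈(|c| + 3) * Real.log n⌉₊ ≤ 1 / 4 * (1 / (n : ℝ) ^ c) := by
  have hK : 0 < Real.exp 4 * (|c| + 4) := by positivity
  have hpos : ∀ᶠ n in atTop, 0 ≤ t n ^ 2 / ρ n := by
    filter_upwards [hρ] with n hn
    positivity
  filter_upwards [hρ, ht, eventually_one_le_log, eventually_const_mul_log_le hpos hlogt hK,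
    eventually_ge_atTop 2] with n hρ ht hlog hK hn
  have hn2 : (2 : ℝ) ≤ n := by exact_mod_cast hn
  have hn0 : (0 : ℝ) < n := by linarith
  set s := ⌈(|c| + 3) * Real.log n⌉₊ with hs
  have hs1 : (|c| + 3) * Real.log n ≤ s := Nat.le_ceil _
  have hs2 : (s : ℝ) ≤ (|c| + 4) * Real.log n := by
    have := Nat.ceil_lt_add_one (show 0 ≤ (|c| + 3) * Real.log n by positivity)
    rw [← hs] at this
    linarith
  -- This is where `t² / ρ` must dominate `log n`; the `s`-th power is then at most `exp (-s)`, and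
  -- `s ≥ (|c| + 3) log n` leaves `n^(-2-c)` after the factor `n`.
  have hbase : s * ρ n * Real.exp 3 / t n ^ 2 ≤ Real.exp (-1) := by
    rw [div_le_iff₀ (by positivity)]
    have h1 : Real.exp 4 * s ≤ t n ^ 2 / ρ n := by
      refine le_trans ?_ hK
      rw [mul_assoc]
      gcongr
    rw [le_div_iff₀ hρ] at h1
    have h2 : Real.exp (-1) * Real.exp 4 = Real.exp 3 := by rw [← Real.exp_add]; norm_num
    calc s * ρ n * Real.exp 3 = Real.exp (-1) * (Real.exp 4 * s * ρ n) := by rw [← h2]; ring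
      _ ≤ _ := by gcongr
  calc (n : ℝ) * (s * ρ n * Real.exp 3 / t n ^ 2) ^ s ≤ n * Real.exp (-1) ^ s := by gcongr
    _ = n * Real.exp (-s) := by rw [← Real.exp_nat_mul]; congr 2; ring
    _ ≤ n * Real.exp (Real.log n * (-(3 + c))) := by
        gcongr
        nlinarith [le_abs_self c]
    _ = (n : ℝ) ^ (-2 : ℝ) * (n : ℝ) ^ (-c) := by
        rw [← Real.rpow_def_of_pos hn0, ← Real.rpow_add hn0]
        nth_rewrite 1 [← Real.rpow_one (n : ℝ)]
        rw [← Real.rpow_add hn0]; congr 1; ring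
    _ ≤ 1 / 4 * (1 / (n : ℝ) ^ c) := by
        rw [Real.rpow_neg hn0.le c, one_div, one_div]
        gcongr
        rw [Real.rpow_neg hn0.le, Real.rpow_two]
        gcongr
        nlinarith

/-- Eventually `t² / ρ ≥ 1`, and `ρ ≤ n`, so `(t / ρ)² ≥ 1 / n`. Hence the threshold exceeds the
sampling error of the spectrum. -/
theorem eventually_rpow_le_threshold {C ρ t : ℕ → ℝ} (hC : ∀ᶠ n in atTop, 1 ≤ C n)
    (hρ : ∀ n : ℕ, ρ n = n / C n) (ht : ∀ᶠ n in atTop, 0 < t n)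
    (hlogt : (fun n : ℕ => Real.log n) =o[atTop] (fun n => t n ^ 2 / ρ n)) :
    ∀ᶠ n : ℕ in atTop, (n : ℝ) ^ (-(1 / 29) : ℝ) ≤ (t n / ρ n) ^ (2 / 29 : ℝ) := by
  have hpos : ∀ᶠ n in atTop, 0 ≤ t n ^ 2 / ρ n := by
    filter_upwards [hC] with n hn
    rw [hρ n]; positivity
  filter_upwards [hC, ht, eventually_one_le_log, eventually_const_mul_log_le hpos hlogt one_pos,
    eventually_ne_atTop 0] with n hC ht hlog hK hn
  have hn0 : (0 : ℝ) < n := by positivity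
  have hρ0 : 0 < ρ n := by rw [hρ n]; positivity
  have hρn : ρ n ≤ n := by rw [hρ n]; exact div_le_self hn0.le hC
  have h1 : ((n : ℝ))⁻¹ ≤ (t n / ρ n) ^ (2 : ℝ) := by
    rw [Real.rpow_two, inv_eq_one_div, show (t n / ρ n) ^ 2 = t n ^ 2 / ρ n / ρ n by
      field_simp]
    gcongr
    linarith
  calc (n : ℝ) ^ (-(1 / 29) : ℝ) = ((n : ℝ)⁻¹) ^ (1 / 29 : ℝ) := by
        rw [Real.rpow_neg hn0.le, Real.inv_rpow hn0.le]
    _ ≤ ((t n / ρ n) ^ (2 : ℝ)) ^ (1 / 29 : ℝ) := by gcongr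
    _ = (t n / ρ n) ^ (2 / 29 : ℝ) := by
        rw [← Real.rpow_mul (by positivity)]; norm_num

theorem le_rpow_pow_three {ε : ℝ} (h0 : 0 < ε) (h1 : ε ≤ 1) : ε ≤ (ε ^ (2 / 29 : ℝ)) ^ 3 := by
  rw [← Real.rpow_natCast, ← Real.rpow_mul h0.le]
  nth_rewrite 1 [← Real.rpow_one ε]
  exact Real.rpow_le_rpow_of_exponent_ge h0 h1 (by norm_num)

end Asymptotics

end

end LatentGraph

/-! ### Assembling the main theorem. -/

open LatentGraph in
theorem mainTheorem8 (κ : SmallWorldKernel) (D : Measure I) [IsProbabilityMeasure D]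
    (lam : ℕ → ℝ) (hlam : IsEigenvalueSequence (κ.integralOperator D) lam) :
    ∃ M : ℝ, 0 < M ∧
      ∀ C ρ t : ℕ → ℝ, (∀ᶠ n in atTop, 1 ≤ C n) → (∀ n : ℕ, ρ n = n / C n) →
        (∀ᶠ n in atTop, 0 < t n) →
        (fun n : ℕ => Real.log n) =o[atTop] ρ →
        t =o[atTop] ρ →
        (fun n : ℕ => Real.log n) =o[atTop] (fun n => t n ^ 2 / ρ n) →
        ∀ c : ℝ, ∀ᶠ n : ℕ in atTop,
          modelLaw κ D (C n) n
            {ω | ¬ ∃ (d : ℕ) (hd : d ≤ n), IsThresholdIndex (adjacency ω.2) (t n) (ρ n) d ∧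
              0 < eigengap lam d ∧
              ∀ UA VA UK VK : Matrix (Fin n) (Fin n) ℝ,
                IsSVD (adjacency ω.2) UA VA → IsSVD (gramMatrix κ ω.1) UK VK →
                ∃ W ∈ Matrix.orthogonalGroup (Fin d) ℝ,
                  frobeniusNorm (√(C n) • topEmbedding hd (adjacency ω.2) UA * W -
                      topEmbedding hd (gramMatrix κ ω.1) UK) ≤
                    M * (t n * √(d * n) / (eigengap lam d ^ 2 * ρ n))}
            < ENNReal.ofReal (1 / (n : ℝ) ^ c) := by
  refine ⟨alignmentConstant lam, alignmentConstant_pos (eigenvalue_zero_pos hlam), ?_⟩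
  intro C ρ t hC hρ ht hlogρ htρ hlogt c
  obtain ⟨k₀, hk1, hγ⟩ := exists_eigengap_pos hlam
  have hl := κ.lip_pos
  have hρ0 : ∀ᶠ n in atTop, 0 < ρ n := by
    filter_upwards [hC, eventually_ne_atTop 0] with n hC hn
    rw [hρ n]; positivity
  have hε : Tendsto (fun n => t n / ρ n) atTop (nhds 0) := htρ.tendsto_div_nhds_zero
  have hh : Tendsto (fun n => (t n / ρ n) ^ (2 / 29 : ℝ)) atTop (nhds 0) := by
    have := hε.rpow_const (p := (2 / 29 : ℝ)) (Or.inr (by norm_num))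
    rwa [Real.zero_rpow (by norm_num)] at this
  filter_upwards [hC, ht, hρ0, eventually_one_le_log, eventually_ne_atTop 0,
    eventually_ge_atTop k₀, hε.eventually_le_const one_pos, hh.eventually_le_const one_pos,
    hh.eventually_le_const (inv_pos.2 hl),
    hh.eventually_le_const (show 0 < eigengap lam k₀ / 14 by positivity),
    eventually_const_mul_log_le (hρ0.mono fun n h => h.le) hlogρ
      (show 0 < |c| + 4 by positivity),
    eventually_discretization_error_le κ.lip hl, eventually_discretization_tail_le c,
    eventually_noise_tail_le hρ0 ht hlogt c, eventually_rpow_le_threshold hC hρ ht hlogt]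
    with n hC ht hρ0 hlog hn hkn hε1 hh1 hhl hhγ hsρ hη htail hnoise hthr
  have hn0 : (0 : ℝ) < n := by positivity
  set s := ⌈(|c| + 3) * Real.log n⌉₊ with hs
  have hs0 : s ≠ 0 := (Nat.ceil_pos.2 (by positivity)).ne'
  have hsle : (s : ℝ) ≤ ρ n := by
    have := Nat.ceil_lt_add_one (show 0 ≤ (|c| + 3) * Real.log n by positivity)
    rw [← hs] at this
    linarith
  have hm := cellCount_ne_zero hn
  set τ := (n : ℝ) ^ (-(2 / 5) : ℝ) with hτ
  set h := (t n / ρ n) ^ (2 / 29 : ℝ) with hhdef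
  have hpos : 0 < 1 / (n : ℝ) ^ c := by positivity
  calc modelLaw κ D (C n) n _
      ≤ modelLaw κ D (C n) n ({ω | t n ^ (2 * s) <
          ((adjacency ω.2 - (C n)⁻¹ • gramMatrix κ ω.1) ^ (2 * s)).trace} ∪
          {ω | ω.1 ∈ cellDeviation D n hm τ}) := by
        -- The bad set itself need not be measurable: it is covered by two measurable events, each
        -- of probability at most a quarter of the allowed bound, which also makes the final
        -- inequality strict.
        refine measure_mono fun ω hω => ?_
        by_contra hgood
        simp only [Set.mem_union, Set.mem_ofPred_eq, cellDeviation, not_or, not_lt,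
          not_exists] at hgood
        obtain ⟨hform, hsv⟩ := singularValues_scaledGram_close hlam hn hm ω.1 hgood.2 rfl
        have hηh := hη.trans hthr
        refine hω (exists_thresholdIndex_alignment hlam hn hC (hρ n) ht hhdef ω.1 ω.2
          (norm_toEuclideanLin_le_of_trace_pow_le
            ((isSymm_adjacency ω.2).sub ((isSymm_gramMatrix κ ω.1).smul _)) ht.le hs0 hgood.1)
          (fun v => le_trans ?_ (hform v)) (fun k => (hsv k).trans hηh)
          (le_rpow_pow_three (by positivity) hε1) hh1 ?_ hk1 hkn (by linarith))
        · gcongr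
        · rwa [← le_div_iff₀' hl, one_div]
    _ ≤ _ := measure_union_le _ _
    _ ≤ ENNReal.ofReal (1 / 4 * (1 / (n : ℝ) ^ c)) + ENNReal.ofReal (1 / 4 * (1 / (n : ℝ) ^ c)) := by
        refine add_le_add ((modelLaw_trace_pow_gt_le κ D hC (hρ n) hρ0 ht hs0 hsle).trans
          (ENNReal.ofReal_le_ofReal hnoise)) ?_
        rw [modelLaw_fst_preimage κ D _ (measurableSet_cellDeviation hm τ)]
        exact (pi_cellDeviation_le hn hm (by positivity)).trans (ENNReal.ofReal_le_ofReal htail)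
    _ = ENNReal.ofReal (1 / 2 * (1 / (n : ℝ) ^ c)) := by
        rw [← ENNReal.ofReal_add (by positivity) (by positivity)]; congr 1; ring
    _ < ENNReal.ofReal (1 / (n : ℝ) ^ c) := by
        rw [ENNReal.ofReal_lt_ofReal_iff hpos]; linarith
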